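/- **Setting.** Let $(\mathcal S,\mathcal A,P,\{r_m\}_{m=1}^M,\gamma,\rho)$ be a discounted Markov decision process with measurable state and action spaces, $M\ge 1$ rewards $r_m:\mathcal S\times\mathcal A\to[0,1]$, discount factor $\gamma\in(0,1)$ and initial distribution $\rho$. For a stationary policy $\pi$ let $J_m^\pi=\mathbb E_\pi[\sum_{t\ge0}\gamma^t r_m(s_t,a_t)]$ and $\mathbf J^\pi=(J_1^\pi,\dots,J_M^\pi)$, let $A_m^\pi=Q_m^\pi-V_m^\pi$ be the advantage functions, and let $d_\rho^\pi=(1-\gamma)\sum_t\gamma^t\,\mathbb P_\pi(s_t\in\cdot)$. Let $\pi_\theta(a|s)$, $\theta\in\mathbb R^d$, be policies with positive densities with respect to a fixed $\sigma$-finite measure on $\mathcal A$, let $\psi_\theta(s,a)=\nabla_\theta\log\pi_\theta(a|s)$, $F(\theta)=\mathbb E_{s\sim d_\rho^{\pi_\theta},a\sim\pi_\theta}[\psi_\theta\psi_\theta^\top]$, and $\omega^*_\theta=F(\theta)^{-1}\nabla_\theta f(\mathbf J^{\pi_\theta})$. Let $\pi^*$ be an optimal policy (optimality is not needed: any stationary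 policy is allowed). **Assumptions.** 1. $f:\mathbb R^M\to\mathbb R$ is concave; its partial derivatives $\partial_m f$ exist on $[0,\frac1{1-\gamma}]^M$ and are there $L_f$-Lipschitz in the Euclidean norm and bounded by $C>0$ in absolute value. 2. $\|\psi_\theta(s,a)\|\le G_1$ and $\|\psi_{\theta_1}(s,a)-\psi_{\theta_2}(s,a)\|\le G_2\|\theta_1-\theta_2\|$ for all $\theta,\theta_1,\theta_2,s,a$, where $G_1,G_2>0$. 3. $F(\theta)\succeq\mu I$ for all $\theta$, where $\mu>0$. 4. For all $\theta$, $\ \mathbb E_{s\sim d_\rho^{\pi^*},a\sim\pi^*}\big[\big(\sum_m\partial_mf(\mathbf J^{\pi_\theta})A_m^{\pi_\theta}(s,a)-(1-\gamma)\langle\omega_\theta^*,\psi_\theta(s,a)\rangle\big)^2\big]\le\varepsilon_{\rm bias}$. 5. $\mathbb E_{s\sim d_\rho^{\pi^*}}\mathrm{KL}(\pi^*(\cdot|s)\,\|\,\pi_{\theta_0}(\cdot|s))\le D<\infty$. **Algorithm (MLMC-NPG).** Start at $\theta_0$. For $k=0,\dots,K-1$: draw a level $Q_k$ with $\Pr(Q_k=q)=2^{-q}$,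 $q\ge1$; put $\bar Q_k=Q_k\mathbf 1\{2^{Q_k}\le B_{\max}\}$; sample $B_k=2^{\bar Q_k}$ trajectories of length $H$ from $\pi_{\theta_k}$; with $\widehat{\mathbf J}_b$ the average of the truncated return vectors $\sum_{t<H}\gamma^t\mathbf r(s_t,a_t)$ of the first $b$ of them, form $$p_m=\partial_mf(\widehat{\mathbf J}_1)+\mathbf 1\{2^{Q_k}\le B_{\max}\}\,2^{Q_k}\big(\partial_mf(\widehat{\mathbf J}_{2^{Q_k}})-\partial_mf(\widehat{\mathbf J}_{2^{Q_k-1}})\big).$$ Starting from a given vector $\omega_0^k$, for $n=0,\dots,N-1$ sample $B$ fresh trajectories of length $H$ from $\pi_{\theta_k}$, let $\hat g_n$ and $\hat F_n$ be the averages over them of $\sum_{t<H}\psi_{\theta_k}(s_t,a_t)\sum_mp_m\sum_{h=t}^{H-1}\gamma^hr_m(s_h,a_h)$ and of $\sum_{t<H}\gamma^t\psi_{\theta_k}(s_t,a_t)\psi_{\theta_k}(s_t,a_t)^\top$, and put $\omega_{n+1}^k=\omega_n^k-\beta(\hat F_n\omega_n^k-\hat g_n)$. Then $\theta_{k+1}=\theta_k+\alpha\,\omega_N^k$.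 All draws are independent given $\theta_k$. **Parameters.** Let $\epsilon\in(0,\frac12]$, $L_J=\frac{MCG_2}{(1-\gamma)^2}$, and let $R_0>0$ satisfy $\|\omega_0^k-\omega_\theta^*\|\le R_0$ for all $k,\theta$. Take $$\alpha=\frac{\mu\epsilon\log(1/\epsilon)}{4L_JG_1^2},\quad B_{\max}=\frac1{\epsilon^2},\quad \frac{c_1}{\alpha\epsilon}\le K\le\frac{c_2}{\alpha\epsilon},\quad N=\Big\lceil\frac{4CMG_1}{\mu^2(1-\gamma)^2}\log\frac{R_0^2}{\epsilon^2}\Big\rceil,\quad H=\Big\lceil\frac{2\log(1/\epsilon)}{\log(1/\gamma)}\Big\rceil,\quad B=1$$ (with $N=0$ if the logarithm is negative), where $c_1>0$, and any inner step size with $\frac{\mu(1-\gamma)^3}{4CMG_1}\le\beta\le\frac{1-\gamma}{G_1^2}$. (Such $\beta$ exist once $C\ge\mu G_1(1-\gamma)^2/(4M)$, which may be arranged by enlarging $C$.) **Theorem.** There are an absolute constant $p\in\mathbb N$ and a constant $c$ depending only on $M,\gamma,L_f,C,G_1,G_2,\mu,R_0,D,c_1,c_2$ such that for all such problems, all $\epsilon\in(0,\frac12]$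 and every run of the algorithm, each $f(\mathbf J^{\pi_{\theta_k}})$ is integrable, $$f(\mathbf J^{\pi^*})-\frac1K\sum_{k=0}^{K-1}\mathbb E\big[f(\mathbf J^{\pi_{\theta_k}})\big]\le\frac{\sqrt{\varepsilon_{\rm bias}}}{1-\gamma}+c\,\epsilon\log^p(1/\epsilon),$$ and the expected number of samples satisfies $$\mathbb E\Big[\sum_{k=0}^{K-1}H\,(B_k+NB)\Big]\le c\,\epsilon^{-2}\log^p(1/\epsilon).$$ -/

import Mathlib

open MeasureTheory ProbabilityTheory
open scoped ENNReal

noncomputable section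

namespace MORL

/-- The parameter space `ℝ^d`, and the space `ℝ^M` of return vectors, with the Euclidean norm. -/
abbrev Euc (d : ℕ) : Type := EuclideanSpace ℝ (Fin d)

/-- An infinite trajectory `(s_0, a_0), (s_1, a_1), …`. A trajectory of length `H` is read off
from its first `H` coordinates. -/
abbrev Traj (S A : Type*) : Type _ := ℕ → S × A

/-- Multi-objective Markov decision process with `M` rewards in `[0, 1]` (the discount factor is
kept as a separate argument). -/
structure MDP (S A : Type*) [MeasurableSpace S] [MeasurableSpace A] (M : ℕ) where
  P : Kernel (S × A) S
  P_markov : IsMarkovKernel P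
  r : Fin M → S × A → ℝ
  r_measurable : ∀ m, Measurable (r m)
  r_mem : ∀ m x, r m x ∈ Set.Icc (0 : ℝ) 1
  ρ : Measure S
  ρ_prob : IsProbabilityMeasure ρ

attribute [instance] MDP.P_markov MDP.ρ_prob

/-- A parametrized class of stationary stochastic policies `π_θ(a|s)`, `θ ∈ ℝ^d`, given by
positive densities with respect to a fixed reference measure on the actions (counting measure for
discrete actions, Lebesgue measure for Gaussian policies, …). -/
structure PolicyClass (S A : Type*) [MeasurableSpace S] [MeasurableSpace A] (d : ℕ) where
  ref : Measure A
  ref_sigmaFinite : SigmaFinite ref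
  dens : Euc d → S → A → ℝ
  dens_measurable : ∀ θ, Measurable (Function.uncurry (dens θ))
  dens_pos : ∀ θ s a, 0 < dens θ s a
  dens_lintegral : ∀ θ s, ∫⁻ a, ENNReal.ofReal (dens θ s a) ∂ref = 1

attribute [instance] PolicyClass.ref_sigmaFinite

variable {S A : Type*} [MeasurableSpace S] [MeasurableSpace A] {M d : ℕ}

namespace PolicyClass

/-- The policy `π_θ` as a kernel from states to actions. -/
def policy (𝓟 : PolicyClass S A d) (θ : Euc d) : Kernel S A :=
  (Kernel.const S 𝓟.ref).withDensity (fun s a => ENNReal.ofReal (𝓟.dens θ s a))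

instance (𝓟 : PolicyClass S A d) (θ : Euc d) : IsMarkovKernel (𝓟.policy θ) := by
  refine ⟨fun s => ⟨?_⟩⟩
  have hm : Measurable (Function.uncurry fun s a => ENNReal.ofReal (𝓟.dens θ s a)) :=
    (𝓟.dens_measurable θ).ennreal_ofReal
  rw [policy, Kernel.withDensity_apply _ hm, withDensity_apply _ MeasurableSet.univ]
  simpa using 𝓟.dens_lintegral θ s

/-- The score function `∇_θ log π_θ(a|s)`. -/
def score (𝓟 : PolicyClass S A d) (θ : Euc d) (x : S × A) : Euc d :=
  gradient (fun θ' => Real.log (𝓟.dens θ' x.1 x.2)) θ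

end PolicyClass

namespace MDP

/-- One step of the state-action chain under `π`: `s' ∼ P(·|s,a)`, then `a' ∼ π(·|s')`. -/
def stepKernel (𝓜 : MDP S A M) (π : Kernel S A) : Kernel (S × A) (S × A) :=
  𝓜.P ⊗ₖ (Kernel.prodMkLeft (S × A) π)

instance (𝓜 : MDP S A M) (π : Kernel S A) [IsMarkovKernel π] :
    IsMarkovKernel (𝓜.stepKernel π) := by
  unfold stepKernel; infer_instance

/-- The law of the trajectory under `π` when `(s_0, a_0) ∼ ν₀`. -/
def trajLaw (𝓜 : MDP S A M) (π : Kernel S A) [IsMarkovKernel π]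
    (ν₀ : Measure (S × A)) [IsProbabilityMeasure ν₀] : Measure (Traj S A) :=
  Kernel.trajMeasure (X := fun _ => S × A) ν₀
    (fun n => (𝓜.stepKernel π).comap (fun h => h ⟨n, by simp⟩) (by fun_prop))

instance (𝓜 : MDP S A M) (π : Kernel S A) [IsMarkovKernel π]
    (ν₀ : Measure (S × A)) [IsProbabilityMeasure ν₀] :
    IsProbabilityMeasure (𝓜.trajLaw π ν₀) := by
  unfold trajLaw; infer_instance

/-- The law of the trajectory under `π` when `s_0 ∼ ρ`, `a_0 ∼ π(·|s_0)`. -/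
def pathLaw (𝓜 : MDP S A M) (π : Kernel S A) [IsMarkovKernel π] : Measure (Traj S A) :=
  𝓜.trajLaw π (𝓜.ρ ⊗ₘ π)

instance (𝓜 : MDP S A M) (π : Kernel S A) [IsMarkovKernel π] :
    IsProbabilityMeasure (𝓜.pathLaw π) := by
  unfold pathLaw; infer_instance

/-- The discounted return `∑_t γ^t r_m(s_t, a_t)` of a trajectory. -/
def ret (𝓜 : MDP S A M) (γ : ℝ) (m : Fin M) (τ : Traj S A) : ℝ :=
  ∑' t : ℕ, γ ^ t * 𝓜.r m (τ t)

/-- The vector `J^π` of expected discounted returns. -/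
def J (𝓜 : MDP S A M) (γ : ℝ) (π : Kernel S A) [IsMarkovKernel π] : Euc M :=
  WithLp.toLp 2 (fun m => ∫ τ, 𝓜.ret γ m τ ∂(𝓜.pathLaw π))

/-- The state value function `V_m^π`. -/
def V (𝓜 : MDP S A M) (γ : ℝ) (π : Kernel S A) [IsMarkovKernel π] (m : Fin M) (s : S) : ℝ :=
  ∫ τ, 𝓜.ret γ m τ ∂(𝓜.trajLaw π (Measure.dirac s ⊗ₘ π))

/-- The state-action value function `Q_m^π`. -/
def Q (𝓜 : MDP S A M) (γ : ℝ) (π : Kernel S A) [IsMarkovKernel π] (m : Fin M)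
    (x : S × A) : ℝ :=
  ∫ τ, 𝓜.ret γ m τ ∂(𝓜.trajLaw π (Measure.dirac x))

/-- The advantage function `A_m^π = Q_m^π - V_m^π`. -/
def adv (𝓜 : MDP S A M) (γ : ℝ) (π : Kernel S A) [IsMarkovKernel π] (m : Fin M)
    (x : S × A) : ℝ :=
  𝓜.Q γ π m x - 𝓜.V γ π m x.1

/-- The discounted state visitation distribution `d_ρ^π`. -/
def visit (𝓜 : MDP S A M) (γ : ℝ) (π : Kernel S A) [IsMarkovKernel π] : Measure S :=
  Measure.sum (fun t : ℕ =>
    ENNReal.ofReal ((1 - γ) * γ ^ t) • (𝓜.pathLaw π).map (fun τ => (τ t).1))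

/-- The state-action distribution `ν_ρ^π(s,a) = d_ρ^π(s) π(a|s)`. -/
def visitSA (𝓜 : MDP S A M) (γ : ℝ) (π : Kernel S A) [IsMarkovKernel π] : Measure (S × A) :=
  𝓜.visit γ π ⊗ₘ π

/-- The Fisher information matrix `F_ρ(θ)`. -/
def fisher (𝓜 : MDP S A M) (γ : ℝ) (𝓟 : PolicyClass S A d) (θ : Euc d) :
    Matrix (Fin d) (Fin d) ℝ :=
  Matrix.of fun i j => ∫ x, 𝓟.score θ x i * 𝓟.score θ x j ∂(𝓜.visitSA γ (𝓟.policy θ))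

/-- The exact natural policy gradient `ω*_θ = F_ρ(θ)⁻¹ ∇_θ f(J^{π_θ})`. It is only used where
`F_ρ(θ)` is positive definite, so that the pseudoinverse is the inverse. -/
def npg (𝓜 : MDP S A M) (γ : ℝ) (𝓟 : PolicyClass S A d) (f : Euc M → ℝ) (θ : Euc d) : Euc d :=
  WithLp.toLp 2 ((𝓜.fisher γ 𝓟 θ)⁻¹.mulVec
    (gradient (fun θ' => f (𝓜.J γ (𝓟.policy θ'))) θ).ofLp)

end MDP

/-- The partial derivative `∂_m f(x)`. -/
def partialD (f : Euc M → ℝ) (m : Fin M) (x : Euc M) : ℝ :=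
  lineDeriv ℝ f x (EuclideanSpace.single m 1)

/-- The cube `[0, 1/(1-γ)]^M`. -/
def box (M : ℕ) (γ : ℝ) : Set (Euc M) :=
  {x | ∀ m, x m ∈ Set.Icc (0 : ℝ) (1 / (1 - γ))}

/-- The partial derivatives of `f` exist and are `L_f`-Lipschitz on `[0, 1/(1-γ)]^M`. -/
def SmoothOnBox (f : Euc M → ℝ) (γ Lf : ℝ) : Prop :=
  ∀ m : Fin M,
    (∀ x ∈ box M γ, LineDifferentiableAt ℝ f x (EuclideanSpace.single m 1)) ∧
    ∀ x ∈ box M γ, ∀ y ∈ box M γ, |partialD f m x - partialD f m y| ≤ Lf * ‖x - y‖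

/-- The score exists, is bounded by `G₁`, and is `G₂`-Lipschitz in the parameter. -/
def ScoreRegular (𝓟 : PolicyClass S A d) (G₁ G₂ : ℝ) : Prop :=
  (∀ θ s a, DifferentiableAt ℝ (fun θ' => Real.log (𝓟.dens θ' s a)) θ) ∧
  (∀ θ x, ‖𝓟.score θ x‖ ≤ G₁) ∧
  ∀ θ₁ θ₂ x, ‖𝓟.score θ₁ x - 𝓟.score θ₂ x‖ ≤ G₂ * ‖θ₁ - θ₂‖

/-- `F_ρ(θ) ⪰ μ I` for every `θ`. -/
def FisherNondegenerate (𝓜 : MDP S A M) (γ : ℝ) (𝓟 : PolicyClass S A d) (μ : ℝ) : Prop :=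
  ∀ θ, (𝓜.fisher γ 𝓟 θ - μ • (1 : Matrix (Fin d) (Fin d) ℝ)).PosSemidef

/-- The transferred compatible function approximation error of the natural policy gradient at `θ`,
measured under `s ∼ d_ρ^{π*}`, `a ∼ π*(·|s)`. -/
def transferError (𝓜 : MDP S A M) (γ : ℝ) (𝓟 : PolicyClass S A d) (f : Euc M → ℝ)
    (πstar : Kernel S A) [IsMarkovKernel πstar] (θ : Euc d) : ℝ :=
  ∫ x, ((∑ m, partialD f m (𝓜.J γ (𝓟.policy θ)) * 𝓜.adv γ (𝓟.policy θ) m x)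
      - (1 - γ) * inner ℝ (𝓜.npg γ 𝓟 f θ) (𝓟.score θ x)) ^ 2 ∂(𝓜.visitSA γ πstar)

/-! ### The algorithm -/

/-- The inputs of the algorithm: initial parameter, numbers of outer and inner iterations,
trajectory length, batch threshold, batch size, the two step sizes, and the starting points
`ω_0^k` of the inner loops. -/
structure Inputs (d : ℕ) where
  θ₀ : Euc d
  K : ℕ
  N : ℕ
  H : ℕ
  Bmax : ℝ
  B : ℕ
  α : ℝ
  β : ℝ
  ω₀ : ℕ → Euc d

/-- The random draws `(Q, outer, inner)` of one outer iteration: the level `Q`, the trajectories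
`outer j` from which the return estimates are formed, and the trajectories `inner n i` of the
`n`-th inner iteration. The algorithm uses only the first `2^Q̄` of the former and only
`n < N`, `i < B` of the latter. -/
abbrev Draw (S A : Type*) : Type _ := ℕ × (ℕ → Traj S A) × (ℕ → ℕ → Traj S A)

/-- The law of the level: `Pr(Q = q) = 2^{-q}` for `q = 1, 2, …`. -/
def levelLaw : Measure ℕ :=
  Measure.sum (fun n : ℕ => ((2 : ℝ≥0∞)⁻¹ ^ (n + 1)) • Measure.dirac (n + 1))

/-- The law of the draws of one outer iteration at the parameter `θ`: the level and all the
trajectories are independent, and the trajectories are sampled from `π_θ`. -/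
def drawLaw (𝓜 : MDP S A M) (𝓟 : PolicyClass S A d) (θ : Euc d) : Measure (Draw S A) :=
  levelLaw.prod ((Measure.infinitePi fun _ : ℕ => 𝓜.pathLaw (𝓟.policy θ)).prod
    (Measure.infinitePi fun _ : ℕ =>
      Measure.infinitePi fun _ : ℕ => 𝓜.pathLaw (𝓟.policy θ)))

/-- The empirical return vector `Ĵ_{H,b}` of the first `b` trajectories. -/
def empReturn (𝓜 : MDP S A M) (γ : ℝ) (H b : ℕ) (τs : ℕ → Traj S A) : Euc M :=
  WithLp.toLp 2 (fun m =>
    (1 / (b : ℝ)) * ∑ j ∈ Finset.range b, ∑ t ∈ Finset.range H, γ ^ t * 𝓜.r m (τs j t))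

open Classical in
/-- The truncated level `Q̄ = Q 1{2^Q ≤ B_max}`. -/
def truncLevel (Bmax : ℝ) (q : ℕ) : ℕ := if (2 : ℝ) ^ q ≤ Bmax then q else 0

open Classical in
/-- The truncated multi-level Monte Carlo estimate of `∂_m f(J)`. -/
def mlmcPartial (𝓜 : MDP S A M) (γ : ℝ) (f : Euc M → ℝ) (H : ℕ) (Bmax : ℝ) (q : ℕ)
    (τs : ℕ → Traj S A) (m : Fin M) : ℝ :=
  partialD f m (empReturn 𝓜 γ H 1 τs) +
    if (2 : ℝ) ^ q ≤ Bmax then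
      2 ^ q * (partialD f m (empReturn 𝓜 γ H (2 ^ q) τs)
        - partialD f m (empReturn 𝓜 γ H (2 ^ (q - 1)) τs))
    else 0

/-- The gradient estimate `g(τ^H, ·|θ)` formed from one trajectory and estimates `pd m` of the
partial derivatives of `f`. -/
def gradEst (𝓜 : MDP S A M) (γ : ℝ) (𝓟 : PolicyClass S A d) (H : ℕ) (pd : Fin M → ℝ)
    (θ : Euc d) (τ : Traj S A) : Euc d :=
  ∑ t ∈ Finset.range H,
    (∑ m, pd m * ∑ h ∈ Finset.Ico t H, γ ^ h * 𝓜.r m (τ h)) • 𝓟.score θ (τ t)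

/-- The Fisher matrix estimate `∑_{t<H} γ^t ψ_t ψ_tᵀ` formed from one trajectory. -/
def fisherEst (γ : ℝ) (𝓟 : PolicyClass S A d) (H : ℕ) (θ : Euc d) (τ : Traj S A) :
    Matrix (Fin d) (Fin d) ℝ :=
  ∑ t ∈ Finset.range H, γ ^ t • Matrix.vecMulVec (𝓟.score θ (τ t)).ofLp (𝓟.score θ (τ t)).ofLp

/-- The inner loop: `ω_{n+1} = ω_n - β (F̂_n ω_n - ĝ_n)`, started at `w`. -/
def innerLoop (𝓜 : MDP S A M) (γ : ℝ) (𝓟 : PolicyClass S A d) (f : Euc M → ℝ) (I : Inputs d)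
    (θ w : Euc d) (x : Draw S A) : ℕ → Euc d
  | 0 => w
  | n + 1 =>
    let ω := innerLoop 𝓜 γ 𝓟 f I θ w x n
    let pd := mlmcPartial 𝓜 γ f I.H I.Bmax x.1 x.2.1
    let ghat : Euc d :=
      (1 / (I.B : ℝ)) • ∑ i ∈ Finset.range I.B, gradEst 𝓜 γ 𝓟 I.H pd θ (x.2.2 n i)
    let Fhat : Matrix (Fin d) (Fin d) ℝ :=
      (1 / (I.B : ℝ)) • ∑ i ∈ Finset.range I.B, fisherEst γ 𝓟 I.H θ (x.2.2 n i)
    ω - I.β • (WithLp.toLp 2 (Fhat.mulVec ω.ofLp) - ghat)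

/-- The parameters `θ_k` produced by the algorithm from the sequence `x` of its draws. -/
def iterate (𝓜 : MDP S A M) (γ : ℝ) (𝓟 : PolicyClass S A d) (f : Euc M → ℝ) (I : Inputs d)
    (x : ℕ → Draw S A) : ℕ → Euc d
  | 0 => I.θ₀
  | k + 1 =>
    let θ := iterate 𝓜 γ 𝓟 f I x k
    θ + I.α • innerLoop 𝓜 γ 𝓟 f I θ (I.ω₀ k) (x k) I.N

/-- The number of samples (state-action pairs) used in the `K` outer iterations:
`∑_k H (B_k + N B)` with `B_k = 2^{Q̄_k}`. -/
def sampleCount (I : Inputs d) (x : ℕ → Draw S A) : ℕ :=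
  ∑ k ∈ Finset.range I.K, I.H * (2 ^ truncLevel I.Bmax (x k).1 + I.N * I.B)

/-- `X` is the sequence of draws of a run of the algorithm: conditionally on the draws of
the iterations before `k`, the draw `X k` has the law `drawLaw θ_k`. -/
def IsRun {Ω : Type*} [MeasurableSpace Ω] (Pr : Measure Ω) (𝓜 : MDP S A M) (γ : ℝ)
    (𝓟 : PolicyClass S A d) (f : Euc M → ℝ) (I : Inputs d) (X : ℕ → Ω → Draw S A) : Prop :=
  (∀ k, Measurable (X k)) ∧
  ∀ k : ℕ, ∀ E : Set Ω,
    MeasurableSet[⨆ j : Fin k, MeasurableSpace.comap (X j) inferInstance] E →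
    ∀ D : Set (Draw S A), MeasurableSet D →
      Pr (E ∩ X k ⁻¹' D) =
        ∫⁻ ω in E, drawLaw 𝓜 𝓟 (iterate 𝓜 γ 𝓟 f I (fun j => X j ω) k) D ∂Pr

/-- The smoothness constant `L_J = M C G₂ / (1-γ)²`. -/
def LJ (M : ℕ) (γ C G₂ : ℝ) : ℝ := M * C * G₂ / (1 - γ) ^ 2

/-- The prescribed choice of the inputs at accuracy `ε`; `K = Θ(1/(αε))` means that it lies between
`c₁/(αε)` and `c₂/(αε)`, and `R₀` bounds the distance of the starting points `ω_0^k` to the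
natural policy gradients. -/
structure Prescribed (𝓜 : MDP S A M) (γ : ℝ) (𝓟 : PolicyClass S A d) (f : Euc M → ℝ)
    (C G₁ G₂ μ R₀ c₁ c₂ ε : ℝ) (I : Inputs d) : Prop where
  α_eq : I.α = μ * ε * Real.log (1 / ε) / (4 * LJ M γ C G₂ * G₁ ^ 2)
  Bmax_eq : I.Bmax = 1 / ε ^ 2
  K_mem : (I.K : ℝ) ∈ Set.Icc (c₁ / (I.α * ε)) (c₂ / (I.α * ε))
  N_eq : I.N = ⌈4 * C * M * G₁ / (μ ^ 2 * (1 - γ) ^ 2) * Real.log (R₀ ^ 2 / ε ^ 2)⌉₊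
  H_eq : I.H = ⌈2 * Real.log (1 / ε) / Real.log (1 / γ)⌉₊
  B_eq : I.B = 1
  β_mem : I.β ∈ Set.Icc (μ * (1 - γ) ^ 3 / (4 * C * M * G₁)) ((1 - γ) / G₁ ^ 2)
  ω₀_dist : ∀ k θ, ‖I.ω₀ k - 𝓜.npg γ 𝓟 f θ‖ ≤ R₀

end MORL

end

open MeasureTheory ProbabilityTheory
open scoped ENNReal

noncomputable section

namespace MORL

variable {S A : Type*} [MeasurableSpace S] [MeasurableSpace A] {M d : ℕ}

/-! ### Concave functions with partial derivatives -/

/-! Let ν* be the discounted state-action law of the comparator π*, and use the potential Φ(θ) =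
E_{ν*}[log π_θ - log π_{θ₀}]. By the Gibbs variational inequality Φ never exceeds the initial
divergence (`ScoreRegular.integral_logRatio_le`), while the Lipschitz score gives Φ(θ + αω) - Φ(θ) ≥
α⟨ω, Ψ(θ)⟩ - G₂α²‖ω‖², where Ψ(θ) is the mean score under ν*
(`ScoreRegular.integral_logRatio_step`). Hence the sum over k of ⟨ω_N^k, Ψ(θ_k)⟩ is at most D/α plus
a term of order α ∑‖ω_N^k‖² (`Regular.sum_inner_le`). On the other side, concavity of f, the
performance difference lemma and Jensen's inequality bound the optimality gap at θ by √ε_bias/(1-γ)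
+ ⟨ω*_θ, Ψ(θ)⟩ (`ScoreRegular.gap_le`). It remains to compare ω_N with ω*.

The comparison is linear in ω_N, so only its conditional mean and its second moment are needed. The
sampled Fisher matrix has mean close to F/(1-γ), so the inner loop targets (1-γ)ω*, which costs a
factor (1-γ)⁻¹.

Mean: given the outer estimate p, fresh samples make the mean of the inner loop a deterministic
linear iteration (`integral_linIter`). That iteration is affine in p, and the multi-level estimate
telescopes to the plain estimate with 2^Q ≈ ε⁻² trajectories (`SmoothOnBox.integral_mlmcPartial`).
Contraction, the Monte Carlo bias and the horizon tail then give a bias of order ε log²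
(`Regular.innerLoop_bias_le`).

Second moment: each sampled step is nonexpansive pathwise, so ‖ω_N‖ is controlled by N ∑|p_m|. Every
level contributes a constant to E p_m², because 4^q · 2^{-q} · 2^{-q} = 1
(`SmoothOnBox.integral_sq_mlmcPartial_le`). This gives order log³ (`Regular.innerLoop_moment_le`).

With α of order ε log and αK of order 1/ε, the three errors D/(αK), α log³ and ε log² are all of
order at most ε log⁴. Each level also contributes one trajectory to the expected batch, so an outer
iteration costs polylogarithmically many samples, and K is of order ε⁻²/log. -/

lemma euc_sum_single (v : Euc M) :
    ∑ m, v m • (EuclideanSpace.single m (1 : ℝ) : Euc M) = v := by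
  ext i
  simp [Pi.single_apply]

lemma hasDerivAt_partialD {f : Euc M → ℝ} {x : Euc M} {m : Fin M}
    (h : LineDifferentiableAt ℝ f x (EuclideanSpace.single m 1)) :
    HasDerivAt (fun t : ℝ => f (x + t • EuclideanSpace.single m 1)) (partialD f m x) 0 :=
  h.hasLineDerivAt

/-- Concavity along the coordinate directions. -/
lemma concave_average_le {f : Euc M → ℝ} (hf : ConcaveOn ℝ Set.univ f) (hM : 0 < M)
    (x v : Euc M) :
    (1 / (M : ℝ)) * ∑ m, f (x + (M * v m) • EuclideanSpace.single m 1) ≤ f (x + v) := by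
  have hM' : (M : ℝ) ≠ 0 := by positivity
  -- x + v is the average of the M axis points x + M v_m e_m.
  have h := hf.le_map_sum (t := Finset.univ) (w := fun _ : Fin M => 1 / (M : ℝ))
    (p := fun m => x + (M * v m) • EuclideanSpace.single m 1)
    (fun _ _ => by positivity) (by simp [hM']) (fun _ _ => Set.mem_univ _)
  have e : ∑ m : Fin M, (1 / (M : ℝ)) • (x + (M * v m) • (EuclideanSpace.single m 1 : Euc M))
      = x + v := by
    simp only [smul_add, Finset.sum_add_distrib, smul_smul]
    congr 1
    · rw [Finset.sum_const, Finset.card_univ, Fintype.card_fin, ← Nat.cast_smul_eq_nsmul ℝ,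
        smul_smul]
      simp [hM']
    · conv_rhs => rw [← euc_sum_single v]
      refine Finset.sum_congr rfl fun m _ => ?_
      congr 1
      field_simp
  rw [e] at h
  simpa [Finset.mul_sum] using h

/-- Partial derivatives suffice for the supergradient inequality. For t > 0 the point x lies between
x - tv and x + v, so concavity gives t(f(x+v) - f(x)) ≤ f(x) - f(x - tv). The right side is bounded
by differences along the axes through `concave_average_le`; dividing by t and letting t ↓ 0 leaves
the partial derivatives. -/
lemma concave_sub_le_partialD {f : Euc M → ℝ} (hf : ConcaveOn ℝ Set.univ f) (hM : 0 < M)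
    {x : Euc M} (hx : ∀ m, LineDifferentiableAt ℝ f x (EuclideanSpace.single m 1)) (v : Euc M) :
    f (x + v) - f x ≤ ∑ m, partialD f m x * v m := by
  have hM' : (M : ℝ) ≠ 0 := by positivity
  have key : ∀ t : ℝ, 0 < t → f (x + v) - f x ≤
      (1 / (M : ℝ)) * ∑ m, t⁻¹ * (f x - f (x + (M * (-(t * v m))) • EuclideanSpace.single m 1)) := by
    intro t ht
    have h1 := hf.2 (Set.mem_univ (x + (-t) • v)) (Set.mem_univ (x + v))
      (show (0 : ℝ) ≤ 1 / (1 + t) by positivity) (show (0 : ℝ) ≤ t / (1 + t) by positivity)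
      (by field_simp)
    have e : (1 / (1 + t)) • (x + (-t) • v) + (t / (1 + t)) • (x + v) = x := by
      have : (1 : ℝ) + t ≠ 0 := by positivity
      ext i
      simp
      field_simp
      ring
    rw [e] at h1
    have h2 := concave_average_le hf hM x ((-t) • v)
    have h3 : f (x + (-t) • v) + t * f (x + v) ≤ (1 + t) * f x := by
      have : (1 + t) * ((1 / (1 + t)) • f (x + (-t) • v) + (t / (1 + t)) • f (x + v))
          = f (x + (-t) • v) + t * f (x + v) := by
        have : (1 : ℝ) + t ≠ 0 := by positivity
        simp only [smul_eq_mul]; field_simp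
      rw [← this]
      exact mul_le_mul_of_nonneg_left h1 (by positivity)
    have h4 : t * (f (x + v) - f x) ≤ f x - f (x + (-t) • v) := by linarith
    have h5 : f x - f (x + (-t) • v) ≤
        (1 / (M : ℝ)) * ∑ m, (f x - f (x + (M * (-(t * v m))) • EuclideanSpace.single m 1)) := by
      rw [Finset.sum_sub_distrib, mul_sub]
      simp only [PiLp.smul_apply, smul_eq_mul, neg_mul] at h2
      simp only [Finset.sum_const, Finset.card_univ, Fintype.card_fin, nsmul_eq_mul]
      have : 1 / (M : ℝ) * (M * f x) = f x := by field_simp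
      rw [this, neg_smul] at *
      linarith
    have h6 := h4.trans h5
    rw [← Finset.mul_sum, mul_left_comm]
    calc f (x + v) - f x = t⁻¹ * (t * (f (x + v) - f x)) := by field_simp
      _ ≤ _ := mul_le_mul_of_nonneg_left h6 (by positivity)
  have hlim : Filter.Tendsto (fun t : ℝ => (1 / (M : ℝ)) *
      ∑ m, t⁻¹ * (f x - f (x + (M * (-(t * v m))) • EuclideanSpace.single m 1)))
      (nhdsWithin 0 (Set.Ioi 0)) (nhds ((1 / (M : ℝ)) * ∑ m, (M : ℝ) * (partialD f m x * v m))) := by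
    refine Filter.Tendsto.const_mul _ (tendsto_finsetSum _ fun m _ => ?_)
    have hd := (hasDerivAt_partialD (hx m))
    have hd2 : HasDerivAt (fun t : ℝ => f (x + (M * (-(t * v m))) • EuclideanSpace.single m 1))
        (partialD f m x * (M * (-(1 * v m)))) 0 := by
      have hin : HasDerivAt (fun t : ℝ => (M : ℝ) * (-(t * v m))) (M * (-(1 * v m))) 0 :=
        (((hasDerivAt_id (0 : ℝ)).mul_const (v m)).neg).const_mul _
      exact HasDerivAt.comp (0 : ℝ) (h₂ := fun t : ℝ => f (x + t • EuclideanSpace.single m 1))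
        (by simpa using hd) hin
    have hs := hd2.tendsto_slope_zero_right
    have := hs.neg
    refine (this.congr fun t => ?_).trans (le_of_eq ?_)
    · simp
      ring
    · congr 1; ring
  have e : (1 / (M : ℝ)) * ∑ m, (M : ℝ) * (partialD f m x * v m) = ∑ m, partialD f m x * v m := by
    rw [← Finset.mul_sum]; field_simp
  rw [e] at hlim
  exact ge_of_tendsto hlim (Filter.eventually_of_mem self_mem_nhdsWithin fun t ht => key t ht)

/-- The continuous linear functional with given coordinates. -/
def coordFunctional (p : Fin M → ℝ) : Euc M →L[ℝ] ℝ :=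
  ∑ m, p m • (EuclideanSpace.proj m : Euc M →L[ℝ] ℝ)

lemma coordFunctional_apply (p : Fin M → ℝ) (v : Euc M) :
    coordFunctional p v = ∑ m, p m * v m := by
  simp [coordFunctional]

/-- A concave function with partial derivatives at a point is differentiable there. -/
lemma concave_hasFDerivAt {f : Euc M → ℝ} (hf : ConcaveOn ℝ Set.univ f) (hM : 0 < M)
    {x : Euc M} (hx : ∀ m, LineDifferentiableAt ℝ f x (EuclideanSpace.single m 1)) :
    HasFDerivAt f (coordFunctional fun m => partialD f m x) x := by
  have hM' : (M : ℝ) ≠ 0 := by positivity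
  rw [hasFDerivAt_iff_isLittleO_nhds_zero]
  -- `g m` is the first-order remainder along the m-th axis. The full remainder lies between the
  -- average of the `g m`, by concavity, and 0, by the supergradient inequality.
  set g : Fin M → Euc M → ℝ := fun m v =>
    f (x + (M * v m) • EuclideanSpace.single m 1) - f x - (M * v m) * partialD f m x with hg
  have hgo : ∀ m, (g m) =o[nhds 0] (fun v : Euc M => v) := by
    intro m
    have hd := (hasDerivAt_iff_isLittleO_nhds_zero.1 (hasDerivAt_partialD (hx m)))
    have ht : Filter.Tendsto (fun v : Euc M => (M : ℝ) * v m) (nhds 0) (nhds 0) := by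
      have : Continuous fun v : Euc M => (M : ℝ) * v m := by fun_prop
      simpa using this.tendsto 0
    have h := hd.comp_tendsto ht
    have hO : (fun v : Euc M => (M : ℝ) * v m) =O[nhds 0] (fun v : Euc M => v) := by
      refine Asymptotics.IsBigO.of_bound M (Filter.Eventually.of_forall fun v => ?_)
      rw [norm_mul, Real.norm_natCast]
      exact mul_le_mul_of_nonneg_left (PiLp.norm_apply_le v m) (by positivity)
    refine (h.trans_isBigO hO).congr_left fun v => ?_
    simp [hg]
  have hsum : (fun v => ∑ m, ‖g m v‖) =o[nhds 0] (fun v : Euc M => v) :=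
    Asymptotics.IsLittleO.fun_sum fun m _ => (hgo m).norm_left
  refine Asymptotics.IsBigO.trans_isLittleO ?_ hsum
  refine Asymptotics.IsBigO.of_bound 1 (Filter.Eventually.of_forall fun v => ?_)
  have hn : 0 ≤ ∑ m, ‖g m v‖ := Finset.sum_nonneg fun _ _ => norm_nonneg _
  rw [one_mul, Real.norm_eq_abs, Real.norm_of_nonneg hn, coordFunctional_apply, abs_le]
  constructor
  · have h := concave_average_le hf hM x v
    have e : (1 / (M : ℝ)) * ∑ m, f (x + (M * v m) • EuclideanSpace.single m 1)
        = (1 / (M : ℝ)) * ∑ m, g m v + f x + ∑ m, partialD f m x * v m := by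
      simp only [hg, Finset.sum_sub_distrib, Finset.sum_const, Finset.card_univ, Fintype.card_fin,
        nsmul_eq_mul]
      have : ∑ m, (M * v m) * partialD f m x = M * ∑ m, partialD f m x * v m := by
        rw [Finset.mul_sum]; exact Finset.sum_congr rfl fun _ _ => by ring
      rw [this]
      field_simp
      ring
    have h2 : -(∑ m, ‖g m v‖) ≤ (1 / (M : ℝ)) * ∑ m, g m v := by
      have h3 : |∑ m, g m v| ≤ ∑ m, ‖g m v‖ := Finset.abs_sum_le_sum_abs _ _
      have h4 : (1 / (M : ℝ)) * |∑ m, g m v| ≤ ∑ m, ‖g m v‖ := by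
        calc (1 / (M : ℝ)) * |∑ m, g m v| ≤ 1 * ∑ m, ‖g m v‖ := by
              apply mul_le_mul _ h3 (abs_nonneg _) zero_le_one
              rw [div_le_one (by positivity)]
              exact_mod_cast hM
          _ = _ := one_mul _
      have h5 : -((1 / (M : ℝ)) * |∑ m, g m v|) ≤ (1 / (M : ℝ)) * ∑ m, g m v := by
        rw [← mul_neg]
        exact mul_le_mul_of_nonneg_left (neg_abs_le _) (by positivity)
      linarith
    linarith
  · have := concave_sub_le_partialD hf hM hx v
    linarith

/-! ### Symmetric operators -/

/-- A symmetric operator whose quadratic form is bounded by `c` has norm at most `c`. -/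
lemma norm_apply_le_of_quadratic_le {E : Type*} [NormedAddCommGroup E] [InnerProductSpace ℝ E]
    (T : E →L[ℝ] E) (hT : ∀ v w, inner ℝ (T v) w = inner ℝ v (T w)) {c : ℝ} (hc : 0 < c)
    (h : ∀ v, |inner ℝ (T v) v| ≤ c * ‖v‖ ^ 2) (v : E) : ‖T v‖ ≤ c * ‖v‖ := by
  -- Polarization expresses ⟨Tv, w⟩ through the quadratic form at v ± w; the parallelogram law adds
  -- up the two bounds.
  have key : ∀ w, 4 * inner ℝ (T v) w ≤ 2 * c * (‖v‖ ^ 2 + ‖w‖ ^ 2) := by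
    intro w
    have h1 := (abs_le.1 (h (v + w))).2
    have h2 := (abs_le.1 (h (v - w))).1
    have e : 4 * inner ℝ (T v) w = inner ℝ (T (v + w)) (v + w) - inner ℝ (T (v - w)) (v - w) := by
      have : inner ℝ (T w) v = inner ℝ (T v) w := by rw [hT, real_inner_comm]
      simp only [map_add, map_sub, inner_add_left, inner_add_right, inner_sub_left,
        inner_sub_right, this]
      ring
    have p := parallelogram_law_with_norm ℝ v w
    nlinarith
  -- This scaling of Tv balances the two squares and yields ‖Tv‖² ≤ c²‖v‖².
  have h3 := key (c⁻¹ • T v)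
  rw [inner_smul_right, real_inner_self_eq_norm_sq, norm_smul, Real.norm_of_nonneg (by positivity)]
    at h3
  have h4 : ‖T v‖ ^ 2 ≤ (c * ‖v‖) ^ 2 := by
    have : 4 * (c⁻¹ * ‖T v‖ ^ 2) * c ≤ 2 * c * (‖v‖ ^ 2 + (c⁻¹ * ‖T v‖) ^ 2) * c :=
      mul_le_mul_of_nonneg_right h3 hc.le
    have e1 : 4 * (c⁻¹ * ‖T v‖ ^ 2) * c = 4 * ‖T v‖ ^ 2 := by field_simp
    have e2 : 2 * c * (‖v‖ ^ 2 + (c⁻¹ * ‖T v‖) ^ 2) * c = 2 * c ^ 2 * ‖v‖ ^ 2 + 2 * ‖T v‖ ^ 2 := by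
      field_simp
    nlinarith
  exact le_of_sq_le_sq h4 (by positivity) 

/-! ### Log-densities and scores -/

namespace PolicyClass

/-- The log-density `log π_θ(a|s)`. -/
def logDens (𝓟 : PolicyClass S A d) (θ : Euc d) (x : S × A) : ℝ := Real.log (𝓟.dens θ x.1 x.2)

lemma measurable_logDens (𝓟 : PolicyClass S A d) (θ : Euc d) : Measurable (𝓟.logDens θ) :=
  Real.measurable_log.comp (𝓟.dens_measurable θ)

lemma exp_logDens (𝓟 : PolicyClass S A d) (θ : Euc d) (x : S × A) :
    Real.exp (𝓟.logDens θ x) = 𝓟.dens θ x.1 x.2 :=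
  Real.exp_log (𝓟.dens_pos θ x.1 x.2)

end PolicyClass

variable {𝓟 : PolicyClass S A d} {G₁ G₂ : ℝ}

lemma ScoreRegular.hasGradientAt (h : ScoreRegular 𝓟 G₁ G₂) (θ : Euc d) (x : S × A) :
    HasGradientAt (fun θ' => 𝓟.logDens θ' x) (𝓟.score θ x) θ :=
  (h.1 θ x.1 x.2).hasGradientAt

lemma ScoreRegular.hasFDerivAt (h : ScoreRegular 𝓟 G₁ G₂) (θ : Euc d) (x : S × A) :
    HasFDerivAt (fun θ' => 𝓟.logDens θ' x) (innerSL ℝ (𝓟.score θ x)) θ :=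
  (h.hasGradientAt θ x).hasFDerivAt

lemma ScoreRegular.logDens_lipschitz (h : ScoreRegular 𝓟 G₁ G₂) (θ₁ θ₂ : Euc d) (x : S × A) :
    |𝓟.logDens θ₁ x - 𝓟.logDens θ₂ x| ≤ G₁ * ‖θ₁ - θ₂‖ := by
  refine Convex.norm_image_sub_le_of_norm_hasFDerivWithin_le (s := Set.univ)
    (f := fun θ' => 𝓟.logDens θ' x)
    (f' := fun θ' => innerSL ℝ (𝓟.score θ' x)) (fun θ _ => (h.hasFDerivAt θ x).hasFDerivWithinAt)
    (fun θ _ => ?_) convex_univ (Set.mem_univ _) (Set.mem_univ _)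
  rw [innerSL_apply_norm]
  exact h.2.1 θ x

/-- Mean value theorem along the segment from θ to θ + v: the score at the intermediate point
differs from the one at θ by at most G₂‖v‖. Taylor's constant G₂/2 is not needed. -/
lemma ScoreRegular.logDens_lower (h : ScoreRegular 𝓟 G₁ G₂) (hG₂ : 0 ≤ G₂) (θ v : Euc d)
    (x : S × A) :
    inner ℝ (𝓟.score θ x) v - G₂ * ‖v‖ ^ 2 ≤ 𝓟.logDens (θ + v) x - 𝓟.logDens θ x := by
  have hd : ∀ t : ℝ, HasDerivAt (fun t : ℝ => 𝓟.logDens (θ + t • v) x)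
      (inner ℝ (𝓟.score (θ + t • v) x) v) t := by
    intro t
    have h1 : HasDerivAt (fun t : ℝ => θ + t • v) v t := by
      simpa using ((hasDerivAt_id t).smul_const v).const_add θ
    exact (h.hasFDerivAt (θ + t • v) x).comp_hasDerivAt t h1
  obtain ⟨c, hc, hc'⟩ := exists_hasDerivAt_eq_slope (fun t : ℝ => 𝓟.logDens (θ + t • v) x) _
    (zero_lt_one) (fun t _ => (hd t).continuousAt.continuousWithinAt) (fun t _ => hd t)
  simp only [one_smul, zero_smul, add_zero, sub_zero, div_one] at hc'
  rw [← hc']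
  have h2 : ‖𝓟.score θ x - 𝓟.score (θ + c • v) x‖ ≤ G₂ * ‖v‖ := by
    refine (h.2.2 _ _ x).trans (mul_le_mul_of_nonneg_left ?_ hG₂)
    rw [sub_add_cancel_left, norm_neg, norm_smul, Real.norm_of_nonneg hc.1.le]
    exact mul_le_of_le_one_left (norm_nonneg _) hc.2.le
  have h3 := (real_inner_le_norm (𝓟.score θ x - 𝓟.score (θ + c • v) x) v).trans
    (mul_le_mul_of_nonneg_right h2 (norm_nonneg v))
  rw [inner_sub_left] at h3
  nlinarith

/-- The score is a gradient in θ, so each coordinate is a pointwise limit, along steps 1/(n+1), of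
difference quotients that are measurable in (s, a). -/
lemma ScoreRegular.measurable_score (h : ScoreRegular 𝓟 G₁ G₂) (θ : Euc d) :
    Measurable (𝓟.score θ) := by
  have hm : ∀ i : Fin d, Measurable fun x => 𝓟.score θ x i := by
    intro i
    have hlim : ∀ x, Filter.Tendsto (fun n : ℕ => ((1 : ℝ) / ((n : ℝ) + 1))⁻¹ *
        (𝓟.logDens (θ + ((1 : ℝ) / ((n : ℝ) + 1)) • EuclideanSpace.single i 1) x - 𝓟.logDens θ x))
        Filter.atTop (nhds (𝓟.score θ x i)) := by
      intro x
      have h1 := ((h.hasFDerivAt θ x).hasLineDerivAt (EuclideanSpace.single i 1))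
      have h2 := h1.tendsto_slope_zero_right
      have h3 : Filter.Tendsto (fun n : ℕ => (1 : ℝ) / ((n : ℝ) + 1)) Filter.atTop
          (nhdsWithin 0 (Set.Ioi 0)) :=
        tendsto_nhdsWithin_iff.2 ⟨tendsto_one_div_add_atTop_nhds_zero_nat,
          Filter.Eventually.of_forall fun n => by
            simp only [Set.mem_Ioi]; positivity⟩
      have h4 := h2.comp h3
      simpa [Function.comp_def, EuclideanSpace.inner_single_right] using h4
    exact measurable_of_tendsto_metrizable
      (fun n => ((𝓟.measurable_logDens _).sub (𝓟.measurable_logDens _)).const_mul _)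
      (tendsto_pi_nhds.2 hlim)
  exact (MeasurableEquiv.toLp 2 (Fin d → ℝ)).measurable.comp (measurable_pi_lambda _ hm)

lemma ScoreRegular.continuous_score (h : ScoreRegular 𝓟 G₁ G₂) (x : S × A) :
    Continuous fun θ => 𝓟.score θ x := by
  have : LipschitzWith (Real.toNNReal G₂) fun θ => 𝓟.score θ x :=
    LipschitzWith.of_dist_le_mul fun a b => by
      rw [dist_eq_norm, dist_eq_norm]
      exact (h.2.2 a b x).trans
        (mul_le_mul_of_nonneg_right (Real.le_coe_toNNReal G₂) (norm_nonneg _))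
  exact this.continuous

/-- Continuity in θ and measurability in (s, a) give joint measurability, which is needed because
θ_k is itself random. -/
lemma ScoreRegular.measurable_score_prod (h : ScoreRegular 𝓟 G₁ G₂) :
    Measurable fun p : Euc d × (S × A) => 𝓟.score p.1 p.2 :=
  measurable_uncurry_of_continuous_of_measurable (u := fun θ x => 𝓟.score θ x)
    (fun x => h.continuous_score x) (fun θ => h.measurable_score θ)

lemma ScoreRegular.measurable_logDens_prod (h : ScoreRegular 𝓟 G₁ G₂) :
    Measurable fun p : Euc d × (S × A) => 𝓟.logDens p.1 p.2 :=
  measurable_uncurry_of_continuous_of_measurable (u := fun θ x => 𝓟.logDens θ x)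
    (fun x => continuous_iff_continuousAt.2 fun θ => (h.hasFDerivAt θ x).continuousAt)
    (fun θ => 𝓟.measurable_logDens θ)

/-! ### Markov chains -/

section Chain

variable {X : Type*} [MeasurableSpace X]

/-- The law of the Markov chain with kernel `K` and initial distribution `ν`. -/
def chainLaw (K : Kernel X X) [IsMarkovKernel K] (ν : Measure X) [IsProbabilityMeasure ν] :
    Measure (ℕ → X) :=
  Kernel.trajMeasure (X := fun _ => X) ν
    (fun n => K.comap (fun h => h ⟨n, by simp⟩) (by fun_prop))

instance (K : Kernel X X) [IsMarkovKernel K] (ν : Measure X) [IsProbabilityMeasure ν] :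
    IsProbabilityMeasure (chainLaw K ν) := by
  unfold chainLaw; infer_instance

variable (K : Kernel X X) [IsMarkovKernel K] (ν : Measure X) [IsProbabilityMeasure ν]

/-- The Markov property, kept for functionals of the whole history: the change of measure below
multiplies by likelihoods of all past states. -/
lemma lintegral_chainLaw_succ (n : ℕ) {g : (∀ _ : Finset.Iic n, X) × X → ℝ≥0∞}
    (hg : Measurable g) :
    ∫⁻ τ, g (Preorder.frestrictLe n τ, τ (n + 1)) ∂(chainLaw K ν) =
      ∫⁻ τ, ∫⁻ y, g (Preorder.frestrictLe n τ, y) ∂(K (τ n)) ∂(chainLaw K ν) := by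
  have h := Kernel.map_frestrictLe_trajMeasure_compProd_eq_map_trajMeasure (X := fun _ => X)
    (μ₀ := ν) (κ := fun n => K.comap (fun h => h ⟨n, by simp⟩) (by fun_prop)) (a := n)
  have h1 := congrArg (fun m => ∫⁻ z, g z ∂m) h
  rw [lintegral_map hg (by fun_prop), Measure.lintegral_compProd hg,
    lintegral_map (by
      exact hg.lintegral_kernel_prod_right') (by fun_prop)] at h1
  exact h1.symm

lemma chainLaw_map_zero : (chainLaw K ν).map (fun τ => τ 0) = ν := by
  unfold chainLaw Kernel.trajMeasure
  have h0 : (fun τ : ℕ → X => τ 0) =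
      (fun h : (∀ _ : Finset.Iic 0, X) => h ⟨0, by simp⟩) ∘ Preorder.frestrictLe 0 := rfl
  rw [h0, ← Measure.map_map (by fun_prop) (by fun_prop), Measure.map_comp _ _ (by fun_prop),
    Kernel.traj_map_frestrictLe, Kernel.partialTraj_self, Measure.id_comp,
    Measure.map_map (by fun_prop) (by fun_prop)]
  convert Measure.map_id
  rfl

lemma lintegral_chainLaw_eval_succ (n : ℕ) {g : X → ℝ≥0∞} (hg : Measurable g) :
    ∫⁻ τ, g (τ (n + 1)) ∂(chainLaw K ν) = ∫⁻ τ, ∫⁻ y, g y ∂(K (τ n)) ∂(chainLaw K ν) :=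
  lintegral_chainLaw_succ K ν n (g := fun z => g z.2) (hg.comp measurable_snd)

lemma chainLaw_map_succ (n : ℕ) :
    (chainLaw K ν).map (fun τ => τ (n + 1)) = K ∘ₘ (chainLaw K ν).map (fun τ => τ n) := by
  ext s hs
  rw [← lintegral_indicator_one hs, ← lintegral_indicator_one hs,
    lintegral_map (measurable_one.indicator hs) (by fun_prop),
    lintegral_chainLaw_eval_succ K ν n (measurable_one.indicator hs),
    Measure.lintegral_bind (by fun_prop) (measurable_one.indicator hs).aemeasurable,
    lintegral_map (Measurable.lintegral_kernel (measurable_one.indicator hs)) (by fun_prop)]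

lemma chainLaw_map_eval (n : ℕ) :
    (chainLaw K ν).map (fun τ => τ n) = (K ^ n) ∘ₘ ν := by
  induction n with
  | zero => rw [chainLaw_map_zero, pow_zero]; exact Measure.id_comp.symm
  | succ n ih => 
    rw [chainLaw_map_succ, ih, Measure.comp_assoc, pow_succ']
    rfl

end Chain

/-! ### Bounded measurable functions -/

section Bounded

variable {X Y : Type*} [MeasurableSpace X] [MeasurableSpace Y]

lemma integrable_of_abs_le {μ : Measure X} [IsFiniteMeasure μ] {g : X → ℝ} (hg : Measurable g)
    {B : ℝ} (hB : ∀ x, |g x| ≤ B) : Integrable g μ :=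
  Integrable.of_bound hg.aestronglyMeasurable B (Filter.Eventually.of_forall hB)

lemma abs_integral_le_of_abs_le {μ : Measure X} [IsProbabilityMeasure μ] {g : X → ℝ}
    {B : ℝ} (hB : ∀ x, |g x| ≤ B) : |∫ x, g x ∂μ| ≤ B := by
  have := norm_integral_le_of_norm_le_const (μ := μ) (f := g) (C := B)
    (Filter.Eventually.of_forall hB)
  simpa using this

lemma integral_measure_comp {μ : Measure X} [IsProbabilityMeasure μ] {κ : Kernel X Y}
    [IsMarkovKernel κ] {g : Y → ℝ} (hg : Measurable g) {B : ℝ} (hB : ∀ y, |g y| ≤ B) :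
    ∫ y, g y ∂(κ ∘ₘ μ) = ∫ x, ∫ y, g y ∂(κ x) ∂μ := by
  rw [Measure.comp_eq_comp_const_apply, Kernel.integral_comp]
  · simp
  · exact integrable_of_abs_le hg hB

lemma measurable_integral_kernel {κ : Kernel X Y} [IsMarkovKernel κ] {g : Y → ℝ}
    (hg : Measurable g) : Measurable fun x => ∫ y, g y ∂(κ x) :=
  (hg.stronglyMeasurable.integral_kernel).measurable

lemma summable_geometric_mul {γ : ℝ} (h0 : 0 ≤ γ) (h1 : γ < 1) {a : ℕ → ℝ} {B : ℝ}
    (ha : ∀ t, |a t| ≤ B) : Summable fun t => γ ^ t * a t := by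
  refine Summable.of_norm_bounded (g := fun t => γ ^ t * B)
    ((summable_geometric_of_lt_one h0 h1).mul_right B) fun t => ?_
  rw [norm_mul, Real.norm_of_nonneg (pow_nonneg h0 t)]
  exact mul_le_mul_of_nonneg_left (ha t) (pow_nonneg h0 t)

lemma abs_tsum_geometric_mul_le {γ : ℝ} (h0 : 0 ≤ γ) (h1 : γ < 1) {a : ℕ → ℝ} {B : ℝ}
    (ha : ∀ t, |a t| ≤ B) : |∑' t, γ ^ t * a t| ≤ B / (1 - γ) := by
  have := tsum_of_norm_bounded (f := fun t => γ ^ t * a t) (g := fun t => γ ^ t * B)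
    (a := (1 - γ)⁻¹ * B) ((hasSum_geometric_of_lt_one h0 h1).mul_right B) fun t => by
      rw [norm_mul, Real.norm_of_nonneg (pow_nonneg h0 t)]
      exact mul_le_mul_of_nonneg_left (ha t) (pow_nonneg h0 t)
  rw [div_eq_inv_mul]
  exact this

lemma hasSum_integral_geometric {γ : ℝ} (h0 : 0 ≤ γ) (h1 : γ < 1) {μ : Measure X}
    [IsProbabilityMeasure μ] {g : ℕ → X → ℝ} (hg : ∀ t, Measurable (g t)) {B : ℝ}
    (hB : ∀ t x, |g t x| ≤ B) :
    HasSum (fun t => γ ^ t * ∫ x, g t x ∂μ) (∫ x, ∑' t, γ ^ t * g t x ∂μ) := by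
  have := hasSum_integral_of_dominated_convergence (μ := μ) (F := fun t x => γ ^ t * g t x)
    (f := fun x => ∑' t, γ ^ t * g t x) (fun t _ => γ ^ t * B)
    (fun t => ((hg t).const_mul _).aestronglyMeasurable)
    (fun t => Filter.Eventually.of_forall fun x => by
      rw [norm_mul, Real.norm_of_nonneg (pow_nonneg h0 t)]
      exact mul_le_mul_of_nonneg_left (hB t x) (pow_nonneg h0 t))
    (Filter.Eventually.of_forall fun x => (summable_geometric_of_lt_one h0 h1).mul_right B)
    (integrable_const _)
    (Filter.Eventually.of_forall fun x => (summable_geometric_mul h0 h1 fun t => hB t x).hasSum)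
  simpa only [integral_const_mul] using this

lemma measurable_tsum_geometric {γ : ℝ} {g : ℕ → X → ℝ} (hg : ∀ t, Measurable (g t))
    (h0 : 0 ≤ γ) (h1 : γ < 1) {B : ℝ} (hB : ∀ t x, |g t x| ≤ B) :
    Measurable fun x => ∑' t, γ ^ t * g t x :=
  measurable_of_tendsto_metrizable
    (f := fun (n : ℕ) x => ∑ t ∈ Finset.range n, γ ^ t * g t x)
    (fun _ => Finset.measurable_sum _ fun t _ => (hg t).const_mul _)
    (tendsto_pi_nhds.2 fun x => (summable_geometric_mul h0 h1 fun t => hB t x).hasSum.tendsto_sum_nat)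

end Bounded

/-! ### Discounted values of a Markov chain -/

section Value

variable {X : Type*} [MeasurableSpace X]

instance kernel_pow_isMarkov (K : Kernel X X) [IsMarkovKernel K] (n : ℕ) :
    IsMarkovKernel (K ^ n) := by
  induction n with
  | zero => rw [pow_zero]; exact (inferInstance : IsMarkovKernel (Kernel.id : Kernel X X))
  | succ n ih => rw [pow_succ']; exact (inferInstance : IsMarkovKernel (K ∘ₖ (K ^ n)))

/-- The discounted value of the chain started at `x`. -/
def chainValue (K : Kernel X X) (γ : ℝ) (r : X → ℝ) (x : X) : ℝ :=
  ∑' t, γ ^ t * ∫ y, r y ∂((K ^ t) x)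

variable (K : Kernel X X) [IsMarkovKernel K] {γ : ℝ} {r : X → ℝ} {B : ℝ}

lemma abs_chainValue_le (h0 : 0 ≤ γ) (h1 : γ < 1) (hB : ∀ x, |r x| ≤ B) (x : X) :
    |chainValue K γ r x| ≤ B / (1 - γ) :=
  abs_tsum_geometric_mul_le h0 h1 fun _ => abs_integral_le_of_abs_le hB

lemma measurable_chainValue (h0 : 0 ≤ γ) (h1 : γ < 1) (hr : Measurable r)
    (hB : ∀ x, |r x| ≤ B) : Measurable (chainValue K γ r) :=
  measurable_tsum_geometric (fun _ => measurable_integral_kernel hr) h0 h1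
    (fun _ _ => abs_integral_le_of_abs_le hB)

lemma hasSum_integral_chainLaw (h0 : 0 ≤ γ) (h1 : γ < 1) (hr : Measurable r)
    (hB : ∀ x, |r x| ≤ B) (ν : Measure X) [IsProbabilityMeasure ν] :
    HasSum (fun t => γ ^ t * ∫ τ, r (τ t) ∂(chainLaw K ν))
      (∫ τ, ∑' t, γ ^ t * r (τ t) ∂(chainLaw K ν)) :=
  hasSum_integral_geometric h0 h1 (fun t => hr.comp (measurable_pi_apply t)) (fun t τ => hB (τ t))

lemma integral_chainLaw_eval (hr : Measurable r) (hB : ∀ x, |r x| ≤ B)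
    (ν : Measure X) [IsProbabilityMeasure ν] (t : ℕ) :
    ∫ τ, r (τ t) ∂(chainLaw K ν) = ∫ x, ∫ y, r y ∂((K ^ t) x) ∂ν := by
  rw [← integral_measure_comp hr hB, ← chainLaw_map_eval,
    integral_map (measurable_pi_apply t).aemeasurable hr.aestronglyMeasurable]

/-- Both sides expand into the same discounted series over t, with the initial state integrated out
first or last. -/
lemma integral_chainLaw_eq (h0 : 0 ≤ γ) (h1 : γ < 1) (hr : Measurable r)
    (hB : ∀ x, |r x| ≤ B) (ν : Measure X) [IsProbabilityMeasure ν] :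
    ∫ τ, ∑' t, γ ^ t * r (τ t) ∂(chainLaw K ν) = ∫ x, chainValue K γ r x ∂ν := by
  have a := hasSum_integral_chainLaw K h0 h1 hr hB ν
  simp only [integral_chainLaw_eval K hr hB] at a
  have b := hasSum_integral_geometric h0 h1 (μ := ν) (g := fun t x => ∫ y, r y ∂((K ^ t) x))
    (fun _ => measurable_integral_kernel hr) (fun _ _ => abs_integral_le_of_abs_le hB)
  exact a.unique b

/-- The Bellman equation. -/
lemma chainValue_eq (h0 : 0 ≤ γ) (h1 : γ < 1) (hr : Measurable r)
    (hB : ∀ x, |r x| ≤ B) (x : X) :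
    chainValue K γ r x = r x + γ * ∫ y, chainValue K γ r y ∂(K x) := by
  have hs : Summable fun t => γ ^ t * ∫ y, r y ∂((K ^ t) x) :=
    summable_geometric_mul h0 h1 fun _ => abs_integral_le_of_abs_le hB
  have e0 : ∫ y, r y ∂((K ^ 0) x) = r x := by
    rw [pow_zero]
    exact (integral_dirac' r x hr.stronglyMeasurable)
  have b := (hasSum_integral_geometric h0 h1 (μ := K x) (g := fun t x => ∫ y, r y ∂((K ^ t) x))
    (fun _ => measurable_integral_kernel hr) (fun _ _ => abs_integral_le_of_abs_le hB)).tsum_eq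
  unfold chainValue
  rw [hs.tsum_eq_zero_add, e0, pow_zero, one_mul, ← b, ← tsum_mul_left]
  congr 2
  funext t
  have : (K ^ (t + 1)) x = (K ^ t) ∘ₘ (K x) := by
    rw [pow_succ]
    exact Kernel.comp_apply _ _ _
  rw [this, integral_measure_comp hr hB, pow_succ]
  ring

end Value

/-! ### The performance difference lemma -/

namespace MDP

variable (𝓜 : MDP S A M) {γ : ℝ} (π πs : Kernel S A) [IsMarkovKernel π] [IsMarkovKernel πs]

lemma abs_r_le (m : Fin M) (x : S × A) : |𝓜.r m x| ≤ 1 := by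
  rw [abs_le]
  have := 𝓜.r_mem m x
  exact ⟨by linarith [this.1], this.2⟩

lemma trajLaw_eq (ν : Measure (S × A)) [IsProbabilityMeasure ν] :
    𝓜.trajLaw π ν = chainLaw (𝓜.stepKernel π) ν := rfl

lemma lintegral_stepKernel {g : S × A → ℝ≥0∞} (hg : Measurable g) (x : S × A) :
    ∫⁻ y, g y ∂(𝓜.stepKernel π x) = ∫⁻ s, ∫⁻ a, g (s, a) ∂(π s) ∂(𝓜.P x) := by
  rw [stepKernel, Kernel.lintegral_compProd _ _ _ hg]
  rfl

lemma integral_stepKernel {g : S × A → ℝ} (hg : Measurable g) {B : ℝ} (hB : ∀ x, |g x| ≤ B)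
    (x : S × A) :
    ∫ y, g y ∂(𝓜.stepKernel π x) = ∫ s, ∫ a, g (s, a) ∂(π s) ∂(𝓜.P x) := by
  have hi : Integrable g ((𝓜.P ⊗ₖ (Kernel.prodMkLeft (S × A) π)) x) := integrable_of_abs_le hg hB
  rw [stepKernel, ProbabilityTheory.integral_compProd hi]
  rfl

/-- The law of `(s_t, a_t)`. -/
def margin (t : ℕ) : Measure (S × A) := (𝓜.pathLaw π).map (fun τ => τ t)

instance (t : ℕ) : IsProbabilityMeasure (𝓜.margin π t) :=
  Measure.isProbabilityMeasure_map (measurable_pi_apply t).aemeasurable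

lemma margin_zero : 𝓜.margin π 0 = 𝓜.ρ ⊗ₘ π := chainLaw_map_zero _ _

lemma margin_succ (t : ℕ) : 𝓜.margin π (t + 1) = 𝓜.stepKernel π ∘ₘ 𝓜.margin π t :=
  chainLaw_map_succ _ _ _

/-- At every time the action is drawn from π at the current state, since `stepKernel` ends with such
a draw. This turns `visitSA` into the geometric mixture of the laws of (s_t, a_t). -/
lemma fst_margin_compProd (t : ℕ) : (𝓜.margin π t).fst ⊗ₘ π = 𝓜.margin π t := by
  cases t with
  | zero => rw [margin_zero, Measure.fst_compProd]
  | succ t =>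
    ext s hs
    have hg : Measurable (s.indicator (1 : S × A → ℝ≥0∞)) := measurable_one.indicator hs
    have hg2 : Measurable fun u : S => ∫⁻ a, s.indicator (1 : S × A → ℝ≥0∞) (u, a) ∂(π u) :=
      hg.lintegral_kernel_prod_right'
    have hg3 : Measurable fun x : S × A =>
        ∫⁻ a, s.indicator (1 : S × A → ℝ≥0∞) (x.1, a) ∂(π x.1) := hg2.comp measurable_fst
    rw [← lintegral_indicator_one hs, ← lintegral_indicator_one hs, Measure.lintegral_compProd hg,
      Measure.fst, lintegral_map hg2 measurable_fst, margin_succ,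
      Measure.lintegral_bind (by fun_prop) hg3.aemeasurable,
      Measure.lintegral_bind (by fun_prop) hg.aemeasurable]
    refine lintegral_congr fun x => ?_
    rw [lintegral_stepKernel _ _ hg, lintegral_stepKernel _ _ hg3]
    simp

lemma visitSA_eq : 𝓜.visitSA γ π =
    Measure.sum fun t : ℕ => ENNReal.ofReal ((1 - γ) * γ ^ t) • 𝓜.margin π t := by
  rw [visitSA, visit, Measure.compProd_sum_left]
  congr 1
  funext t
  rw [Measure.compProd_smul_left, ← fst_margin_compProd 𝓜 π t, margin, Measure.fst,
    Measure.map_map measurable_fst (by fun_prop)]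
  rfl

lemma isProbabilityMeasure_visit (hγ : γ ∈ Set.Ioo (0 : ℝ) 1)
    : IsProbabilityMeasure (𝓜.visit γ π) := by
  constructor
  rw [visit, Measure.sum_apply _ MeasurableSet.univ]
  have h1 : 0 < 1 - γ := by linarith [hγ.2]
  have : ∀ t : ℕ, (ENNReal.ofReal ((1 - γ) * γ ^ t) •
      (𝓜.pathLaw π).map (fun τ => (τ t).1)) Set.univ = ENNReal.ofReal ((1 - γ) * γ ^ t) := by
    intro t
    have : IsProbabilityMeasure ((𝓜.pathLaw π).map (fun τ => (τ t).1)) :=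
      Measure.isProbabilityMeasure_map (measurable_pi_apply t).fst.aemeasurable
    simp
  simp only [this]
  rw [← ENNReal.ofReal_tsum_of_nonneg
    (fun t => mul_nonneg h1.le (pow_nonneg hγ.1.le t))
    ((summable_geometric_of_lt_one hγ.1.le hγ.2).mul_left _), tsum_mul_left,
    tsum_geometric_of_lt_one hγ.1.le hγ.2, mul_inv_cancel₀ h1.ne']
  simp

lemma isProbabilityMeasure_visitSA (hγ : γ ∈ Set.Ioo (0 : ℝ) 1)
    : IsProbabilityMeasure (𝓜.visitSA γ π) := by
  have := 𝓜.isProbabilityMeasure_visit π hγ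
  unfold visitSA
  infer_instance

/-- The weights (1-γ)γ^t of the visitation measure are normalized and discounted sums are not. This
is the source of every factor (1-γ)⁻¹ below, in the performance difference as well as in the mean of
the Fisher estimate. -/
lemma hasSum_integral_visitSA (hγ : γ ∈ Set.Ioo (0 : ℝ) 1)
    {g : S × A → ℝ} (hg : Measurable g) {B : ℝ}
    (hB : ∀ x, |g x| ≤ B) :
    HasSum (fun t => γ ^ t * ∫ x, g x ∂(𝓜.margin π t))
      ((1 - γ)⁻¹ * ∫ x, g x ∂(𝓜.visitSA γ π)) := by
  have h1 : 0 < 1 - γ := by linarith [hγ.2]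
  have := 𝓜.isProbabilityMeasure_visitSA π hγ
  have hi : Integrable g (𝓜.visitSA γ π) := integrable_of_abs_le hg hB
  rw [visitSA_eq] at hi ⊢
  have h := (hasSum_integral_measure hi).mul_left (1 - γ)⁻¹
  refine h.congr_fun fun t => ?_
  rw [integral_smul_measure, ENNReal.toReal_ofReal (mul_nonneg h1.le (pow_nonneg hγ.1.le t)),
    smul_eq_mul]
  field_simp

lemma Q_eq (hγ : γ ∈ Set.Ioo (0 : ℝ) 1) (m : Fin M) (x : S × A) :
    𝓜.Q γ π m x = chainValue (𝓜.stepKernel π) γ (𝓜.r m) x := by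
  rw [Q, trajLaw_eq]
  have := integral_chainLaw_eq (𝓜.stepKernel π) hγ.1.le hγ.2 (𝓜.r_measurable m)
    (𝓜.abs_r_le m) (Measure.dirac x)
  unfold ret
  rw [this, integral_dirac' _ _ (measurable_chainValue _ hγ.1.le hγ.2 (𝓜.r_measurable m)
    (𝓜.abs_r_le m)).stronglyMeasurable]

lemma measurable_Q (hγ : γ ∈ Set.Ioo (0 : ℝ) 1) (m : Fin M) : Measurable (𝓜.Q γ π m) := by
  rw [funext (𝓜.Q_eq π hγ m)]
  exact measurable_chainValue _ hγ.1.le hγ.2 (𝓜.r_measurable m) (𝓜.abs_r_le m)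

lemma abs_Q_le (hγ : γ ∈ Set.Ioo (0 : ℝ) 1)
    (m : Fin M) (x : S × A) : |𝓜.Q γ π m x| ≤ 1 / (1 - γ) := by
  rw [Q_eq 𝓜 π hγ]
  exact abs_chainValue_le _ hγ.1.le hγ.2 (𝓜.abs_r_le m) x

lemma integral_ret_eq (hγ : γ ∈ Set.Ioo (0 : ℝ) 1)
    (m : Fin M) (ν : Measure (S × A)) [IsProbabilityMeasure ν] :
    ∫ τ, 𝓜.ret γ m τ ∂(𝓜.trajLaw π ν) = ∫ x, 𝓜.Q γ π m x ∂ν := by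
  simp only [Q_eq 𝓜 π hγ]
  exact integral_chainLaw_eq (𝓜.stepKernel π) hγ.1.le hγ.2 (𝓜.r_measurable m)
    (𝓜.abs_r_le m) ν

lemma V_eq (hγ : γ ∈ Set.Ioo (0 : ℝ) 1)
    (m : Fin M) (s : S) : 𝓜.V γ π m s = ∫ a, 𝓜.Q γ π m (s, a) ∂(π s) := by
  have h1 : Integrable (𝓜.Q γ π m) (Measure.dirac s ⊗ₘ π) :=
    integrable_of_abs_le (𝓜.measurable_Q π hγ m) (𝓜.abs_Q_le π hγ m)
  rw [V, integral_ret_eq 𝓜 π hγ, Measure.integral_compProd h1]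
  have hm : StronglyMeasurable fun s => ∫ a, 𝓜.Q γ π m (s, a) ∂(π s) :=
    (𝓜.measurable_Q π hγ m).stronglyMeasurable.integral_kernel_prod_right'
  exact integral_dirac' _ _ hm

lemma measurable_V (hγ : γ ∈ Set.Ioo (0 : ℝ) 1) (m : Fin M) : Measurable (𝓜.V γ π m) := by
  rw [funext (𝓜.V_eq π hγ m)]
  exact ((𝓜.measurable_Q π hγ m).stronglyMeasurable.integral_kernel_prod_right').measurable

lemma abs_V_le (hγ : γ ∈ Set.Ioo (0 : ℝ) 1) (m : Fin M) (s : S) : |𝓜.V γ π m s| ≤ 1 / (1 - γ) := by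
  rw [V_eq 𝓜 π hγ]
  exact abs_integral_le_of_abs_le fun a => 𝓜.abs_Q_le π hγ m (s, a)

lemma measurable_adv (hγ : γ ∈ Set.Ioo (0 : ℝ) 1) (m : Fin M) : Measurable (𝓜.adv γ π m) :=
  (𝓜.measurable_Q π hγ m).sub ((𝓜.measurable_V π hγ m).comp measurable_fst)

lemma abs_adv_le (hγ : γ ∈ Set.Ioo (0 : ℝ) 1)
    (m : Fin M) (x : S × A) : |𝓜.adv γ π m x| ≤ 2 / (1 - γ) := by
  refine (abs_sub _ _).trans ?_
  have := 𝓜.abs_Q_le π hγ m x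
  have := 𝓜.abs_V_le π hγ m x.1
  calc _ ≤ 1 / (1 - γ) + 1 / (1 - γ) := by gcongr
    _ = _ := by ring

lemma Q_bellman (hγ : γ ∈ Set.Ioo (0 : ℝ) 1) (m : Fin M) (x : S × A) :
    𝓜.Q γ π m x = 𝓜.r m x + γ * ∫ s, 𝓜.V γ π m s ∂(𝓜.P x) := by
  have h := chainValue_eq (𝓜.stepKernel π) hγ.1.le hγ.2 (𝓜.r_measurable m) (𝓜.abs_r_le m) x
  simp only [← Q_eq 𝓜 π hγ] at h
  rw [h, integral_stepKernel 𝓜 π (𝓜.measurable_Q π hγ m) (𝓜.abs_Q_le π hγ m)]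
  simp only [V_eq 𝓜 π hγ]

lemma J_eq_integral_V (hγ : γ ∈ Set.Ioo (0 : ℝ) 1)
    (m : Fin M) : 𝓜.J γ π m = ∫ s, 𝓜.V γ π m s ∂𝓜.ρ := by
  have h1 : Integrable (𝓜.Q γ π m) (𝓜.ρ ⊗ₘ π) :=
    integrable_of_abs_le (𝓜.measurable_Q π hγ m) (𝓜.abs_Q_le π hγ m)
  have : 𝓜.J γ π m = ∫ τ, 𝓜.ret γ m τ ∂(𝓜.trajLaw π (𝓜.ρ ⊗ₘ π)) := rfl
  rw [this, integral_ret_eq 𝓜 π hγ, Measure.integral_compProd h1]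
  simp only [V_eq 𝓜 π hγ]

lemma hasSum_J (hγ : γ ∈ Set.Ioo (0 : ℝ) 1) (m : Fin M) :
    HasSum (fun t => γ ^ t * ∫ x, 𝓜.r m x ∂(𝓜.margin π t)) (𝓜.J γ π m) := by
  have := hasSum_integral_chainLaw (𝓜.stepKernel π) hγ.1.le hγ.2 (𝓜.r_measurable m)
    (𝓜.abs_r_le m) (𝓜.ρ ⊗ₘ π)
  refine this.congr_fun fun t => ?_
  rw [margin, integral_map (measurable_pi_apply t).aemeasurable
    (𝓜.r_measurable m).aestronglyMeasurable]
  rfl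

/-- The performance difference lemma. -/
lemma integral_adv_visitSA (hγ : γ ∈ Set.Ioo (0 : ℝ) 1) (m : Fin M) :
    ∫ x, 𝓜.adv γ π m x ∂(𝓜.visitSA γ πs) = (1 - γ) * (𝓜.J γ πs m - 𝓜.J γ π m) := by
  have h1 : 0 < 1 - γ := by linarith [hγ.2]
  have hVm : Measurable fun x : S × A => 𝓜.V γ π m x.1 := (𝓜.measurable_V π hγ m).comp measurable_fst
  have hVb : ∀ x : S × A, |𝓜.V γ π m x.1| ≤ 1 / (1 - γ) := fun x => 𝓜.abs_V_le π hγ m x.1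
  set a : ℕ → ℝ := fun t => ∫ x, 𝓜.V γ π m x.1 ∂(𝓜.margin πs t) with ha
  have hadv := 𝓜.hasSum_integral_visitSA πs hγ (𝓜.measurable_adv π hγ m) (𝓜.abs_adv_le π hγ m)
  -- Bellman's equation for π, averaged along the chain of πs. Weighted by γ^t the terms γ a(t+1) -
  -- a(t) telescope to -a(0).
  have hstep : ∀ t, ∫ x, 𝓜.adv γ π m x ∂(𝓜.margin πs t) =
      ∫ x, 𝓜.r m x ∂(𝓜.margin πs t) + γ * a (t + 1) - a t := by
    intro t
    have e1 : ∀ x, 𝓜.adv γ π m x =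
        𝓜.r m x + γ * (∫ y, 𝓜.V γ π m y.1 ∂(𝓜.stepKernel πs x)) - 𝓜.V γ π m x.1 := by
      intro x
      rw [adv, Q_bellman 𝓜 π hγ, integral_stepKernel 𝓜 πs hVm hVb]
      simp
    have i1 : Integrable (𝓜.r m) (𝓜.margin πs t) :=
      integrable_of_abs_le (𝓜.r_measurable m) (𝓜.abs_r_le m)
    have i2 : Integrable (fun x => γ * ∫ y, 𝓜.V γ π m y.1 ∂(𝓜.stepKernel πs x)) (𝓜.margin πs t) :=
      (integrable_of_abs_le (measurable_integral_kernel hVm)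
        (fun x => abs_integral_le_of_abs_le hVb)).const_mul γ
    have i3 : Integrable (fun x : S × A => 𝓜.V γ π m x.1) (𝓜.margin πs t) :=
      integrable_of_abs_le hVm hVb
    simp only [e1]
    rw [integral_sub (i1.add i2 : Integrable (fun x => _ + _) _) i3, integral_add i1 i2,
      integral_const_mul, ← integral_measure_comp hVm hVb, ← margin_succ]
  -- V depends only on the state, and s_0 ∼ ρ under both policies.
  have ha0 : a 0 = 𝓜.J γ π m := by
    rw [J_eq_integral_V 𝓜 π hγ, ha]
    simp only [margin_zero]
    conv_rhs => rw [← Measure.fst_compProd 𝓜.ρ πs]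
    rw [Measure.fst, integral_map (by fun_prop) (𝓜.measurable_V π hγ m).aestronglyMeasurable]
  have hab : ∀ t, |a t| ≤ 1 / (1 - γ) := fun t => abs_integral_le_of_abs_le hVb
  have hs := (summable_geometric_mul hγ.1.le hγ.2 hab)
  have ht := (hs.hasSum_iff.2 rfl)
  have ht1 : HasSum (fun t => γ ^ (t + 1) * a (t + 1)) ((∑' t, γ ^ t * a t) - a 0) := by
    have := (hasSum_nat_add_iff' (f := fun t => γ ^ t * a t) 1).2 ht
    simpa using this
  have hfin := ((𝓜.hasSum_J πs hγ m).add ht1).sub ht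
  have := hadv.unique (hfin.congr_fun fun t => by rw [hstep]; ring)
  rw [← ha0, ← mul_right_inj' (inv_ne_zero h1.ne'), this]
  field_simp
  ring

lemma J_mem_box (hγ : γ ∈ Set.Ioo (0 : ℝ) 1) : 𝓜.J γ π ∈ box M γ := by
  intro m
  have h := 𝓜.hasSum_J π hγ m
  have h0 : ∀ t, 0 ≤ ∫ x, 𝓜.r m x ∂(𝓜.margin π t) := fun t =>
    integral_nonneg fun x => (𝓜.r_mem m x).1
  refine ⟨h.nonneg fun t => mul_nonneg (pow_nonneg hγ.1.le t) (h0 t), ?_⟩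
  have := hasSum_le (fun t => mul_le_of_le_one_right (pow_nonneg hγ.1.le t)
    ((abs_le.1 (abs_integral_le_of_abs_le (μ := 𝓜.margin π t) (𝓜.abs_r_le m))).2)) h
    (hasSum_geometric_of_lt_one hγ.1.le hγ.2)
  rwa [one_div]

end MDP

/-! ### Change of measure along the first steps of a chain -/

section ChangeOfMeasure

variable {X : Type*}

/-- Appends one more state to the first `n + 1` states of a path. -/
def appendState (n : ℕ) (z : (∀ _ : Finset.Iic n, X) × X) : ∀ _ : Finset.Iic (n + 1), X :=
  fun i => if h : i.1 ≤ n then z.1 ⟨i.1, Finset.mem_Iic.2 h⟩ else z.2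

lemma appendState_frestrictLe (n : ℕ) (τ : ℕ → X) :
    appendState n (Preorder.frestrictLe n τ, τ (n + 1)) = Preorder.frestrictLe (n + 1) τ := by
  funext i
  unfold appendState
  by_cases h : i.1 ≤ n
  · simp [h]
  · have hi : i.1 = n + 1 := le_antisymm (Finset.mem_Iic.1 i.2) (by omega)
    simp [h, ← hi]

variable [MeasurableSpace X]

lemma measurable_appendState (n : ℕ) : Measurable (appendState (X := X) n) := by
  refine measurable_pi_lambda _ fun i => ?_
  unfold appendState
  by_cases h : i.1 ≤ n
  · simp only [h, dite_true]
    exact (measurable_pi_apply _).comp measurable_fst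
  · simp only [h, dite_false]
    exact measurable_snd

/-- A single density `l` serves the initial law and all transitions: two policies share ρ and P, so
their ratio at each step depends only on the new state-action pair. The densities then multiply
along the path, by induction with the Markov property. -/
lemma lintegral_chainLaw_change {K K' : Kernel X X} [IsMarkovKernel K] [IsMarkovKernel K']
    {ν ν' : Measure X} [IsProbabilityMeasure ν] [IsProbabilityMeasure ν'] {l : X → ℝ≥0∞}
    (hl : Measurable l)
    (hν : ∀ g : X → ℝ≥0∞, Measurable g → ∫⁻ y, g y ∂ν' = ∫⁻ y, g y * l y ∂ν)
    (hK : ∀ x, ∀ g : X → ℝ≥0∞, Measurable g → ∫⁻ y, g y ∂(K' x) = ∫⁻ y, g y * l y ∂(K x))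
    (n : ℕ) {g : (∀ _ : Finset.Iic n, X) → ℝ≥0∞} (hg : Measurable g) :
    ∫⁻ τ, g (Preorder.frestrictLe n τ) ∂(chainLaw K' ν') =
      ∫⁻ τ, g (Preorder.frestrictLe n τ) * ∏ t ∈ Finset.range (n + 1), l (τ t)
        ∂(chainLaw K ν) := by
  induction n with
  | zero =>
    have e : ∀ τ : ℕ → X, Preorder.frestrictLe 0 τ = fun _ : Finset.Iic 0 => τ 0 := by
      intro τ
      funext i
      have : i.1 = 0 := by simpa using Finset.mem_Iic.1 i.2
      simp [this]
    have hc : Measurable fun x : X => g fun _ => x :=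
      hg.comp (measurable_pi_lambda _ fun _ => measurable_id)
    simp only [e, zero_add, Finset.prod_range_one]
    have h1 := lintegral_map (μ := chainLaw K' ν') hc (measurable_pi_apply 0)
    have h2 := lintegral_map (μ := chainLaw K ν) (hc.mul hl) (measurable_pi_apply 0)
    rw [chainLaw_map_zero] at h1 h2
    rw [← h1, hν _ hc]
    exact h2
  | succ n ih =>
    have hga : Measurable fun z => g (appendState n z) := hg.comp (measurable_appendState n)
    have hlast : Measurable fun h : (∀ _ : Finset.Iic n, X) => h ⟨n, by simp⟩ :=
      measurable_pi_apply _
    have hgl : Measurable fun z : (∀ _ : Finset.Iic n, X) × X => g (appendState n z) * l z.2 :=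
      hga.mul (hl.comp measurable_snd)
    have h_int : Measurable fun h : (∀ _ : Finset.Iic n, X) =>
        ∫⁻ y, g (appendState n (h, y)) * l y ∂(K (h ⟨n, by simp⟩)) := by
      have := hgl.lintegral_kernel_prod_right' (κ := K.comap _ hlast)
      exact this
    -- The product of past likelihoods, rewritten as a function of the finite history so that
    -- `lintegral_chainLaw_succ` applies to it.
    let pr : (∀ _ : Finset.Iic n, X) → ℝ≥0∞ := fun h => ∏ t ∈ (Finset.range (n + 1)).attach,
      l (h ⟨t.1, by have := Finset.mem_range.1 t.2; simp; omega⟩)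
    have hpr : Measurable pr := Finset.measurable_prod _ fun t _ => hl.comp (measurable_pi_apply _)
    have hpr' : ∀ τ : ℕ → X, pr (Preorder.frestrictLe n τ) =
        ∏ t ∈ Finset.range (n + 1), l (τ t) := fun τ =>
      Finset.prod_attach (Finset.range (n + 1)) fun t => l (τ t)
    have h1 := lintegral_chainLaw_succ K' ν' n hga
    simp only [appendState_frestrictLe] at h1
    rw [h1]
    have h2 : ∀ τ : ℕ → X, ∫⁻ y, g (appendState n (Preorder.frestrictLe n τ, y)) ∂(K' (τ n)) =
        ∫⁻ y, g (appendState n (Preorder.frestrictLe n τ, y)) * l y ∂(K (τ n)) := fun τ =>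
      hK (τ n) _ (hga.comp measurable_prodMk_left)
    simp only [h2]
    have h3 := ih h_int
    simp only [Preorder.frestrictLe_apply] at h3
    rw [h3]
    have h4 := lintegral_chainLaw_succ K ν n
      (g := fun z => g (appendState n z) * l z.2 * pr z.1) (hgl.mul (hpr.comp measurable_fst))
    simp only [appendState_frestrictLe, hpr'] at h4
    have h5 : ∀ τ : ℕ → X, ∫⁻ y, g (appendState n (Preorder.frestrictLe n τ, y)) * l y *
        ∏ t ∈ Finset.range (n + 1), l (τ t) ∂(K (τ n)) =
        (∫⁻ y, g (appendState n (Preorder.frestrictLe n τ, y)) * l y ∂(K (τ n))) *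
          ∏ t ∈ Finset.range (n + 1), l (τ t) := fun τ =>
      lintegral_mul_const _ (hgl.comp measurable_prodMk_left)
    simp only [h5] at h4
    rw [← h4]
    refine lintegral_congr fun τ => ?_
    rw [Finset.prod_range_succ _ (n + 1)]
    ring

end ChangeOfMeasure

/-! ### Likelihood ratios of policies -/

section Likelihood

variable (𝓜 : MDP S A M) (𝓟 : PolicyClass S A d)

/-- The law of a trajectory under `π_θ`. -/
abbrev pathOf (θ : Euc d) : Measure (Traj S A) := 𝓜.pathLaw (𝓟.policy θ)

lemma lintegral_policy {g : A → ℝ≥0∞} (hg : Measurable g) (θ : Euc d) (s : S) :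
    ∫⁻ a, g a ∂(𝓟.policy θ s) = ∫⁻ a, ENNReal.ofReal (𝓟.dens θ s a) * g a ∂𝓟.ref := by
  have hm : Measurable (Function.uncurry fun s a => ENNReal.ofReal (𝓟.dens θ s a)) :=
    (𝓟.dens_measurable θ).ennreal_ofReal
  have hs : Measurable fun a => ENNReal.ofReal (𝓟.dens θ s a) := hm.comp measurable_prodMk_left
  rw [PolicyClass.policy, Kernel.withDensity_apply _ hm,
    lintegral_withDensity_eq_lintegral_mul _ hs hg]
  rfl

/-- The logarithm of the likelihood ratio of `π_θ'` and `π_θ` at one state-action pair. -/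
def logRatio (θ θ' : Euc d) (x : S × A) : ℝ := 𝓟.logDens θ' x - 𝓟.logDens θ x

lemma measurable_logRatio (θ θ' : Euc d) : Measurable (logRatio 𝓟 θ θ') :=
  (𝓟.measurable_logDens θ').sub (𝓟.measurable_logDens θ)

lemma lintegral_policy_change {g : A → ℝ≥0∞} (hg : Measurable g) (θ θ' : Euc d) (s : S) :
    ∫⁻ a, g a ∂(𝓟.policy θ' s) =
      ∫⁻ a, g a * ENNReal.ofReal (Real.exp (logRatio 𝓟 θ θ' (s, a))) ∂(𝓟.policy θ s) := by
  have h1 : Measurable fun a => ENNReal.ofReal (Real.exp (logRatio 𝓟 θ θ' (s, a))) :=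
    ((measurable_logRatio 𝓟 θ θ').comp measurable_prodMk_left).exp.ennreal_ofReal
  rw [lintegral_policy 𝓟 hg, lintegral_policy 𝓟 (hg.fun_mul h1)]
  refine lintegral_congr fun a => ?_
  have e : 𝓟.dens θ' s a = 𝓟.dens θ s a * Real.exp (logRatio 𝓟 θ θ' (s, a)) := by
    rw [logRatio, Real.exp_sub, 𝓟.exp_logDens, 𝓟.exp_logDens]
    have := (𝓟.dens_pos θ s a).ne'
    field_simp
  rw [e, ENNReal.ofReal_mul (𝓟.dens_pos θ s a).le]
  ring

/-- The likelihood ratio of the first `n + 1` steps of a trajectory. -/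
def likelihood (θ θ' : Euc d) (n : ℕ) (τ : Traj S A) : ℝ :=
  Real.exp (∑ t ∈ Finset.range (n + 1), logRatio 𝓟 θ θ' (τ t))

lemma measurable_likelihood (θ θ' : Euc d) (n : ℕ) : Measurable (likelihood 𝓟 θ θ' n) :=
  (Finset.measurable_sum _ fun t _ =>
    (measurable_logRatio 𝓟 θ θ').comp (measurable_pi_apply t)).exp

lemma lintegral_pathOf_change (θ θ' : Euc d) (n : ℕ)
    {g : (∀ _ : Finset.Iic n, S × A) → ℝ≥0∞} (hg : Measurable g) :
    ∫⁻ τ, g (Preorder.frestrictLe n τ) ∂(pathOf 𝓜 𝓟 θ') =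
      ∫⁻ τ, g (Preorder.frestrictLe n τ) * ENNReal.ofReal (likelihood 𝓟 θ θ' n τ)
        ∂(pathOf 𝓜 𝓟 θ) := by
  have hl : Measurable fun x => ENNReal.ofReal (Real.exp (logRatio 𝓟 θ θ' x)) :=
    (measurable_logRatio 𝓟 θ θ').exp.ennreal_ofReal
  have h := lintegral_chainLaw_change (K := 𝓜.stepKernel (𝓟.policy θ))
    (K' := 𝓜.stepKernel (𝓟.policy θ')) (ν := 𝓜.ρ ⊗ₘ 𝓟.policy θ) (ν' := 𝓜.ρ ⊗ₘ 𝓟.policy θ')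
    hl (fun g hg => ?_) (fun x g hg => ?_) n hg
  · have e : ∀ τ : Traj S A, ∏ t ∈ Finset.range (n + 1),
        ENNReal.ofReal (Real.exp (logRatio 𝓟 θ θ' (τ t))) =
        ENNReal.ofReal (likelihood 𝓟 θ θ' n τ) := by
      intro τ
      rw [likelihood, Real.exp_sum, ENNReal.ofReal_prod_of_nonneg fun _ _ => (Real.exp_pos _).le]
    simp only [e] at h
    exact h
  · rw [Measure.lintegral_compProd hg, Measure.lintegral_compProd (hg.fun_mul hl)]
    exact lintegral_congr fun s => lintegral_policy_change 𝓟 (hg.comp measurable_prodMk_left) θ θ' s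
  · rw [MDP.lintegral_stepKernel _ _ hg, MDP.lintegral_stepKernel _ _ (hg.fun_mul hl)]
    exact lintegral_congr fun s => lintegral_policy_change 𝓟 (hg.comp measurable_prodMk_left) θ θ' s

/-- Moves the dependence on θ' from the law into the integrand, where it can be differentiated. -/
lemma integral_pathOf_change (θ θ' : Euc d) (n : ℕ) {g : S × A → ℝ} (hg : Measurable g) :
    ∫ τ, g (τ n) ∂(pathOf 𝓜 𝓟 θ') = ∫ τ, likelihood 𝓟 θ θ' n τ * g (τ n) ∂(pathOf 𝓜 𝓟 θ) := by
  have hL : Measurable fun τ => ENNReal.ofReal (likelihood 𝓟 θ θ' n τ) :=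
    (measurable_likelihood 𝓟 θ θ' n).ennreal_ofReal
  have hmap : (pathOf 𝓜 𝓟 θ').map (fun τ => τ n) =
      ((pathOf 𝓜 𝓟 θ).withDensity fun τ => ENNReal.ofReal (likelihood 𝓟 θ θ' n τ)).map
        (fun τ => τ n) := by
    ext s hs
    have hi : Measurable (s.indicator (1 : S × A → ℝ≥0∞)) := measurable_one.indicator hs
    have hi' : Measurable fun τ : Traj S A => s.indicator (1 : S × A → ℝ≥0∞) (τ n) :=
      hi.comp (measurable_pi_apply n)
    rw [← lintegral_indicator_one hs, ← lintegral_indicator_one hs,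
      lintegral_map hi (measurable_pi_apply n), lintegral_map hi (measurable_pi_apply n),
      lintegral_withDensity_eq_lintegral_mul _ hL hi']
    have := lintegral_pathOf_change 𝓜 𝓟 θ θ' n (g := fun h => s.indicator 1 (h ⟨n, by simp⟩))
      (hi.comp (measurable_pi_apply _))
    simp only [Preorder.frestrictLe_apply] at this
    rw [this]
    exact lintegral_congr fun τ => mul_comm _ _
  have h1 := integral_map (μ := pathOf 𝓜 𝓟 θ') (φ := fun τ => τ n)
    (measurable_pi_apply n).aemeasurable hg.aestronglyMeasurable
  rw [← h1, hmap, integral_map (measurable_pi_apply n).aemeasurable hg.aestronglyMeasurable,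
    integral_withDensity_eq_integral_toReal_smul hL
      (Filter.Eventually.of_forall fun _ => ENNReal.ofReal_lt_top)]
  refine integral_congr_ae (Filter.Eventually.of_forall fun τ => ?_)
  simp [ENNReal.toReal_ofReal (Real.exp_pos _).le, likelihood]

end Likelihood

/-! ### Measurability of the laws in the parameter -/

section LawMeasurable

variable (𝓜 : MDP S A M) {𝓟 : PolicyClass S A d} {G₁ G₂ : ℝ}

/-- On cylinders the probability under θ is an integral, over the fixed law at parameter 0, of a
likelihood jointly measurable in θ and the path. Tonelli gives measurability there, and cylinders
form a generating π-system. -/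
lemma ScoreRegular.measurable_pathOf (h : ScoreRegular 𝓟 G₁ G₂) :
    Measurable fun θ => pathOf 𝓜 𝓟 θ := by
  refine Measurable.measure_of_isPiSystem_of_isProbabilityMeasure
    (generateFrom_measurableCylinders (α := fun _ : ℕ => S × A)).symm
    isPiSystem_measurableCylinders ?_
  intro s hs
  obtain ⟨I, T, hT, rfl⟩ := (mem_measurableCylinders _).1 hs
  set n := I.sup id with hn
  have hsub : I ⊆ Finset.Iic n := Finset.subset_Iic_sup_id I
  set T' : Set (∀ _ : Finset.Iic n, S × A) :=
    Finset.restrict₂ (π := fun _ : ℕ => S × A) hsub ⁻¹' T with hT'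
  have hTm : MeasurableSet T' := (Finset.measurable_restrict₂ hsub) hT
  have hc : MeasurableSet (cylinder (α := fun _ : ℕ => S × A) I T) :=
    MeasurableSet.cylinder I hT
  have hi : Measurable (T'.indicator (1 : (∀ _ : Finset.Iic n, S × A) → ℝ≥0∞)) := measurable_one.indicator hTm
  have e : ∀ θ, pathOf 𝓜 𝓟 θ (cylinder I T) =
      ∫⁻ τ, T'.indicator 1 (Preorder.frestrictLe n τ) *
        ENNReal.ofReal (likelihood 𝓟 0 θ n τ) ∂(pathOf 𝓜 𝓟 0) := by
    intro θ
    rw [← lintegral_pathOf_change 𝓜 𝓟 0 θ n hi, ← lintegral_indicator_one hc]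
    rfl
  simp only [e]
  refine Measurable.lintegral_prod_right' (f := fun p : Euc d × Traj S A =>
    T'.indicator 1 (Preorder.frestrictLe n p.2) * ENNReal.ofReal (likelihood 𝓟 0 p.1 n p.2)) ?_
  refine (hi.comp ((Preorder.measurable_frestrictLe n).comp measurable_snd)).mul
    (Measurable.ennreal_ofReal (Measurable.exp ?_))
  refine Finset.measurable_sum _ fun t _ => Measurable.sub ?_ ?_
  · exact h.measurable_logDens_prod.comp
      (measurable_fst.prodMk ((measurable_pi_apply t).comp measurable_snd))
  · exact (𝓟.measurable_logDens 0).comp ((measurable_pi_apply t).comp measurable_snd)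

lemma measurable_infinitePi_const {Θ X : Type*} [MeasurableSpace Θ] [MeasurableSpace X]
    {m : Θ → Measure X} [∀ θ, IsProbabilityMeasure (m θ)] (hm : Measurable m) :
    Measurable fun θ => Measure.infinitePi fun _ : ℕ => m θ := by
  refine Measurable.measure_of_isPiSystem_of_isProbabilityMeasure
    (generateFrom_squareCylinders (α := fun _ : ℕ => X)).symm
    (isPiSystem_squareCylinders (fun _ => MeasurableSpace.isPiSystem_measurableSet)
      fun _ => MeasurableSet.univ) ?_
  rintro s ⟨I, t, ht, rfl⟩
  have ht' : ∀ i, MeasurableSet (t i) := fun i => ht i (Set.mem_univ i)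
  simp only [Measure.infinitePi_pi _ fun i _ => ht' i]
  exact Finset.measurable_prod _ fun i _ => (Measure.measurable_coe (ht' i)).comp hm

instance isProbabilityMeasure_levelLaw : IsProbabilityMeasure levelLaw := by
  constructor
  rw [levelLaw, Measure.sum_apply _ MeasurableSet.univ]
  simp only [Measure.smul_apply, measure_univ, smul_eq_mul, mul_one]
  rw [ENNReal.tsum_geometric_add_one, ENNReal.one_sub_inv_two, inv_inv]
  exact ENNReal.inv_mul_cancel (by norm_num) (by norm_num)

instance (𝓟 : PolicyClass S A d) (θ : Euc d) : IsProbabilityMeasure (drawLaw 𝓜 𝓟 θ) := by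
  unfold drawLaw; infer_instance

lemma ScoreRegular.measurable_drawLaw (h : ScoreRegular 𝓟 G₁ G₂) :
    Measurable fun θ => drawLaw 𝓜 𝓟 θ := by
  have h1 := measurable_infinitePi_const (h.measurable_pathOf 𝓜)
  have h2 := measurable_infinitePi_const h1
  let k1 : Kernel (Euc d) (ℕ → Traj S A) := ⟨_, h1⟩
  let k2 : Kernel (Euc d) (ℕ → ℕ → Traj S A) := ⟨_, h2⟩
  have : IsMarkovKernel k1 := ⟨fun θ => inferInstanceAs
    (IsProbabilityMeasure (Measure.infinitePi fun _ : ℕ => pathOf 𝓜 𝓟 θ))⟩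
  have : IsMarkovKernel k2 := ⟨fun θ => inferInstanceAs
    (IsProbabilityMeasure (Measure.infinitePi fun _ : ℕ =>
      Measure.infinitePi fun _ : ℕ => pathOf 𝓜 𝓟 θ))⟩
  have e : (fun θ => drawLaw 𝓜 𝓟 θ) = fun θ => ((Kernel.const _ levelLaw) ×ₖ (k1 ×ₖ k2)) θ := by
    funext θ
    rw [Kernel.prod_apply, Kernel.prod_apply, Kernel.const_apply]
    rfl
  rw [e]
  exact Kernel.measurable _

/-- The law of the draws as a Markov kernel in the parameter. -/
def drawKernel (h : ScoreRegular 𝓟 G₁ G₂) : Kernel (Euc d) (Draw S A) :=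
  ⟨fun θ => drawLaw 𝓜 𝓟 θ, h.measurable_drawLaw 𝓜⟩

instance (h : ScoreRegular 𝓟 G₁ G₂) : IsMarkovKernel (drawKernel 𝓜 h) :=
  ⟨fun θ => inferInstanceAs (IsProbabilityMeasure (drawLaw 𝓜 𝓟 θ))⟩

end LawMeasurable

/-! ### The policy gradient theorem -/

section PolicyGradient

variable (𝓜 : MDP S A M) {𝓟 : PolicyClass S A d} {G₁ G₂ γ : ℝ}

/-- The sum of the scores of the first `h + 1` state-action pairs. -/
def scoreSum (𝓟 : PolicyClass S A d) (θ : Euc d) (h : ℕ) (τ : Traj S A) : Euc d :=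
  ∑ t ∈ Finset.range (h + 1), 𝓟.score θ (τ t)

/-- The gradient of the expected reward at time `h`. -/
def gradTerm (𝓟 : PolicyClass S A d) (θ : Euc d) (m : Fin M) (h : ℕ) : Euc d :=
  ∫ τ, 𝓜.r m (τ h) • scoreSum 𝓟 θ h τ ∂(pathOf 𝓜 𝓟 θ)

/-- The gradient of `J_m`. -/
def gradJ (γ : ℝ) (𝓟 : PolicyClass S A d) (θ : Euc d) (m : Fin M) : Euc d :=
  ∑' h : ℕ, γ ^ h • gradTerm 𝓜 𝓟 θ m h

/-- The gradient of `J_m` truncated at the horizon `H`. -/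
def truncGrad (γ : ℝ) (𝓟 : PolicyClass S A d) (H : ℕ) (θ : Euc d) (m : Fin M) : Euc d :=
  ∑ h ∈ Finset.range H, γ ^ h • gradTerm 𝓜 𝓟 θ m h

lemma ScoreRegular.measurable_scoreSum (hS : ScoreRegular 𝓟 G₁ G₂) (θ : Euc d) (h : ℕ) :
    Measurable (scoreSum 𝓟 θ h) :=
  Finset.measurable_sum _ fun t _ => (hS.measurable_score θ).comp (measurable_pi_apply t)

lemma ScoreRegular.norm_scoreSum_le (hS : ScoreRegular 𝓟 G₁ G₂) (θ : Euc d) (h : ℕ)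
    (τ : Traj S A) : ‖scoreSum 𝓟 θ h τ‖ ≤ ((h : ℝ) + 1) * G₁ := by
  refine (norm_sum_le_of_le _ fun t _ => hS.2.1 θ (τ t)).trans (le_of_eq ?_)
  simp

lemma ScoreRegular.norm_reward_smul_scoreSum_le (hS : ScoreRegular 𝓟 G₁ G₂) (θ : Euc d)
    (m : Fin M) (h : ℕ) (τ : Traj S A) :
    ‖𝓜.r m (τ h) • scoreSum 𝓟 θ h τ‖ ≤ ((h : ℝ) + 1) * G₁ := by
  rw [norm_smul]
  exact (mul_le_of_le_one_left (norm_nonneg _) (𝓜.abs_r_le m _)).trans (hS.norm_scoreSum_le θ h τ)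

lemma ScoreRegular.integrable_reward_smul_scoreSum (hS : ScoreRegular 𝓟 G₁ G₂) (θ : Euc d)
    (m : Fin M) (h : ℕ) :
    Integrable (fun τ => 𝓜.r m (τ h) • scoreSum 𝓟 θ h τ) (pathOf 𝓜 𝓟 θ) :=
  Integrable.of_bound (((𝓜.r_measurable m).comp (measurable_pi_apply h)).smul
    (hS.measurable_scoreSum θ h)).aestronglyMeasurable _
    (Filter.Eventually.of_forall fun τ => hS.norm_reward_smul_scoreSum_le 𝓜 θ m h τ)

lemma ScoreRegular.norm_gradTerm_le (hS : ScoreRegular 𝓟 G₁ G₂) (θ : Euc d) (m : Fin M) (h : ℕ) :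
    ‖gradTerm 𝓜 𝓟 θ m h‖ ≤ ((h : ℝ) + 1) * G₁ := by
  have := norm_integral_le_of_norm_le_const (μ := pathOf 𝓜 𝓟 θ)
    (Filter.Eventually.of_forall fun τ => hS.norm_reward_smul_scoreSum_le 𝓜 θ m h τ)
  simpa [gradTerm] using this

lemma ScoreRegular.hasFDerivAt_likelihood (hS : ScoreRegular 𝓟 G₁ G₂) (θ θ' : Euc d) (h : ℕ)
    (τ : Traj S A) :
    HasFDerivAt (fun ϑ => likelihood 𝓟 θ ϑ h τ)
      (likelihood 𝓟 θ θ' h τ • innerSL ℝ (scoreSum 𝓟 θ' h τ)) θ' := by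
  have h1 : HasFDerivAt (fun ϑ => ∑ t ∈ Finset.range (h + 1), logRatio 𝓟 θ ϑ (τ t))
      (∑ t ∈ Finset.range (h + 1), innerSL ℝ (𝓟.score θ' (τ t))) θ' :=
    HasFDerivAt.fun_sum fun t _ => (hS.hasFDerivAt θ' (τ t)).sub_const _
  have h2 := h1.exp
  rw [scoreSum, map_sum]
  exact h2

lemma ScoreRegular.likelihood_le (hS : ScoreRegular 𝓟 G₁ G₂) (θ θ' : Euc d) (h : ℕ)
    (τ : Traj S A) :
    likelihood 𝓟 θ θ' h τ ≤ Real.exp (((h : ℝ) + 1) * (G₁ * ‖θ' - θ‖)) := by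
  refine Real.exp_le_exp.2 ((Finset.sum_le_sum fun t _ =>
    (le_abs_self _).trans (hS.logDens_lipschitz θ' θ (τ t))).trans (le_of_eq ?_))
  simp

/-- The law is frozen at θ by the likelihood ratio, whose derivative at ϑ is the ratio times the sum
of the scores. On the unit ball around θ the ratio is at most exp((h+1)G₁) and the score sum at most
(h+1)G₁, so a constant dominates the derivative. -/
lemma ScoreRegular.hasFDerivAt_reward (hS : ScoreRegular 𝓟 G₁ G₂) (hG₁ : 0 < G₁) (θ : Euc d)
    (m : Fin M) (h : ℕ) :
    HasFDerivAt (fun ϑ => ∫ τ, 𝓜.r m (τ h) ∂(pathOf 𝓜 𝓟 ϑ))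
      (innerSL ℝ (gradTerm 𝓜 𝓟 θ m h)) θ := by
  simp only [integral_pathOf_change 𝓜 𝓟 θ _ h (𝓜.r_measurable m)]
  have hr : Measurable fun τ : Traj S A => 𝓜.r m (τ h) :=
    (𝓜.r_measurable m).comp (measurable_pi_apply h)
  have hl0 : ∀ τ : Traj S A, likelihood 𝓟 θ θ h τ = 1 := fun τ => by simp [likelihood, logRatio]
  have key := hasFDerivAt_integral_of_dominated_of_fderiv_le (μ := pathOf 𝓜 𝓟 θ) (𝕜 := ℝ)
    (F := fun ϑ τ => likelihood 𝓟 θ ϑ h τ * 𝓜.r m (τ h))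
    (F' := fun ϑ τ => 𝓜.r m (τ h) • (likelihood 𝓟 θ ϑ h τ • innerSL ℝ (scoreSum 𝓟 ϑ h τ)))
    (x₀ := θ) (s := Metric.ball θ 1)
    (bound := fun _ => Real.exp (((h : ℝ) + 1) * (G₁ * 1)) * (((h : ℝ) + 1) * G₁))
    (Metric.ball_mem_nhds θ one_pos)
    (Filter.Eventually.of_forall fun ϑ =>
      ((measurable_likelihood 𝓟 θ ϑ h).mul hr).aestronglyMeasurable)
    (by
      simp only [hl0, one_mul]
      exact integrable_of_abs_le hr fun τ => 𝓜.abs_r_le m _)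
    (by
      simp only [hl0, one_smul]
      exact (hr.smul ((innerSL ℝ).continuous.measurable.comp
        (hS.measurable_scoreSum θ h))).aestronglyMeasurable)
    (Filter.Eventually.of_forall fun τ ϑ hϑ => by
      rw [norm_smul, norm_smul, innerSL_apply_norm]
      refine (mul_le_of_le_one_left (by positivity) (𝓜.abs_r_le m _)).trans ?_
      have hpos : 0 ≤ likelihood 𝓟 θ ϑ h τ := (Real.exp_pos _).le
      rw [Real.norm_of_nonneg hpos]
      refine mul_le_mul ((hS.likelihood_le θ ϑ h τ).trans (Real.exp_le_exp.2 ?_))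
        (hS.norm_scoreSum_le ϑ h τ) (norm_nonneg _) (Real.exp_pos _).le
      have := (mem_ball_iff_norm.1 hϑ).le
      gcongr)
    (integrable_const _)
    (Filter.Eventually.of_forall fun τ ϑ _ =>
      (hS.hasFDerivAt_likelihood θ ϑ h τ).mul_const (𝓜.r m (τ h)))
  refine key.congr_fderiv ?_
  have hi := hS.integrable_reward_smul_scoreSum 𝓜 θ m h
  have hmeas : AEStronglyMeasurable (fun τ => 𝓜.r m (τ h) • (likelihood 𝓟 θ θ h τ •
      innerSL ℝ (scoreSum 𝓟 θ h τ))) (pathOf 𝓜 𝓟 θ) := by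
    simp only [hl0, one_smul]
    exact (hr.smul ((innerSL ℝ).continuous.measurable.comp
        (hS.measurable_scoreSum θ h))).aestronglyMeasurable
  ext v
  rw [ContinuousLinearMap.integral_apply]
  · simp only [hl0, one_smul, innerSL_apply_apply, smul_apply, smul_eq_mul]
    rw [gradTerm, real_inner_comm, ← integral_inner hi]
    refine integral_congr_ae (Filter.Eventually.of_forall fun τ => ?_)
    simp only
    rw [inner_smul_right, real_inner_comm]
  · refine Integrable.of_bound hmeas (((h : ℝ) + 1) * G₁) (Filter.Eventually.of_forall fun τ => ?_)
    rw [hl0, one_smul, norm_smul, innerSL_apply_norm, ← norm_smul]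
    exact hS.norm_reward_smul_scoreSum_le 𝓜 θ m h τ

lemma hasSum_succ_mul_geometric (hγ : γ ∈ Set.Ioo (0 : ℝ) 1) :
    HasSum (fun h : ℕ => γ ^ h * ((h : ℝ) + 1)) (1 / (1 - γ) ^ 2) := by
  have hn : ‖γ‖ < 1 := by rw [Real.norm_of_nonneg hγ.1.le]; exact hγ.2
  have h := (hasSum_coe_mul_geometric_of_norm_lt_one hn).add
    (hasSum_geometric_of_lt_one hγ.1.le hγ.2)
  have h1 : 1 - γ ≠ 0 := by linarith [hγ.2]
  have e : 1 / (1 - γ) ^ 2 = γ / (1 - γ) ^ 2 + (1 - γ)⁻¹ := by field_simp; ring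
  rw [e]
  exact h.congr_fun fun n => by ring

lemma ScoreRegular.norm_gradTerm_smul_le (hS : ScoreRegular 𝓟 G₁ G₂)
    (hγ : γ ∈ Set.Ioo (0 : ℝ) 1) (θ : Euc d) (m : Fin M) (h : ℕ) :
    ‖γ ^ h • gradTerm 𝓜 𝓟 θ m h‖ ≤ γ ^ h * ((h : ℝ) + 1) * G₁ := by
  rw [norm_smul, norm_pow, Real.norm_of_nonneg hγ.1.le, mul_assoc]
  exact mul_le_mul_of_nonneg_left (hS.norm_gradTerm_le 𝓜 θ m h) (pow_nonneg hγ.1.le h)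

lemma ScoreRegular.summable_gradTerm (hS : ScoreRegular 𝓟 G₁ G₂)
    (hγ : γ ∈ Set.Ioo (0 : ℝ) 1) (θ : Euc d) (m : Fin M) :
    Summable fun h : ℕ => γ ^ h • gradTerm 𝓜 𝓟 θ m h :=
  Summable.of_norm_bounded ((hasSum_succ_mul_geometric hγ).mul_right G₁).summable
    fun h => hS.norm_gradTerm_smul_le 𝓜 hγ θ m h

lemma ScoreRegular.norm_gradJ_le (hS : ScoreRegular 𝓟 G₁ G₂)
    (hγ : γ ∈ Set.Ioo (0 : ℝ) 1) (θ : Euc d) (m : Fin M) :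
    ‖gradJ 𝓜 γ 𝓟 θ m‖ ≤ 1 / (1 - γ) ^ 2 * G₁ :=
  tsum_of_norm_bounded ((hasSum_succ_mul_geometric hγ).mul_right G₁)
    fun h => hS.norm_gradTerm_smul_le 𝓜 hγ θ m h

lemma hasSum_succ_mul_geometric_tail (hγ : γ ∈ Set.Ioo (0 : ℝ) 1) (H : ℕ) :
    HasSum (fun h : ℕ => γ ^ (h + H) * (((h + H : ℕ) : ℝ) + 1))
      (γ ^ H * (H / (1 - γ) + 1 / (1 - γ) ^ 2)) := by
  have h := ((hasSum_succ_mul_geometric hγ).add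
    ((hasSum_geometric_of_lt_one hγ.1.le hγ.2).mul_left (H : ℝ))).mul_left (γ ^ H)
  have e : γ ^ H * (H / (1 - γ) + 1 / (1 - γ) ^ 2) =
      γ ^ H * (1 / (1 - γ) ^ 2 + H * (1 - γ)⁻¹) := by ring
  rw [e]
  exact h.congr_fun fun n => by push_cast; ring

lemma ScoreRegular.norm_gradJ_sub_truncGrad_le (hS : ScoreRegular 𝓟 G₁ G₂)
    (hγ : γ ∈ Set.Ioo (0 : ℝ) 1) (θ : Euc d) (m : Fin M) (H : ℕ) :
    ‖gradJ 𝓜 γ 𝓟 θ m - truncGrad 𝓜 γ 𝓟 H θ m‖ ≤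
      γ ^ H * (H / (1 - γ) + 1 / (1 - γ) ^ 2) * G₁ := by
  have e : gradJ 𝓜 γ 𝓟 θ m - truncGrad 𝓜 γ 𝓟 H θ m =
      ∑' h : ℕ, γ ^ (h + H) • gradTerm 𝓜 𝓟 θ m (h + H) := by
    rw [gradJ, truncGrad, ← (hS.summable_gradTerm 𝓜 hγ θ m).sum_add_tsum_nat_add H]
    exact add_sub_cancel_left _ _
  rw [e]
  exact tsum_of_norm_bounded ((hasSum_succ_mul_geometric_tail hγ H).mul_right G₁)
    fun h => hS.norm_gradTerm_smul_le 𝓜 hγ θ m (h + H)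

lemma ScoreRegular.norm_truncGrad_le (hS : ScoreRegular 𝓟 G₁ G₂)
    (hγ : γ ∈ Set.Ioo (0 : ℝ) 1) (hG₁ : 0 < G₁) (θ : Euc d) (m : Fin M) (H : ℕ) :
    ‖truncGrad 𝓜 γ 𝓟 H θ m‖ ≤ 1 / (1 - γ) ^ 2 * G₁ := by
  refine (norm_sum_le_of_le _ fun h _ => hS.norm_gradTerm_smul_le 𝓜 hγ θ m h).trans ?_
  exact sum_le_hasSum _ (fun h _ => by have := hγ.1; positivity)
    ((hasSum_succ_mul_geometric hγ).mul_right G₁)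

/-- The policy gradient theorem. -/
lemma ScoreRegular.hasGradientAt_J (hS : ScoreRegular 𝓟 G₁ G₂) (hG₁ : 0 < G₁)
    (hγ : γ ∈ Set.Ioo (0 : ℝ) 1) (θ : Euc d) (m : Fin M) :
    HasGradientAt (fun ϑ => 𝓜.J γ (𝓟.policy ϑ) m) (gradJ 𝓜 γ 𝓟 θ m) θ := by
  rw [hasGradientAt_iff_hasFDerivAt]
  have hJ : ∀ ϑ, HasSum (fun h => γ ^ h * ∫ τ, 𝓜.r m (τ h) ∂(pathOf 𝓜 𝓟 ϑ))
      (𝓜.J γ (𝓟.policy ϑ) m) := by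
    intro ϑ
    refine (𝓜.hasSum_J (𝓟.policy ϑ) hγ m).congr_fun fun t => ?_
    rw [MDP.margin, integral_map (measurable_pi_apply t).aemeasurable
      (𝓜.r_measurable m).aestronglyMeasurable]
  have e : (fun ϑ => 𝓜.J γ (𝓟.policy ϑ) m) =
      fun ϑ => ∑' h, γ ^ h * ∫ τ, 𝓜.r m (τ h) ∂(pathOf 𝓜 𝓟 ϑ) :=
    funext fun ϑ => (hJ ϑ).tsum_eq.symm
  rw [e]
  -- The term gradients are bounded uniformly in ϑ by the summable γ^h (h+1) G₁, so the series may
  -- be differentiated term by term.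
  have key := hasFDerivAt_tsum (𝕜 := ℝ) (x₀ := θ)
    (f := fun h ϑ => γ ^ h * ∫ τ, 𝓜.r m (τ h) ∂(pathOf 𝓜 𝓟 ϑ))
    (f' := fun h ϑ => γ ^ h • innerSL ℝ (gradTerm 𝓜 𝓟 ϑ m h))
    (u := fun h : ℕ => γ ^ h * ((h : ℝ) + 1) * G₁)
    ((hasSum_succ_mul_geometric hγ).mul_right G₁).summable
    (fun h ϑ => (hS.hasFDerivAt_reward 𝓜 hG₁ ϑ m h).const_mul (γ ^ h))
    (fun h ϑ => by
      rw [norm_smul, innerSL_apply_norm, ← norm_smul]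
      exact hS.norm_gradTerm_smul_le 𝓜 hγ ϑ m h)
    (hJ θ).summable θ
  refine key.congr_fderiv ?_
  have hs := (hS.summable_gradTerm 𝓜 hγ θ m).hasSum.map
    (InnerProductSpace.toDual ℝ (Euc d)) (LinearIsometryEquiv.continuous _)
  rw [gradJ, ← hs.tsum_eq]
  refine tsum_congr fun h => ?_
  ext v
  simp

/-- The gradient of `θ ↦ f(J^{π_θ})`. -/
def gradObj (γ : ℝ) (𝓟 : PolicyClass S A d) (f : Euc M → ℝ) (θ : Euc d) : Euc d :=
  ∑ m, partialD f m (𝓜.J γ (𝓟.policy θ)) • gradJ 𝓜 γ 𝓟 θ m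

/-- The chain rule needs Fréchet differentiability of f at J, which concavity supplies from the
partial derivatives alone, even when J lies on the boundary of the box. -/
lemma ScoreRegular.hasGradientAt_objective (hS : ScoreRegular 𝓟 G₁ G₂) (hG₁ : 0 < G₁)
    (hγ : γ ∈ Set.Ioo (0 : ℝ) 1) (hM : 0 < M) {f : Euc M → ℝ} (hf : ConcaveOn ℝ Set.univ f)
    {Lf : ℝ} (hs : SmoothOnBox f γ Lf) (θ : Euc d) :
    HasGradientAt (fun ϑ => f (𝓜.J γ (𝓟.policy ϑ))) (gradObj 𝓜 γ 𝓟 f θ) θ := by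
  rw [hasGradientAt_iff_hasFDerivAt]
  have hJm := fun m => (hS.hasGradientAt_J 𝓜 hG₁ hγ θ m).hasFDerivAt
  have hJ : DifferentiableAt ℝ (fun ϑ => 𝓜.J γ (𝓟.policy ϑ)) θ :=
    differentiableAt_euclidean.2 fun m => (hJm m).differentiableAt
  have hfd := concave_hasFDerivAt hf hM
    (x := 𝓜.J γ (𝓟.policy θ)) fun m => (hs m).1 _ (𝓜.J_mem_box _ hγ)
  refine (HasFDerivAt.comp θ (f := fun ϑ => 𝓜.J γ (𝓟.policy ϑ)) hfd
    hJ.hasFDerivAt).congr_fderiv ?_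
  ext v
  have hc : ∀ m, (fderiv ℝ (fun ϑ => 𝓜.J γ (𝓟.policy ϑ)) θ v) m =
      inner ℝ (gradJ 𝓜 γ 𝓟 θ m) v := by
    intro m
    have h1 : HasFDerivAt (fun ϑ => 𝓜.J γ (𝓟.policy ϑ) m)
        ((EuclideanSpace.proj m : Euc M →L[ℝ] ℝ) ∘L
          fderiv ℝ (fun ϑ => 𝓜.J γ (𝓟.policy ϑ)) θ) θ :=
      (EuclideanSpace.proj m : Euc M →L[ℝ] ℝ).hasFDerivAt.comp θ hJ.hasFDerivAt
    have h2 := h1.unique (hJm m)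
    exact congrArg (fun T => T v) h2
  simp only [ContinuousLinearMap.comp_apply, coordFunctional_apply, hc, gradObj,
    InnerProductSpace.toDual_apply_apply, sum_inner, inner_smul_left]
  rfl

lemma ScoreRegular.norm_gradObj_le (hS : ScoreRegular 𝓟 G₁ G₂)
    (hγ : γ ∈ Set.Ioo (0 : ℝ) 1) {f : Euc M → ℝ} {C : ℝ}
    (hC : ∀ m, ∀ y ∈ box M γ, |partialD f m y| ≤ C) (θ : Euc d) :
    ‖gradObj 𝓜 γ 𝓟 f θ‖ ≤ M * (C * (1 / (1 - γ) ^ 2 * G₁)) := by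
  refine (norm_sum_le_of_le (n := fun _ => C * (1 / (1 - γ) ^ 2 * G₁)) _ fun m _ => ?_).trans
    (le_of_eq (by simp))
  · rw [norm_smul]
    have hb := hC m _ (𝓜.J_mem_box (𝓟.policy θ) hγ)
    exact mul_le_mul hb (hS.norm_gradJ_le 𝓜 hγ θ m) (norm_nonneg _) ((abs_nonneg _).trans hb)

end PolicyGradient

/-! ### Fisher information -/

section Fisher

variable (𝓜 : MDP S A M) {𝓟 : PolicyClass S A d} {G₁ G₂ γ : ℝ}

/-- The operator `v ↦ ⟨ψ, v⟩ ψ`. -/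
def outerOp (ψ : Euc d) : Euc d →L[ℝ] Euc d := (innerSL ℝ ψ).smulRight ψ

@[simp] lemma outerOp_apply (ψ v : Euc d) : outerOp ψ v = inner ℝ ψ v • ψ := rfl

lemma continuous_outerOp : Continuous (outerOp (d := d)) := by
  have : (outerOp (d := d)) = fun ψ =>
      ContinuousLinearMap.smulRightL ℝ (Euc d) (Euc d) (innerSL ℝ ψ) ψ := by
    funext ψ; rfl
  rw [this]
  exact ((ContinuousLinearMap.smulRightL ℝ (Euc d) (Euc d)).continuous.comp
    (innerSL ℝ).continuous).clm_apply continuous_id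

lemma norm_outerOp_le (ψ : Euc d) : ‖outerOp ψ‖ ≤ ‖ψ‖ ^ 2 :=
  ContinuousLinearMap.opNorm_le_bound _ (by positivity) fun v => by
    rw [outerOp_apply, norm_smul]
    have := norm_inner_le_norm (𝕜 := ℝ) ψ v
    nlinarith [norm_nonneg ψ]

/-- The Fisher estimate formed from one trajectory, as an operator. -/
def sampleFisher (γ : ℝ) (𝓟 : PolicyClass S A d) (H : ℕ) (θ : Euc d) (τ : Traj S A) :
    Euc d →L[ℝ] Euc d :=
  ∑ t ∈ Finset.range H, γ ^ t • outerOp (𝓟.score θ (τ t))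

lemma sampleFisher_apply (γ : ℝ) (𝓟 : PolicyClass S A d) (H : ℕ) (θ : Euc d) (τ : Traj S A)
    (v : Euc d) : sampleFisher γ 𝓟 H θ τ v =
      ∑ t ∈ Finset.range H, γ ^ t • (inner ℝ (𝓟.score θ (τ t)) v • 𝓟.score θ (τ t)) := by
  simp [sampleFisher]

lemma fisherEst_mulVec (γ : ℝ) (𝓟 : PolicyClass S A d) (H : ℕ) (θ : Euc d) (τ : Traj S A)
    (v : Euc d) :
    WithLp.toLp 2 ((fisherEst γ 𝓟 H θ τ).mulVec v.ofLp) = sampleFisher γ 𝓟 H θ τ v := by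
  rw [sampleFisher_apply]
  ext i
  simp only [fisherEst, Matrix.sum_mulVec, Matrix.smul_mulVec, Matrix.vecMulVec_mulVec]
  simp [PiLp.inner_apply, dotProduct, Finset.sum_apply, mul_comm]

lemma inner_sampleFisher (γ : ℝ) (𝓟 : PolicyClass S A d) (H : ℕ) (θ : Euc d) (τ : Traj S A)
    (v u : Euc d) : inner ℝ (sampleFisher γ 𝓟 H θ τ v) u =
      ∑ t ∈ Finset.range H, γ ^ t *
        (inner ℝ (𝓟.score θ (τ t)) v * inner ℝ (𝓟.score θ (τ t)) u) := by
  rw [sampleFisher_apply, sum_inner]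
  simp [inner_smul_left]

lemma geom_sum_le (hγ : γ ∈ Set.Ioo (0 : ℝ) 1) (H : ℕ) :
    ∑ t ∈ Finset.range H, γ ^ t ≤ 1 / (1 - γ) := by
  rw [one_div]
  exact sum_le_hasSum _ (fun t _ => pow_nonneg hγ.1.le t)
    (hasSum_geometric_of_lt_one hγ.1.le hγ.2)

lemma ScoreRegular.abs_inner_mul_inner_le (hS : ScoreRegular 𝓟 G₁ G₂) (θ : Euc d)
    (v u : Euc d) (x : S × A) :
    |inner ℝ (𝓟.score θ x) v * inner ℝ (𝓟.score θ x) u| ≤ G₁ ^ 2 * (‖v‖ * ‖u‖) := by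
  have h := hS.2.1 θ x
  have h1 := (abs_real_inner_le_norm (𝓟.score θ x) v).trans
    (mul_le_mul_of_nonneg_right h (norm_nonneg v))
  have h2 := (abs_real_inner_le_norm (𝓟.score θ x) u).trans
    (mul_le_mul_of_nonneg_right h (norm_nonneg u))
  rw [abs_mul]
  calc _ ≤ (G₁ * ‖v‖) * (G₁ * ‖u‖) := mul_le_mul h1 h2 (abs_nonneg _) ((abs_nonneg _).trans h1)
    _ = _ := by ring

lemma ScoreRegular.measurable_inner_mul_inner (hS : ScoreRegular 𝓟 G₁ G₂) (θ : Euc d)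
    (v u : Euc d) :
    Measurable fun x => inner ℝ (𝓟.score θ x) v * inner ℝ (𝓟.score θ x) u :=
  ((hS.measurable_score θ).inner_const).mul ((hS.measurable_score θ).inner_const)

lemma inner_sampleFisher_nonneg (hγ : γ ∈ Set.Ioo (0 : ℝ) 1) (H : ℕ) (θ : Euc d)
    (τ : Traj S A) (v : Euc d) : 0 ≤ inner ℝ (sampleFisher γ 𝓟 H θ τ v) v := by
  rw [inner_sampleFisher]
  exact Finset.sum_nonneg fun t _ => mul_nonneg (pow_nonneg hγ.1.le t) (mul_self_nonneg _)

lemma ScoreRegular.inner_sampleFisher_le (hS : ScoreRegular 𝓟 G₁ G₂)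
    (hγ : γ ∈ Set.Ioo (0 : ℝ) 1) (H : ℕ) (θ : Euc d) (τ : Traj S A) (v : Euc d) :
    inner ℝ (sampleFisher γ 𝓟 H θ τ v) v ≤ G₁ ^ 2 / (1 - γ) * ‖v‖ ^ 2 := by
  rw [inner_sampleFisher]
  calc _ ≤ ∑ t ∈ Finset.range H, γ ^ t * (G₁ ^ 2 * (‖v‖ * ‖v‖)) :=
        Finset.sum_le_sum fun t _ => mul_le_mul_of_nonneg_left
          ((le_abs_self _).trans (hS.abs_inner_mul_inner_le θ v v (τ t))) (pow_nonneg hγ.1.le t)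
    _ = (∑ t ∈ Finset.range H, γ ^ t) * (G₁ ^ 2 * (‖v‖ * ‖v‖)) := by rw [Finset.sum_mul]
    _ ≤ 1 / (1 - γ) * (G₁ ^ 2 * (‖v‖ * ‖v‖)) :=
        mul_le_mul_of_nonneg_right (geom_sum_le hγ H) (by positivity)
    _ = _ := by ring

lemma ScoreRegular.norm_sampleFisher_le (hS : ScoreRegular 𝓟 G₁ G₂)
    (hγ : γ ∈ Set.Ioo (0 : ℝ) 1) (H : ℕ) (θ : Euc d) (τ : Traj S A) :
    ‖sampleFisher γ 𝓟 H θ τ‖ ≤ G₁ ^ 2 / (1 - γ) := by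
  calc _ ≤ ∑ t ∈ Finset.range H, γ ^ t * G₁ ^ 2 := by
        refine norm_sum_le_of_le _ fun t _ => ?_
        rw [norm_smul, norm_pow, Real.norm_of_nonneg hγ.1.le]
        refine mul_le_mul_of_nonneg_left ((norm_outerOp_le _).trans ?_) (pow_nonneg hγ.1.le t)
        exact pow_le_pow_left₀ (norm_nonneg _) (hS.2.1 θ (τ t)) 2
    _ = (∑ t ∈ Finset.range H, γ ^ t) * G₁ ^ 2 := by rw [Finset.sum_mul]
    _ ≤ 1 / (1 - γ) * G₁ ^ 2 :=
        mul_le_mul_of_nonneg_right (geom_sum_le hγ H) (by positivity)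
    _ = _ := by ring

lemma ScoreRegular.measurable_sampleFisher_prod (hS : ScoreRegular 𝓟 G₁ G₂) (γ : ℝ) (H : ℕ) :
    Measurable fun p : Euc d × Traj S A => sampleFisher γ 𝓟 H p.1 p.2 :=
  Finset.measurable_sum _ fun t _ => ((continuous_outerOp.measurable.comp
    (hS.measurable_score_prod.comp (measurable_fst.prodMk
      ((measurable_pi_apply t).comp measurable_snd)))).const_smul (γ ^ t))

lemma ScoreRegular.measurable_sampleFisher (hS : ScoreRegular 𝓟 G₁ G₂) (γ : ℝ) (H : ℕ)
    (θ : Euc d) : Measurable fun τ : Traj S A => sampleFisher γ 𝓟 H θ τ :=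
  Finset.measurable_sum _ fun t _ => ((continuous_outerOp.measurable.comp
    ((hS.measurable_score θ).comp (measurable_pi_apply t))).const_smul (γ ^ t))

lemma ScoreRegular.integrable_sampleFisher (hS : ScoreRegular 𝓟 G₁ G₂)
    (hγ : γ ∈ Set.Ioo (0 : ℝ) 1) (H : ℕ) (θ : Euc d) :
    Integrable (sampleFisher γ 𝓟 H θ) (pathOf 𝓜 𝓟 θ) :=
  Integrable.of_bound (hS.measurable_sampleFisher γ H θ).aestronglyMeasurable _
    (Filter.Eventually.of_forall fun τ => hS.norm_sampleFisher_le hγ H θ τ)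

/-- The mean of the Fisher estimate. -/
def truncFisher (γ : ℝ) (𝓟 : PolicyClass S A d) (H : ℕ) (θ : Euc d) : Euc d →L[ℝ] Euc d :=
  ∫ τ, sampleFisher γ 𝓟 H θ τ ∂(pathOf 𝓜 𝓟 θ)

lemma ScoreRegular.truncFisher_apply (hS : ScoreRegular 𝓟 G₁ G₂)
    (hγ : γ ∈ Set.Ioo (0 : ℝ) 1) (H : ℕ) (θ v : Euc d) :
    truncFisher 𝓜 γ 𝓟 H θ v = ∫ τ, sampleFisher γ 𝓟 H θ τ v ∂(pathOf 𝓜 𝓟 θ) :=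
  ContinuousLinearMap.integral_apply (hS.integrable_sampleFisher 𝓜 hγ H θ) v

lemma ScoreRegular.integrable_sampleFisher_apply (hS : ScoreRegular 𝓟 G₁ G₂)
    (hγ : γ ∈ Set.Ioo (0 : ℝ) 1) (H : ℕ) (θ v : Euc d) :
    Integrable (fun τ => sampleFisher γ 𝓟 H θ τ v) (pathOf 𝓜 𝓟 θ) :=
  (hS.integrable_sampleFisher 𝓜 hγ H θ).apply_continuousLinearMap v

lemma ScoreRegular.inner_truncFisher_eq_integral (hS : ScoreRegular 𝓟 G₁ G₂)
    (hγ : γ ∈ Set.Ioo (0 : ℝ) 1) (H : ℕ) (θ v u : Euc d) :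
    inner ℝ (truncFisher 𝓜 γ 𝓟 H θ v) u =
      ∫ τ, inner ℝ (sampleFisher γ 𝓟 H θ τ v) u ∂(pathOf 𝓜 𝓟 θ) := by
  rw [hS.truncFisher_apply 𝓜 hγ, real_inner_comm,
    ← integral_inner (hS.integrable_sampleFisher_apply 𝓜 hγ H θ v)]
  simp only [real_inner_comm]

lemma ScoreRegular.inner_truncFisher (hS : ScoreRegular 𝓟 G₁ G₂)
    (hγ : γ ∈ Set.Ioo (0 : ℝ) 1) (H : ℕ) (θ v u : Euc d) :
    inner ℝ (truncFisher 𝓜 γ 𝓟 H θ v) u = ∑ t ∈ Finset.range H, γ ^ t *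
      ∫ x, inner ℝ (𝓟.score θ x) v * inner ℝ (𝓟.score θ x) u ∂(𝓜.margin (𝓟.policy θ) t) := by
  rw [hS.inner_truncFisher_eq_integral 𝓜 hγ]
  simp only [inner_sampleFisher]
  have hm := hS.measurable_inner_mul_inner θ v u
  rw [integral_finsetSum]
  · refine Finset.sum_congr rfl fun t _ => ?_
    rw [integral_const_mul, MDP.margin, integral_map (measurable_pi_apply t).aemeasurable
      hm.aestronglyMeasurable]
  · intro t _
    have hi : Integrable (fun τ : Traj S A =>
        inner ℝ (𝓟.score θ (τ t)) v * inner ℝ (𝓟.score θ (τ t)) u) (pathOf 𝓜 𝓟 θ) :=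
      integrable_of_abs_le (hm.comp (measurable_pi_apply t))
        (fun τ => hS.abs_inner_mul_inner_le θ v u (τ t))
    exact hi.const_mul _

lemma inner_fisher_mulVec (hS : ScoreRegular 𝓟 G₁ G₂)
    (hγ : γ ∈ Set.Ioo (0 : ℝ) 1) (θ v u : Euc d) :
    inner ℝ (WithLp.toLp 2 ((𝓜.fisher γ 𝓟 θ).mulVec v.ofLp) : Euc d) u =
      ∫ x, inner ℝ (𝓟.score θ x) v * inner ℝ (𝓟.score θ x) u
        ∂(𝓜.visitSA γ (𝓟.policy θ)) := by
  have := 𝓜.isProbabilityMeasure_visitSA (𝓟.policy θ) hγ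
  have hc : ∀ (x : S × A) (i : Fin d), |𝓟.score θ x i| ≤ G₁ := fun x i =>
    (PiLp.norm_apply_le (𝓟.score θ x) i).trans (hS.2.1 θ x)
  have hcm : ∀ i : Fin d, Measurable fun x => 𝓟.score θ x i := fun i =>
    ((EuclideanSpace.proj i : Euc d →L[ℝ] ℝ).continuous.measurable).comp (hS.measurable_score θ)
  have h_int : ∀ i j, Integrable (fun x => 𝓟.score θ x i * 𝓟.score θ x j)
      (𝓜.visitSA γ (𝓟.policy θ)) := fun i j =>
    integrable_of_abs_le ((hcm i).mul (hcm j)) (B := G₁ * G₁) fun x => by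
      rw [abs_mul]
      exact mul_le_mul (hc x i) (hc x j) (abs_nonneg _) ((abs_nonneg _).trans (hc x i))
  have e : ∀ x, inner ℝ (𝓟.score θ x) v * inner ℝ (𝓟.score θ x) u =
      ∑ i, ∑ j, (u i * v j) * (𝓟.score θ x i * 𝓟.score θ x j) := by
    intro x
    simp only [PiLp.inner_apply, RCLike.inner_apply, conj_trivial]
    rw [mul_comm, Finset.sum_mul_sum]
    refine Finset.sum_congr rfl fun i _ => Finset.sum_congr rfl fun j _ => by ring
  simp only [e]
  rw [integral_finsetSum _ fun i _ => integrable_finsetSum _ fun j _ => (h_int i j).const_mul _]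
  simp only [PiLp.inner_apply, RCLike.inner_apply, conj_trivial, Matrix.mulVec, dotProduct,
    Finset.mul_sum]
  refine Finset.sum_congr rfl fun i _ => ?_
  rw [integral_finsetSum _ fun j _ => (h_int i j).const_mul _]
  refine Finset.sum_congr rfl fun j _ => ?_
  rw [integral_const_mul, MDP.fisher, Matrix.of_apply]
  ring

/-- The discounted sum of E[ψ_t ψ_tᵀ] over all t equals F/(1-γ), and truncation drops a tail of
total weight γ^H/(1-γ). Hence the inner loop solves a system whose solution is near (1-γ)ω* rather
than ω*. -/
lemma ScoreRegular.abs_fisher_sub_truncFisher_le (hS : ScoreRegular 𝓟 G₁ G₂)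
    (hγ : γ ∈ Set.Ioo (0 : ℝ) 1) (H : ℕ) (θ v u : Euc d) :
    |(1 - γ)⁻¹ * inner ℝ (WithLp.toLp 2 ((𝓜.fisher γ 𝓟 θ).mulVec v.ofLp) : Euc d) u -
      inner ℝ (truncFisher 𝓜 γ 𝓟 H θ v) u| ≤ γ ^ H * (G₁ ^ 2 / (1 - γ)) * (‖v‖ * ‖u‖) := by
  rw [inner_fisher_mulVec 𝓜 hS hγ, hS.inner_truncFisher 𝓜 hγ]
  have hb := hS.abs_inner_mul_inner_le θ v u
  have h := 𝓜.hasSum_integral_visitSA (𝓟.policy θ) hγ (hS.measurable_inner_mul_inner θ v u) hb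
  rw [← h.tsum_eq, ← h.summable.sum_add_tsum_nat_add H, add_sub_cancel_left]
  have e : ∀ t, γ ^ (t + H) * ∫ x, inner ℝ (𝓟.score θ x) v * inner ℝ (𝓟.score θ x) u
      ∂(𝓜.margin (𝓟.policy θ) (t + H)) = γ ^ H * (γ ^ t * ∫ x, inner ℝ (𝓟.score θ x) v *
        inner ℝ (𝓟.score θ x) u ∂(𝓜.margin (𝓟.policy θ) (t + H))) := fun t => by ring
  simp only [e]
  rw [tsum_mul_left, abs_mul, abs_of_nonneg (pow_nonneg hγ.1.le H), mul_assoc]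
  refine mul_le_mul_of_nonneg_left ?_ (pow_nonneg hγ.1.le H)
  refine (abs_tsum_geometric_mul_le hγ.1.le hγ.2 fun t => abs_integral_le_of_abs_le hb).trans
    (le_of_eq ?_)
  ring

/-! ### Contraction of the inner iteration -/

/-- The upper bound on β makes 0 ≤ βF̂ ≤ I as quadratic forms for every trajectory. Pathwise
nonexpansiveness is what controls the second moment of the inner loop. -/
lemma ScoreRegular.norm_sub_smul_sampleFisher_le (hS : ScoreRegular 𝓟 G₁ G₂)
    (hG₁ : 0 < G₁) (hγ : γ ∈ Set.Ioo (0 : ℝ) 1) {β : ℝ} (hβ0 : 0 ≤ β)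
    (hβ : β ≤ (1 - γ) / G₁ ^ 2) (H : ℕ) (θ : Euc d) (τ : Traj S A) (v : Euc d) :
    ‖v - β • sampleFisher γ 𝓟 H θ τ v‖ ≤ ‖v‖ := by
  have h1 : 0 < 1 - γ := by linarith [hγ.2]
  have key := norm_apply_le_of_quadratic_le
    (ContinuousLinearMap.id ℝ (Euc d) - β • sampleFisher γ 𝓟 H θ τ) (fun v w => ?_) one_pos
    (fun v => ?_) v
  · simpa using key
  · simp only [sub_apply, smul_apply, ContinuousLinearMap.id_apply, inner_sub_left,
      inner_sub_right, inner_smul_left, inner_smul_right, conj_trivial]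
    rw [real_inner_comm (sampleFisher γ 𝓟 H θ τ w) v, inner_sampleFisher, inner_sampleFisher]
    simp only [mul_comm]
  · simp only [sub_apply, smul_apply, ContinuousLinearMap.id_apply, inner_sub_left,
      inner_smul_left, conj_trivial, real_inner_self_eq_norm_sq, one_mul]
    have a := mul_nonneg hβ0 (inner_sampleFisher_nonneg (𝓟 := 𝓟) hγ H θ τ v)
    have b := mul_le_mul hβ (hS.inner_sampleFisher_le hγ H θ τ v)
      (inner_sampleFisher_nonneg hγ H θ τ v) (by positivity)
    have c : (1 - γ) / G₁ ^ 2 * (G₁ ^ 2 / (1 - γ) * ‖v‖ ^ 2) = ‖v‖ ^ 2 := by field_simp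
    rw [abs_le]
    constructor <;> nlinarith [sq_nonneg ‖v‖]

lemma ScoreRegular.inner_truncFisher_le (hS : ScoreRegular 𝓟 G₁ G₂)
    (hγ : γ ∈ Set.Ioo (0 : ℝ) 1) (H : ℕ) (θ v : Euc d) :
    inner ℝ (truncFisher 𝓜 γ 𝓟 H θ v) v ≤ G₁ ^ 2 / (1 - γ) * ‖v‖ ^ 2 := by
  rw [hS.inner_truncFisher_eq_integral 𝓜 hγ]
  have hi : Integrable (fun τ => inner ℝ (sampleFisher γ 𝓟 H θ τ v) v) (pathOf 𝓜 𝓟 θ) :=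
    (hS.integrable_sampleFisher_apply 𝓜 hγ H θ v).inner_const v
  refine (integral_mono hi (integrable_const (G₁ ^ 2 / (1 - γ) * ‖v‖ ^ 2)) fun τ =>
    hS.inner_sampleFisher_le hγ H θ τ v).trans (le_of_eq (by simp))

lemma ScoreRegular.truncFisher_symm (hS : ScoreRegular 𝓟 G₁ G₂)
    (hγ : γ ∈ Set.Ioo (0 : ℝ) 1) (H : ℕ) (θ v w : Euc d) :
    inner ℝ (truncFisher 𝓜 γ 𝓟 H θ v) w = inner ℝ v (truncFisher 𝓜 γ 𝓟 H θ w) := by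
  rw [real_inner_comm (truncFisher 𝓜 γ 𝓟 H θ w) v, hS.inner_truncFisher 𝓜 hγ,
    hS.inner_truncFisher 𝓜 hγ]
  simp only [mul_comm]

/-- The quadratic form of I - βF̄ lies between 0 and 1 - βl ≤ exp(-βl) times ‖v‖². The exponential
form makes N steps multiply cleanly. -/
lemma ScoreRegular.norm_sub_smul_truncFisher_le (hS : ScoreRegular 𝓟 G₁ G₂)
    (hG₁ : 0 < G₁) (hγ : γ ∈ Set.Ioo (0 : ℝ) 1) {β : ℝ} (hβ0 : 0 ≤ β)
    (hβ : β ≤ (1 - γ) / G₁ ^ 2) {H : ℕ} {θ : Euc d} {l : ℝ}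
    (hl : ∀ v, l * ‖v‖ ^ 2 ≤ inner ℝ (truncFisher 𝓜 γ 𝓟 H θ v) v) (v : Euc d) :
    ‖v - β • truncFisher 𝓜 γ 𝓟 H θ v‖ ≤ Real.exp (-(β * l)) * ‖v‖ := by
  have h1 : 0 < 1 - γ := by linarith [hγ.2]
  have key := norm_apply_le_of_quadratic_le
    (ContinuousLinearMap.id ℝ (Euc d) - β • truncFisher 𝓜 γ 𝓟 H θ) (fun v w => ?_)
    (Real.exp_pos (-(β * l))) (fun v => ?_) v
  · simpa using key
  · simp only [sub_apply, smul_apply, ContinuousLinearMap.id_apply, inner_sub_left,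
      inner_sub_right, inner_smul_left, inner_smul_right, conj_trivial,
      hS.truncFisher_symm 𝓜 hγ H θ v w]
  · simp only [sub_apply, smul_apply, ContinuousLinearMap.id_apply, inner_sub_left,
      inner_smul_left, conj_trivial, real_inner_self_eq_norm_sq]
    have a := mul_le_mul_of_nonneg_left (hl v) hβ0
    have b := (mul_le_mul_of_nonneg_left (hS.inner_truncFisher_le 𝓜 hγ H θ v) hβ0).trans
      (mul_le_mul_of_nonneg_right hβ (by positivity))
    have c : (1 - γ) / G₁ ^ 2 * (G₁ ^ 2 / (1 - γ) * ‖v‖ ^ 2) = ‖v‖ ^ 2 := by field_simp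
    have e := mul_le_mul_of_nonneg_right (Real.add_one_le_exp (-(β * l))) (sq_nonneg ‖v‖)
    have e' : 0 ≤ Real.exp (-(β * l)) * ‖v‖ ^ 2 := by positivity
    rw [abs_le]
    constructor <;> nlinarith

/-! ### The natural policy gradient -/

lemma FisherNondegenerate.le_inner {μ : ℝ} (hF : FisherNondegenerate 𝓜 γ 𝓟 μ) (θ v : Euc d) :
    μ * ‖v‖ ^ 2 ≤
      inner ℝ (WithLp.toLp 2 ((𝓜.fisher γ 𝓟 θ).mulVec v.ofLp) : Euc d) v := by
  have h := (Matrix.posSemidef_iff_dotProduct_mulVec.1 (hF θ)).2 v.ofLp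
  have e : inner ℝ (WithLp.toLp 2 ((𝓜.fisher γ 𝓟 θ).mulVec v.ofLp) : Euc d) v =
      v.ofLp ⬝ᵥ ((𝓜.fisher γ 𝓟 θ).mulVec v.ofLp) := by
    simp [PiLp.inner_apply, dotProduct]
  have e2 : ‖v‖ ^ 2 = v.ofLp ⬝ᵥ v.ofLp := by
    rw [EuclideanSpace.norm_sq_eq]
    simp [dotProduct, sq]
  rw [e, e2]
  simp only [star_trivial, Matrix.sub_mulVec, Matrix.smul_mulVec, Matrix.one_mulVec,
    dotProduct_sub, dotProduct_smul, smul_eq_mul] at h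
  linarith

lemma FisherNondegenerate.le_inner_truncFisher {μ : ℝ} (hF : FisherNondegenerate 𝓜 γ 𝓟 μ)
    (hS : ScoreRegular 𝓟 G₁ G₂) (hγ : γ ∈ Set.Ioo (0 : ℝ) 1) (H : ℕ) (θ v : Euc d) :
    (μ - γ ^ H * G₁ ^ 2) / (1 - γ) * ‖v‖ ^ 2 ≤ inner ℝ (truncFisher 𝓜 γ 𝓟 H θ v) v := by
  have h1 : 0 < 1 - γ := by linarith [hγ.2]
  have a := (abs_le.1 (hS.abs_fisher_sub_truncFisher_le 𝓜 hγ H θ v v)).2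
  have b := mul_le_mul_of_nonneg_left (hF.le_inner 𝓜 θ v) (inv_nonneg.2 h1.le)
  have c : (μ - γ ^ H * G₁ ^ 2) / (1 - γ) * ‖v‖ ^ 2 =
      (1 - γ)⁻¹ * (μ * ‖v‖ ^ 2) - γ ^ H * (G₁ ^ 2 / (1 - γ)) * (‖v‖ * ‖v‖) := by
    field_simp
  rw [c]
  linarith

/-- Positive definiteness makes the Fisher matrix injective, hence invertible, so the inverse in
`npg` is a genuine one. -/
lemma FisherNondegenerate.fisher_mulVec_npg {μ : ℝ} (hF : FisherNondegenerate 𝓜 γ 𝓟 μ)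
    (hμ : 0 < μ) {f : Euc M → ℝ} {θ g : Euc d}
    (hg : HasGradientAt (fun ϑ => f (𝓜.J γ (𝓟.policy ϑ))) g θ) :
    WithLp.toLp 2 ((𝓜.fisher γ 𝓟 θ).mulVec (𝓜.npg γ 𝓟 f θ).ofLp) = g := by
  have hu : IsUnit (𝓜.fisher γ 𝓟 θ) := by
    rw [← Matrix.mulVec_injective_iff_isUnit]
    intro v w hvw
    have h0 : (𝓜.fisher γ 𝓟 θ).mulVec (v - w) = 0 := by
      rw [Matrix.mulVec_sub, sub_eq_zero]; exact hvw
    have h := hF.le_inner 𝓜 θ (WithLp.toLp 2 (v - w))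
    simp only [h0, WithLp.toLp_zero, inner_zero_left] at h
    have : ‖(WithLp.toLp 2 (v - w) : Euc d)‖ = 0 := by
      by_contra hne
      have : 0 < ‖(WithLp.toLp 2 (v - w) : Euc d)‖ ^ 2 := by positivity
      nlinarith
    have h2 := norm_eq_zero.1 this
    exact sub_eq_zero.1 (congrArg WithLp.ofLp h2)
  rw [MDP.npg, hg.gradient]
  simp only [Matrix.mulVec_mulVec]
  rw [Matrix.mul_nonsing_inv _ ((Matrix.isUnit_iff_isUnit_det _).1 hu), Matrix.one_mulVec]

lemma FisherNondegenerate.norm_npg_le {μ : ℝ} (hF : FisherNondegenerate 𝓜 γ 𝓟 μ)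
    (hμ : 0 < μ) {f : Euc M → ℝ} {θ g : Euc d}
    (hg : HasGradientAt (fun ϑ => f (𝓜.J γ (𝓟.policy ϑ))) g θ) :
    ‖𝓜.npg γ 𝓟 f θ‖ ≤ ‖g‖ / μ := by
  have h := hF.le_inner 𝓜 θ (𝓜.npg γ 𝓟 f θ)
  rw [hF.fisher_mulVec_npg 𝓜 hμ hg] at h
  have h2 := real_inner_le_norm g (𝓜.npg γ 𝓟 f θ)
  rw [le_div_iff₀ hμ]
  rcases (norm_nonneg (𝓜.npg γ 𝓟 f θ)).eq_or_lt with h0 | h0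
  · rw [← h0]; simp
  · nlinarith

/-- The scaled natural gradient nearly solves the truncated system. -/
lemma FisherNondegenerate.norm_truncFisher_npg_sub_le {μ : ℝ} (hF : FisherNondegenerate 𝓜 γ 𝓟 μ)
    (hS : ScoreRegular 𝓟 G₁ G₂) (hγ : γ ∈ Set.Ioo (0 : ℝ) 1)
    (hμ : 0 < μ) {f : Euc M → ℝ} {θ g : Euc d}
    (hg : HasGradientAt (fun ϑ => f (𝓜.J γ (𝓟.policy ϑ))) g θ) (H : ℕ) :
    ‖g - truncFisher 𝓜 γ 𝓟 H θ ((1 - γ) • 𝓜.npg γ 𝓟 f θ)‖ ≤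
      γ ^ H * (G₁ ^ 2 / (1 - γ)) * ‖(1 - γ) • 𝓜.npg γ 𝓟 f θ‖ := by
  have h1 : 0 < 1 - γ := by linarith [hγ.2]
  set w := (1 - γ) • 𝓜.npg γ 𝓟 f θ with hw
  set u := g - truncFisher 𝓜 γ 𝓟 H θ w with hu
  -- The residual u is tested against itself; with F w = (1-γ)g the left side becomes ‖u‖².
  have h := (abs_le.1 (hS.abs_fisher_sub_truncFisher_le 𝓜 hγ H θ w u)).2
  have e : (WithLp.toLp 2 ((𝓜.fisher γ 𝓟 θ).mulVec w.ofLp) : Euc d) = (1 - γ) • g := by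
    rw [← hF.fisher_mulVec_npg 𝓜 hμ hg, hw]
    simp [Matrix.mulVec_smul]
  rw [e, inner_smul_left, conj_trivial, ← mul_assoc, inv_mul_cancel₀ h1.ne', one_mul,
    ← inner_sub_left, ← hu, real_inner_self_eq_norm_sq] at h
  rcases (norm_nonneg u).eq_or_lt with h0 | h0
  · have := hγ.1
    rw [← h0]; positivity
  · have h3 : ‖u‖ * ‖u‖ ≤ (γ ^ H * (G₁ ^ 2 / (1 - γ)) * ‖w‖) * ‖u‖ := by
      calc ‖u‖ * ‖u‖ = ‖u‖ ^ 2 := (sq _).symm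
        _ ≤ _ := h
        _ = _ := by ring
    exact le_of_mul_le_mul_right h3 h0

end Fisher

/-! ### The optimality gap -/

section Gap

variable (𝓜 : MDP S A M) {𝓟 : PolicyClass S A d} {G₁ G₂ γ : ℝ}
  (πs : Kernel S A) [IsMarkovKernel πs]

/-- The mean of the score under the comparator policy. -/
def meanScore (γ : ℝ) (𝓟 : PolicyClass S A d) (θ : Euc d) : Euc d :=
  ∫ x, 𝓟.score θ x ∂(𝓜.visitSA γ πs)

lemma ScoreRegular.integrable_score (hS : ScoreRegular 𝓟 G₁ G₂) (hγ : γ ∈ Set.Ioo (0 : ℝ) 1)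
    (θ : Euc d) : Integrable (𝓟.score θ) (𝓜.visitSA γ πs) := by
  have := 𝓜.isProbabilityMeasure_visitSA πs hγ
  exact Integrable.of_bound (hS.measurable_score θ).aestronglyMeasurable G₁
    (Filter.Eventually.of_forall (hS.2.1 θ))

lemma ScoreRegular.norm_meanScore_le (hS : ScoreRegular 𝓟 G₁ G₂) (hγ : γ ∈ Set.Ioo (0 : ℝ) 1)
    (θ : Euc d) : ‖meanScore 𝓜 πs γ 𝓟 θ‖ ≤ G₁ := by
  have := 𝓜.isProbabilityMeasure_visitSA πs hγ
  have h := norm_integral_le_of_norm_le_const (μ := 𝓜.visitSA γ πs) (f := 𝓟.score θ)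
    (Filter.Eventually.of_forall (hS.2.1 θ))
  simpa [meanScore] using h

lemma ScoreRegular.continuous_meanScore (hS : ScoreRegular 𝓟 G₁ G₂)
    (hγ : γ ∈ Set.Ioo (0 : ℝ) 1) : Continuous (meanScore 𝓜 πs γ 𝓟) := by
  have := 𝓜.isProbabilityMeasure_visitSA πs hγ
  exact continuous_of_dominated (bound := fun _ => G₁)
    (fun θ => (hS.measurable_score θ).aestronglyMeasurable)
    (fun θ => Filter.Eventually.of_forall (hS.2.1 θ)) (integrable_const _)
    (Filter.Eventually.of_forall fun x => hS.continuous_score x)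

lemma integral_le_sqrt_integral_sq {X : Type*} [MeasurableSpace X] {μ : Measure X}
    [IsProbabilityMeasure μ] {Y : X → ℝ} (hY : Measurable Y) {B : ℝ} (hB : ∀ x, |Y x| ≤ B) :
    ∫ x, Y x ∂μ ≤ Real.sqrt (∫ x, Y x ^ 2 ∂μ) := by
  have hi : Integrable Y μ := integrable_of_abs_le hY hB
  have hi2 : Integrable (fun x => Y x ^ 2) μ :=
    integrable_of_abs_le (hY.pow_const 2) (B := B ^ 2) fun x => by
      rw [abs_pow]; exact pow_le_pow_left₀ (abs_nonneg _) (hB x) 2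
  refine Real.le_sqrt_of_sq_le ?_
  set e := ∫ x, Y x ∂μ with he
  have h0 : 0 ≤ ∫ x, (Y x - e) ^ 2 ∂μ := integral_nonneg fun x => sq_nonneg _
  have h1 : ∫ x, (Y x - e) ^ 2 ∂μ = ∫ x, Y x ^ 2 ∂μ - e ^ 2 := by
    have : ∀ x, (Y x - e) ^ 2 = Y x ^ 2 - 2 * e * Y x + e ^ 2 := fun x => by ring
    simp only [this]
    rw [integral_add (hi2.sub (hi.const_mul _) : Integrable (fun x => _ - _) _)
      (integrable_const _), integral_sub hi2 (hi.const_mul _), integral_const_mul, ← he]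
    simp
    ring
  linarith

/-- The optimality gap is controlled by the natural policy gradient. -/
lemma ScoreRegular.gap_le (hS : ScoreRegular 𝓟 G₁ G₂)
    (hγ : γ ∈ Set.Ioo (0 : ℝ) 1) (hM : 0 < M) {f : Euc M → ℝ} (hf : ConcaveOn ℝ Set.univ f)
    {Lf C : ℝ} (hs : SmoothOnBox f γ Lf) (hC : ∀ m, ∀ y ∈ box M γ, |partialD f m y| ≤ C)
    {εbias : ℝ} {θ : Euc d} (hε : transferError 𝓜 γ 𝓟 f πs θ ≤ εbias) :
    f (𝓜.J γ πs) - f (𝓜.J γ (𝓟.policy θ)) ≤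
      Real.sqrt εbias / (1 - γ) + inner ℝ (𝓜.npg γ 𝓟 f θ) (meanScore 𝓜 πs γ 𝓟 θ) := by
  have h1 : 0 < 1 - γ := by linarith [hγ.2]
  have hp := 𝓜.isProbabilityMeasure_visitSA πs hγ
  set x₀ := 𝓜.J γ (𝓟.policy θ) with hx₀
  set n := 𝓜.npg γ 𝓟 f θ with hn
  -- Supergradient of f at J^{π_θ}, in the direction of the comparator's returns.
  have hc := concave_sub_le_partialD hf hM (x := x₀)
    (fun m => (hs m).1 _ (𝓜.J_mem_box _ hγ)) (𝓜.J γ πs - x₀)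
  rw [add_sub_cancel] at hc
  have hAi : ∀ m, Integrable (𝓜.adv γ (𝓟.policy θ) m) (𝓜.visitSA γ πs) := fun m =>
    integrable_of_abs_le (𝓜.measurable_adv _ hγ m) (𝓜.abs_adv_le _ hγ m)
  have hsum : ∫ x, (∑ m, partialD f m x₀ * 𝓜.adv γ (𝓟.policy θ) m x) ∂(𝓜.visitSA γ πs) =
      (1 - γ) * ∑ m, partialD f m x₀ * (𝓜.J γ πs - x₀) m := by
    rw [integral_finsetSum _ fun m _ => (hAi m).const_mul _, Finset.mul_sum]
    refine Finset.sum_congr rfl fun m _ => ?_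
    rw [integral_const_mul, 𝓜.integral_adv_visitSA (𝓟.policy θ) πs hγ m]
    simp only [PiLp.sub_apply, hx₀]
    ring
  have hin : Integrable (fun x => (1 - γ) * inner ℝ n (𝓟.score θ x)) (𝓜.visitSA γ πs) :=
    ((hS.integrable_score 𝓜 πs hγ θ).const_inner n).const_mul _
  set Y : S × A → ℝ := fun x => (∑ m, partialD f m x₀ * 𝓜.adv γ (𝓟.policy θ) m x)
      - (1 - γ) * inner ℝ n (𝓟.score θ x) with hY
  have hYm : Measurable Y := by
    refine Measurable.sub (Finset.measurable_sum _ fun m _ =>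
      (𝓜.measurable_adv _ hγ m).const_mul _) (Measurable.const_mul ?_ _)
    exact (hS.measurable_score θ).const_inner
  have hYb : ∀ x, |Y x| ≤ (∑ m : Fin M, C * (2 / (1 - γ))) + (1 - γ) * (‖n‖ * G₁) := by
    intro x
    refine (abs_sub _ _).trans (add_le_add ((Finset.abs_sum_le_sum_abs _ _).trans
      (Finset.sum_le_sum fun m _ => ?_)) ?_)
    · rw [abs_mul]
      have hb : |partialD f m x₀| ≤ C := hC m _ (𝓜.J_mem_box _ hγ)
      exact mul_le_mul hb (𝓜.abs_adv_le _ hγ m x) (abs_nonneg _) ((abs_nonneg _).trans hb)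
    · rw [abs_mul, abs_of_pos h1]
      exact mul_le_mul_of_nonneg_left ((abs_real_inner_le_norm _ _).trans
        (mul_le_mul_of_nonneg_left (hS.2.1 θ x) (norm_nonneg _))) h1.le
  -- Jensen: the transfer assumption bounds the second moment of Y, whereas only the mean enters the
  -- gap.
  have hYle : ∫ x, Y x ∂(𝓜.visitSA γ πs) ≤ Real.sqrt εbias :=
    (integral_le_sqrt_integral_sq hYm hYb).trans (Real.sqrt_le_sqrt hε)
  -- By the performance difference lemma both terms of the mean carry the factor 1-γ. Dividing by it
  -- leaves ω* with coefficient one and puts 1/(1-γ) on √ε_bias only.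
  have hYeq : ∫ x, Y x ∂(𝓜.visitSA γ πs) =
      (1 - γ) * ∑ m, partialD f m x₀ * (𝓜.J γ πs - x₀) m -
        (1 - γ) * inner ℝ n (meanScore 𝓜 πs γ 𝓟 θ) := by
    rw [hY, integral_sub (integrable_finsetSum _ fun m _ => (hAi m).const_mul _) hin, hsum,
      integral_const_mul, integral_inner (hS.integrable_score 𝓜 πs hγ θ), meanScore]
  have : ∑ m, partialD f m x₀ * (𝓜.J γ πs - x₀) m ≤
      Real.sqrt εbias / (1 - γ) + inner ℝ n (meanScore 𝓜 πs γ 𝓟 θ) := by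
    rw [← sub_le_iff_le_add, le_div_iff₀ h1]
    linarith
  linarith

/-! ### The Kullback-Leibler potential -/

lemma ScoreRegular.abs_logRatio_le (hS : ScoreRegular 𝓟 G₁ G₂) (θ θ' : Euc d) (x : S × A) :
    |logRatio 𝓟 θ θ' x| ≤ G₁ * ‖θ' - θ‖ := hS.logDens_lipschitz θ' θ x

/-- Normalization of π_θ'. It makes the log-partition term of the Gibbs inequality vanish. -/
lemma integral_exp_logRatio (θ θ' : Euc d) (s : S) :
    ∫ a, Real.exp (logRatio 𝓟 θ θ' (s, a)) ∂(𝓟.policy θ s) = 1 := by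
  have hm : Measurable fun a => Real.exp (logRatio 𝓟 θ θ' (s, a)) :=
    ((measurable_logRatio 𝓟 θ θ').comp measurable_prodMk_left).exp
  rw [integral_eq_lintegral_of_nonneg_ae
    (Filter.Eventually.of_forall fun a => (Real.exp_pos _).le) hm.aestronglyMeasurable]
  have h := lintegral_policy_change 𝓟 (g := fun _ => 1) measurable_const θ θ' s
  simp only [lintegral_one, measure_univ, one_mul] at h
  rw [← h]
  simp

/-- The Gibbs variational inequality for two policies of the class. -/
lemma ScoreRegular.integral_logRatio_le_klDiv (hS : ScoreRegular 𝓟 G₁ G₂) (θ θ' : Euc d) (s : S) :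
    ENNReal.ofReal (∫ a, logRatio 𝓟 θ θ' (s, a) ∂(πs s)) ≤
      InformationTheory.klDiv (πs s) (𝓟.policy θ s) := by
  by_cases htop : InformationTheory.klDiv (πs s) (𝓟.policy θ s) = ⊤
  · rw [htop]; exact le_top
  obtain ⟨hac, h_int⟩ := InformationTheory.klDiv_ne_top_iff.1 htop
  have hm : Measurable fun a => logRatio 𝓟 θ θ' (s, a) :=
    (measurable_logRatio 𝓟 θ θ').comp measurable_prodMk_left
  have hb : ∀ a, |logRatio 𝓟 θ θ' (s, a)| ≤ G₁ * ‖θ' - θ‖ := fun a => hS.abs_logRatio_le θ θ' _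
  have hi : Integrable (fun a => logRatio 𝓟 θ θ' (s, a)) (πs s) := integrable_of_abs_le hm hb
  have hie : Integrable (fun a => Real.exp (logRatio 𝓟 θ θ' (s, a))) (𝓟.policy θ s) :=
    integrable_of_abs_le hm.exp (B := Real.exp (G₁ * ‖θ' - θ‖)) fun a => by
      rw [Real.abs_exp]
      exact Real.exp_le_exp.2 ((le_abs_self _).trans (hb a))
  have hp := isProbabilityMeasure_tilted hie
  -- Tilting π_θ by the log-ratio gives π_θ'. The divergence of πs from the tilted law is KL(πs‖π_θ)
  -- minus the mean log-ratio, and it is nonnegative.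
  have h1 := integral_llr_tilted_right hac hi hie h_int
  rw [integral_exp_logRatio, Real.log_one, add_zero] at h1
  have hac' := hac.trans (absolutelyContinuous_tilted hie)
  have h2 := InformationTheory.toReal_klDiv_of_measure_eq hac' (by simp)
  have h3 := InformationTheory.toReal_klDiv_of_measure_eq hac (by simp)
  rw [ENNReal.ofReal_le_iff_le_toReal htop, h3]
  have h4 : 0 ≤ (InformationTheory.klDiv (πs s)
      ((𝓟.policy θ s).tilted fun a => logRatio 𝓟 θ θ' (s, a))).toReal := ENNReal.toReal_nonneg
  rw [h2, h1] at h4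
  linarith

lemma ScoreRegular.integral_logRatio_le (hS : ScoreRegular 𝓟 G₁ G₂)
    (hγ : γ ∈ Set.Ioo (0 : ℝ) 1) (θ θ' : Euc d) {D : ℝ}
    (hD : ∫⁻ s, InformationTheory.klDiv (πs s) (𝓟.policy θ s) ∂(𝓜.visit γ πs)
      ≤ ENNReal.ofReal D) :
    ∫ x, logRatio 𝓟 θ θ' x ∂(𝓜.visitSA γ πs) ≤ max D 0 := by
  have := 𝓜.isProbabilityMeasure_visit πs hγ
  have hm := measurable_logRatio 𝓟 θ θ'
  have hb := hS.abs_logRatio_le θ θ'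
  have hi : Integrable (logRatio 𝓟 θ θ') (𝓜.visit γ πs ⊗ₘ πs) := integrable_of_abs_le hm hb
  rw [MDP.visitSA, Measure.integral_compProd hi]
  have hi2 : Integrable (fun s => ∫ a, logRatio 𝓟 θ θ' (s, a) ∂(πs s)) (𝓜.visit γ πs) :=
    integrable_of_abs_le (hm.stronglyMeasurable.integral_kernel_prod_right').measurable
      fun s => abs_integral_le_of_abs_le fun a => hb (s, a)
  -- Only the positive part is compared with the divergence, by monotonicity of the lower integral;
  -- this does not require the divergence to be measurable in s.
  rw [integral_eq_lintegral_pos_part_sub_lintegral_neg_part hi2]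
  refine (sub_le_self _ ENNReal.toReal_nonneg).trans ?_
  have h2 := (lintegral_mono fun s => hS.integral_logRatio_le_klDiv πs θ θ' s).trans hD
  have h3 := ENNReal.toReal_mono ENNReal.ofReal_ne_top h2
  rwa [ENNReal.toReal_ofReal'] at h3

/-- One step of the parameter changes the potential by the linear term up to a quadratic error. -/
lemma ScoreRegular.integral_logRatio_step (hS : ScoreRegular 𝓟 G₁ G₂) (hG₂ : 0 ≤ G₂)
    (hγ : γ ∈ Set.Ioo (0 : ℝ) 1) (θ v : Euc d) :
    inner ℝ v (meanScore 𝓜 πs γ 𝓟 θ) - G₂ * ‖v‖ ^ 2 ≤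
      ∫ x, logRatio 𝓟 θ (θ + v) x ∂(𝓜.visitSA γ πs) := by
  have := 𝓜.isProbabilityMeasure_visitSA πs hγ
  have hi : Integrable (logRatio 𝓟 θ (θ + v)) (𝓜.visitSA γ πs) :=
    integrable_of_abs_le (measurable_logRatio 𝓟 θ _) (hS.abs_logRatio_le θ _)
  have hi2 : Integrable (fun x => inner ℝ v (𝓟.score θ x)) (𝓜.visitSA γ πs) :=
    (hS.integrable_score 𝓜 πs hγ θ).const_inner v
  rw [meanScore, ← integral_inner (hS.integrable_score 𝓜 πs hγ θ)]
  have h := integral_mono (hi2.sub (integrable_const (G₂ * ‖v‖ ^ 2)) :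
    Integrable (fun x => _ - _) _) hi fun x => by
      have := hS.logDens_lower hG₂ θ v x
      rw [real_inner_comm] at this
      exact this
  rw [integral_sub hi2 (integrable_const _)] at h
  simpa using h

lemma ScoreRegular.integral_logRatio_add (hS : ScoreRegular 𝓟 G₁ G₂)
    (hγ : γ ∈ Set.Ioo (0 : ℝ) 1) (θ θ' θ'' : Euc d) :
    ∫ x, logRatio 𝓟 θ θ'' x ∂(𝓜.visitSA γ πs) = ∫ x, logRatio 𝓟 θ θ' x ∂(𝓜.visitSA γ πs) +
      ∫ x, logRatio 𝓟 θ' θ'' x ∂(𝓜.visitSA γ πs) := by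
  have := 𝓜.isProbabilityMeasure_visitSA πs hγ
  rw [← integral_add (integrable_of_abs_le (measurable_logRatio 𝓟 θ _) (hS.abs_logRatio_le θ _))
    (integrable_of_abs_le (measurable_logRatio 𝓟 θ' _) (hS.abs_logRatio_le θ' _))]
  refine integral_congr_ae (Filter.Eventually.of_forall fun x => ?_)
  simp [logRatio]

end Gap

/-! ### The empirical returns -/

section Empirical

variable (𝓜 : MDP S A M) (𝓟 : PolicyClass S A d) {γ : ℝ}

/-- The return of a trajectory truncated at the horizon `H`. -/
def truncRet (γ : ℝ) (H : ℕ) (m : Fin M) (τ : Traj S A) : ℝ :=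
  ∑ t ∈ Finset.range H, γ ^ t * 𝓜.r m (τ t)

lemma measurable_truncRet (γ : ℝ) (H : ℕ) (m : Fin M) : Measurable (truncRet 𝓜 γ H m) :=
  Finset.measurable_sum _ fun t _ =>
    ((𝓜.r_measurable m).comp (measurable_pi_apply t)).const_mul _

lemma truncRet_nonneg (hγ : γ ∈ Set.Ioo (0 : ℝ) 1) (H : ℕ) (m : Fin M) (τ : Traj S A) :
    0 ≤ truncRet 𝓜 γ H m τ :=
  Finset.sum_nonneg fun t _ => mul_nonneg (pow_nonneg hγ.1.le t) (𝓜.r_mem m _).1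

lemma truncRet_le (hγ : γ ∈ Set.Ioo (0 : ℝ) 1) (H : ℕ) (m : Fin M) (τ : Traj S A) :
    truncRet 𝓜 γ H m τ ≤ 1 / (1 - γ) :=
  (Finset.sum_le_sum fun t _ => mul_le_of_le_one_right (pow_nonneg hγ.1.le t)
    (𝓜.r_mem m _).2).trans (geom_sum_le hγ H)

lemma abs_truncRet_le (hγ : γ ∈ Set.Ioo (0 : ℝ) 1) (H : ℕ) (m : Fin M) (τ : Traj S A) :
    |truncRet 𝓜 γ H m τ| ≤ 1 / (1 - γ) := by
  rw [abs_of_nonneg (truncRet_nonneg 𝓜 hγ H m τ)]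
  exact truncRet_le 𝓜 hγ H m τ

lemma empReturn_apply (γ : ℝ) (H b : ℕ) (τs : ℕ → Traj S A) (m : Fin M) :
    empReturn 𝓜 γ H b τs m = (1 / (b : ℝ)) * ∑ j ∈ Finset.range b, truncRet 𝓜 γ H m (τs j) := rfl

lemma measurable_empReturn (γ : ℝ) (H b : ℕ) : Measurable (empReturn 𝓜 γ H b) := by
  refine (MeasurableEquiv.toLp 2 (Fin M → ℝ)).measurable.comp (measurable_pi_lambda _ fun m => ?_)
  exact (Finset.measurable_sum _ fun j _ =>
    (measurable_truncRet 𝓜 γ H m).comp (measurable_pi_apply j)).const_mul _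

lemma empReturn_mem_box (hγ : γ ∈ Set.Ioo (0 : ℝ) 1) (H b : ℕ) (τs : ℕ → Traj S A) :
    empReturn 𝓜 γ H b τs ∈ box M γ := by
  intro m
  have h1 : 0 < 1 - γ := by linarith [hγ.2]
  rw [empReturn_apply]
  refine ⟨mul_nonneg (by positivity)
    (Finset.sum_nonneg fun j _ => truncRet_nonneg 𝓜 hγ H m _), ?_⟩
  rcases Nat.eq_zero_or_pos b with rfl | hb
  · simp only [Finset.range_zero, Finset.sum_empty, mul_zero]
    positivity
  · have h2 : ∑ j ∈ Finset.range b, truncRet 𝓜 γ H m (τs j) ≤ b * (1 / (1 - γ)) := by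
      refine (Finset.sum_le_sum fun j _ => truncRet_le 𝓜 hγ H m (τs j)).trans (le_of_eq ?_)
      simp
    have hb' : (0 : ℝ) < b := by exact_mod_cast hb
    calc _ ≤ (1 / (b : ℝ)) * (b * (1 / (1 - γ))) :=
          mul_le_mul_of_nonneg_left h2 (by positivity)
      _ = _ := by field_simp

/-- The mean of the truncated returns. -/
def truncJ (γ : ℝ) (H : ℕ) (θ : Euc d) : Euc M :=
  WithLp.toLp 2 fun m => ∫ τ, truncRet 𝓜 γ H m τ ∂(pathOf 𝓜 𝓟 θ)

/-- The joint law of the outer trajectories. -/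
abbrev outerLaw (θ : Euc d) : Measure (ℕ → Traj S A) :=
  Measure.infinitePi fun _ : ℕ => pathOf 𝓜 𝓟 θ

/-- Variances of independent returns add, and each is at most (1-γ)⁻² since the returns lie in [0,
1/(1-γ)]. -/
lemma integral_sq_empReturn_sub_le (hγ : γ ∈ Set.Ioo (0 : ℝ) 1) (θ : Euc d) (H : ℕ) {b : ℕ}
    (hb : 0 < b) (m : Fin M) :
    ∫ τs, (empReturn 𝓜 γ H b τs m - truncJ 𝓜 𝓟 γ H θ m) ^ 2 ∂(outerLaw 𝓜 𝓟 θ) ≤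
      1 / (b * (1 - γ) ^ 2) := by
  have h1 : 0 < 1 - γ := by linarith [hγ.2]
  have hb' : (0 : ℝ) < b := by exact_mod_cast hb
  have hmeas := measurable_truncRet 𝓜 γ H m
  let X : ℕ → (ℕ → Traj S A) → ℝ := fun j τs => truncRet 𝓜 γ H m (τs j)
  have hXm : ∀ j, Measurable (X j) := fun j => hmeas.comp (measurable_pi_apply j)
  have hXb : ∀ j τs, |X j τs| ≤ 1 / (1 - γ) := fun j τs => abs_truncRet_le 𝓜 hγ H m _
  have hind : iIndepFun X (outerLaw 𝓜 𝓟 θ) :=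
    iIndepFun_infinitePi (P := fun _ : ℕ => pathOf 𝓜 𝓟 θ)
      (X := fun _ => truncRet 𝓜 γ H m) fun _ => hmeas
  have hmean : ∀ j, ∫ τs, X j τs ∂(outerLaw 𝓜 𝓟 θ) = truncJ 𝓜 𝓟 γ H θ m := by
    intro j
    have := (measurePreserving_eval_infinitePi (fun _ : ℕ => pathOf 𝓜 𝓟 θ) j)
    have e := integral_map (μ := outerLaw 𝓜 𝓟 θ) this.measurable.aemeasurable
      (hmeas.aestronglyMeasurable (μ := (outerLaw 𝓜 𝓟 θ).map (Function.eval j)))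
    rw [this.map_eq] at e
    exact e.symm
  have hvar : Var[∑ j ∈ Finset.range b, X j; outerLaw 𝓜 𝓟 θ] ≤ b * (1 / (1 - γ) ^ 2) := by
    rw [IndepFun.variance_sum (fun j _ => MemLp.of_bound (hXm j).aestronglyMeasurable _
      (Filter.Eventually.of_forall (hXb j))) fun i _ j _ hij => hind.indepFun hij]
    refine (Finset.sum_le_sum (g := fun _ => 1 / (1 - γ) ^ 2) fun j _ => ?_).trans
      (le_of_eq (by simp))
    refine (variance_le_expectation_sq (hXm j).aestronglyMeasurable).trans ?_
    refine (le_abs_self _).trans (abs_integral_le_of_abs_le fun τs => ?_)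
    rw [Pi.pow_apply, abs_pow, ← one_div_pow]
    exact pow_le_pow_left₀ (abs_nonneg _) (hXb j τs) 2
  have hEm : Measurable fun τs : ℕ → Traj S A => empReturn 𝓜 γ H b τs m :=
    (Finset.measurable_sum _ fun j _ => hXm j).const_mul _
  have hEmean : ∫ τs, empReturn 𝓜 γ H b τs m ∂(outerLaw 𝓜 𝓟 θ) = truncJ 𝓜 𝓟 γ H θ m := by
    simp only [empReturn_apply]
    rw [integral_const_mul, integral_finsetSum _ fun j _ =>
      integrable_of_abs_le (hXm j) (hXb j)]
    have : ∀ j ∈ Finset.range b, ∫ τs, truncRet 𝓜 γ H m (τs j) ∂(outerLaw 𝓜 𝓟 θ) =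
        truncJ 𝓜 𝓟 γ H θ m := fun j _ => hmean j
    rw [Finset.sum_congr rfl this]
    simp
    field_simp
  have hV := variance_eq_integral (μ := outerLaw 𝓜 𝓟 θ) hEm.aemeasurable
  rw [hEmean] at hV
  rw [← hV]
  have e : (fun τs : ℕ → Traj S A => empReturn 𝓜 γ H b τs m) =
      fun τs => (1 / (b : ℝ)) * (∑ j ∈ Finset.range b, X j) τs := by
    funext τs
    simp [empReturn_apply, X, Finset.sum_apply]
  rw [e, variance_const_mul]
  calc _ ≤ (1 / (b : ℝ)) ^ 2 * (b * (1 / (1 - γ) ^ 2)) :=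
        mul_le_mul_of_nonneg_left hvar (by positivity)
    _ = _ := by field_simp

lemma norm_sub_le_of_mem_box {x y : Euc M} (hx : x ∈ box M γ)
    (hy : y ∈ box M γ) : ‖x - y‖ ^ 2 ≤ M * (1 / (1 - γ)) ^ 2 := by
  rw [EuclideanSpace.norm_sq_eq]
  refine (Finset.sum_le_sum (g := fun _ => (1 / (1 - γ)) ^ 2) fun m _ => ?_).trans
    (le_of_eq (by simp))
  rw [Real.norm_eq_abs]
  refine pow_le_pow_left₀ (abs_nonneg _) ?_ 2
  rw [PiLp.sub_apply, abs_le]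
  have a := hx m
  have b := hy m
  constructor <;> linarith [a.1, a.2, b.1, b.2]

lemma truncJ_mem_box (hγ : γ ∈ Set.Ioo (0 : ℝ) 1) (θ : Euc d) (H : ℕ) :
    truncJ 𝓜 𝓟 γ H θ ∈ box M γ := by
  intro m
  exact ⟨integral_nonneg fun τ => truncRet_nonneg 𝓜 hγ H m τ,
    (le_abs_self _).trans (abs_integral_le_of_abs_le fun τ => abs_truncRet_le 𝓜 hγ H m τ)⟩

lemma integrable_norm_sq_empReturn_sub (hγ : γ ∈ Set.Ioo (0 : ℝ) 1) (θ : Euc d) (H b : ℕ)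
    {y : Euc M} (hy : y ∈ box M γ) :
    Integrable (fun τs => ‖empReturn 𝓜 γ H b τs - y‖ ^ 2) (outerLaw 𝓜 𝓟 θ) :=
  integrable_of_abs_le (((measurable_empReturn 𝓜 γ H b).sub_const y).norm.pow_const 2)
    fun τs => by
      rw [abs_of_nonneg (by positivity)]
      exact norm_sub_le_of_mem_box (empReturn_mem_box 𝓜 hγ H b τs) hy

lemma integral_norm_sq_empReturn_sub_le (hγ : γ ∈ Set.Ioo (0 : ℝ) 1) (θ : Euc d) (H : ℕ) {b : ℕ}
    (hb : 0 < b) :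
    ∫ τs, ‖empReturn 𝓜 γ H b τs - truncJ 𝓜 𝓟 γ H θ‖ ^ 2 ∂(outerLaw 𝓜 𝓟 θ) ≤
      M / (b * (1 - γ) ^ 2) := by
  simp only [EuclideanSpace.norm_sq_eq, Real.norm_eq_abs, sq_abs, PiLp.sub_apply]
  rw [integral_finsetSum]
  · refine (Finset.sum_le_sum fun m _ =>
      integral_sq_empReturn_sub_le 𝓜 𝓟 hγ θ H hb m).trans (le_of_eq ?_)
    simp [div_eq_mul_inv]
  · intro m _
    have hm : Measurable fun τs : ℕ → Traj S A => empReturn 𝓜 γ H b τs m :=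
      ((EuclideanSpace.proj m : Euc M →L[ℝ] ℝ).continuous.measurable).comp
        (measurable_empReturn 𝓜 γ H b)
    refine integrable_of_abs_le ((hm.sub_const _).pow_const 2) (B := (1 / (1 - γ)) ^ 2)
      fun τs => ?_
    rw [abs_pow]
    refine pow_le_pow_left₀ (abs_nonneg _) ?_ 2
    have a := empReturn_mem_box 𝓜 hγ H b τs m
    have b := truncJ_mem_box 𝓜 𝓟 hγ θ H m
    rw [abs_le]
    constructor <;> linarith [a.1, a.2, b.1, b.2]

lemma norm_sq_truncJ_sub_J_le (hγ : γ ∈ Set.Ioo (0 : ℝ) 1) (θ : Euc d) (H : ℕ) :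
    ‖truncJ 𝓜 𝓟 γ H θ - 𝓜.J γ (𝓟.policy θ)‖ ^ 2 ≤ M * (γ ^ H / (1 - γ)) ^ 2 := by
  rw [EuclideanSpace.norm_sq_eq]
  refine (Finset.sum_le_sum (g := fun _ => (γ ^ H / (1 - γ)) ^ 2) fun m _ => ?_).trans
    (le_of_eq (by simp))
  refine pow_le_pow_left₀ (norm_nonneg _) ?_ 2
  rw [PiLp.sub_apply, norm_sub_rev, Real.norm_eq_abs]
  have hJ := 𝓜.hasSum_J (𝓟.policy θ) hγ m
  have e : truncJ 𝓜 𝓟 γ H θ m =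
      ∑ t ∈ Finset.range H, γ ^ t * ∫ x, 𝓜.r m x ∂(𝓜.margin (𝓟.policy θ) t) := by
    have hi : ∀ t ∈ Finset.range H, Integrable (fun τ : Traj S A => γ ^ t * 𝓜.r m (τ t))
        (pathOf 𝓜 𝓟 θ) := fun t _ => by
      have : Integrable (fun τ : Traj S A => 𝓜.r m (τ t)) (pathOf 𝓜 𝓟 θ) :=
        integrable_of_abs_le ((𝓜.r_measurable m).comp (measurable_pi_apply t))
          fun τ => 𝓜.abs_r_le m _
      exact this.const_mul _
    have : truncJ 𝓜 𝓟 γ H θ m = ∫ τ, ∑ t ∈ Finset.range H, γ ^ t * 𝓜.r m (τ t)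
        ∂(pathOf 𝓜 𝓟 θ) := rfl
    rw [this, integral_finsetSum _ hi]
    refine Finset.sum_congr rfl fun t _ => ?_
    rw [integral_const_mul, MDP.margin, integral_map (measurable_pi_apply t).aemeasurable
      (𝓜.r_measurable m).aestronglyMeasurable]
  rw [e, ← hJ.tsum_eq, ← hJ.summable.sum_add_tsum_nat_add H, add_sub_cancel_left]
  have e2 : ∀ t, γ ^ (t + H) * ∫ x, 𝓜.r m x ∂(𝓜.margin (𝓟.policy θ) (t + H)) =
      γ ^ H * (γ ^ t * ∫ x, 𝓜.r m x ∂(𝓜.margin (𝓟.policy θ) (t + H))) := fun t => by ring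
  simp only [e2]
  rw [tsum_mul_left, abs_mul, abs_of_nonneg (pow_nonneg hγ.1.le H), div_eq_mul_one_div]
  exact mul_le_mul_of_nonneg_left (abs_tsum_geometric_mul_le hγ.1.le hγ.2 fun t =>
    abs_integral_le_of_abs_le (𝓜.abs_r_le m)) (pow_nonneg hγ.1.le H)

lemma norm_add_sq_le {E : Type*} [SeminormedAddCommGroup E] (u v : E) :
    ‖u + v‖ ^ 2 ≤ 2 * ‖u‖ ^ 2 + 2 * ‖v‖ ^ 2 := by
  have := norm_add_le u v
  nlinarith [sq_nonneg (‖u‖ - ‖v‖), norm_nonneg (u + v), norm_nonneg u, norm_nonneg v]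

lemma integral_norm_sq_empReturn_sub_J_le (hγ : γ ∈ Set.Ioo (0 : ℝ) 1) (θ : Euc d) (H : ℕ) {b : ℕ}
    (hb : 0 < b) :
    ∫ τs, ‖empReturn 𝓜 γ H b τs - 𝓜.J γ (𝓟.policy θ)‖ ^ 2 ∂(outerLaw 𝓜 𝓟 θ) ≤
      2 * (M / (b * (1 - γ) ^ 2)) + 2 * (M * (γ ^ H / (1 - γ)) ^ 2) := by
  have hi := integrable_norm_sq_empReturn_sub 𝓜 𝓟 hγ θ H b (truncJ_mem_box 𝓜 𝓟 hγ θ H)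
  calc _ ≤ ∫ τs, (2 * ‖empReturn 𝓜 γ H b τs - truncJ 𝓜 𝓟 γ H θ‖ ^ 2 +
        2 * ‖truncJ 𝓜 𝓟 γ H θ - 𝓜.J γ (𝓟.policy θ)‖ ^ 2) ∂(outerLaw 𝓜 𝓟 θ) := by
        refine integral_mono (integrable_norm_sq_empReturn_sub 𝓜 𝓟 hγ θ H b (𝓜.J_mem_box _ hγ))
          ((hi.const_mul 2).add (integrable_const _)) fun τs => ?_
        simpa using norm_add_sq_le (empReturn 𝓜 γ H b τs - truncJ 𝓜 𝓟 γ H θ)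
          (truncJ 𝓜 𝓟 γ H θ - 𝓜.J γ (𝓟.policy θ))
    _ = 2 * ∫ τs, ‖empReturn 𝓜 γ H b τs - truncJ 𝓜 𝓟 γ H θ‖ ^ 2 ∂(outerLaw 𝓜 𝓟 θ) +
        2 * ‖truncJ 𝓜 𝓟 γ H θ - 𝓜.J γ (𝓟.policy θ)‖ ^ 2 := by
        rw [integral_add (hi.const_mul 2) (integrable_const _), integral_const_mul]
        simp
    _ ≤ _ := by
        have := integral_norm_sq_empReturn_sub_le 𝓜 𝓟 hγ θ H hb
        have := norm_sq_truncJ_sub_J_le 𝓜 𝓟 hγ θ H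
        linarith

/-- Both averages are compared with their common mean `truncJ`, not with J, so the horizon bias
cancels and the bound decays with the batch sizes. -/
lemma integral_norm_sq_empReturn_sub_empReturn_le (hγ : γ ∈ Set.Ioo (0 : ℝ) 1) (θ : Euc d)
    (H : ℕ) {b c : ℕ} (hb : 0 < b) (hc : 0 < c) :
    ∫ τs, ‖empReturn 𝓜 γ H b τs - empReturn 𝓜 γ H c τs‖ ^ 2 ∂(outerLaw 𝓜 𝓟 θ) ≤
      2 * (M / (b * (1 - γ) ^ 2)) + 2 * (M / (c * (1 - γ) ^ 2)) := by
  have hi := fun b => integrable_norm_sq_empReturn_sub 𝓜 𝓟 hγ θ H b (truncJ_mem_box 𝓜 𝓟 hγ θ H)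
  calc _ ≤ ∫ τs, (2 * ‖empReturn 𝓜 γ H b τs - truncJ 𝓜 𝓟 γ H θ‖ ^ 2 +
        2 * ‖empReturn 𝓜 γ H c τs - truncJ 𝓜 𝓟 γ H θ‖ ^ 2) ∂(outerLaw 𝓜 𝓟 θ) := by
        refine integral_mono ?_ (((hi b).const_mul 2).add ((hi c).const_mul 2)) fun τs => ?_
        · exact integrable_of_abs_le (((measurable_empReturn 𝓜 γ H b).sub
            (measurable_empReturn 𝓜 γ H c)).norm.pow_const 2) fun τs => by
              rw [abs_of_nonneg (by positivity)]
              exact norm_sub_le_of_mem_box (empReturn_mem_box 𝓜 hγ H b τs)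
                (empReturn_mem_box 𝓜 hγ H c τs)
        · have := norm_add_sq_le (empReturn 𝓜 γ H b τs - truncJ 𝓜 𝓟 γ H θ)
            (truncJ 𝓜 𝓟 γ H θ - empReturn 𝓜 γ H c τs)
          rw [sub_add_sub_cancel, norm_sub_rev (truncJ 𝓜 𝓟 γ H θ)] at this
          exact this
    _ = 2 * ∫ τs, ‖empReturn 𝓜 γ H b τs - truncJ 𝓜 𝓟 γ H θ‖ ^ 2 ∂(outerLaw 𝓜 𝓟 θ) +
        2 * ∫ τs, ‖empReturn 𝓜 γ H c τs - truncJ 𝓜 𝓟 γ H θ‖ ^ 2 ∂(outerLaw 𝓜 𝓟 θ) := by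
        rw [integral_add ((hi b).const_mul 2) ((hi c).const_mul 2), integral_const_mul,
          integral_const_mul]
    _ ≤ _ := by
        have := integral_norm_sq_empReturn_sub_le 𝓜 𝓟 hγ θ H hb
        have := integral_norm_sq_empReturn_sub_le 𝓜 𝓟 hγ θ H hc
        linarith

end Empirical

/-! ### The level of the multi-level estimate -/

section Level

/-- Vanishing above Q makes the integral a finite sum. The index n stands for the level n + 1,
because levels start at 1. -/
lemma integral_levelLaw {G : ℕ → ℝ} {Q : ℕ} (hG : ∀ q, Q < q → G q = 0) :
    ∫ q, G q ∂levelLaw = ∑ n ∈ Finset.range Q, (1 / 2 : ℝ) ^ (n + 1) * G (n + 1) := by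
  have hz : ∀ n ∉ Finset.range Q, ((2 : ℝ≥0∞)⁻¹ ^ (n + 1)).toReal • G (n + 1) = 0 := fun n hn => by
    rw [hG (n + 1) (by simp at hn; omega), smul_zero]
  rw [levelLaw, integral_sum_dirac_eq_tsum (fun n => by simp), tsum_eq_sum hz]
  · refine Finset.sum_congr rfl fun n _ => ?_
    simp
  · refine summable_of_ne_finset_zero (s := Finset.range Q) fun n hn => ?_
    rw [hG (n + 1) (by simp at hn; omega), norm_zero, mul_zero]

lemma lintegral_levelLaw {G : ℕ → ℝ≥0∞} {Q : ℕ} (hG : ∀ q, Q < q → G q = 0) :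
    ∫⁻ q, G q ∂levelLaw = ∑ n ∈ Finset.range Q, (2 : ℝ≥0∞)⁻¹ ^ (n + 1) * G (n + 1) := by
  rw [levelLaw, lintegral_sum_measure]
  simp only [lintegral_smul_measure, lintegral_dirac, smul_eq_mul]
  exact tsum_eq_sum fun n hn => by rw [hG (n + 1) (by simp at hn; omega), mul_zero]

/-- The expected number of outer trajectories. -/
lemma lintegral_two_pow_truncLevel_le {Bmax : ℝ} {Q : ℕ} (hQ : Bmax < 2 ^ (Q + 1)) :
    ∫⁻ q, ((2 ^ truncLevel Bmax q : ℕ) : ℝ≥0∞) ∂levelLaw ≤ (Q : ℝ≥0∞) + 1 := by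
  -- A level q ≤ Q has batch 2^q and probability 2^{-q}, contributing 1. The added 1 covers the
  -- truncated levels, where one trajectory is drawn.
  have hle : ∀ q, ((2 ^ truncLevel Bmax q : ℕ) : ℝ≥0∞) ≤
      (if q ≤ Q then (2 : ℝ≥0∞) ^ q else 0) + 1 := by
    intro q
    unfold truncLevel
    by_cases h : (2 : ℝ) ^ q ≤ Bmax
    · have hq : q ≤ Q := by
        have : (2 : ℝ) ^ q < 2 ^ (Q + 1) := h.trans_lt hQ
        have := (pow_lt_pow_iff_right₀ (one_lt_two : (1 : ℝ) < 2)).1 this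
        omega
      rw [if_pos h, if_pos hq]
      push_cast
      exact le_self_add
    · rw [if_neg h]
      simp
  refine (lintegral_mono hle).trans ?_
  rw [lintegral_add_right _ measurable_const, lintegral_levelLaw (Q := Q)
    (fun q hq => if_neg (by omega))]
  gcongr
  · refine (Finset.sum_le_sum (g := fun _ => (1 : ℝ≥0∞)) fun n hn => ?_).trans (le_of_eq (by simp))
    rw [if_pos (by simp at hn; omega), ← mul_pow, ENNReal.inv_mul_cancel (by norm_num) (by norm_num),
      one_pow]
  · simp

end Level

/-! ### The multi-level Monte Carlo estimate -/

section Mlmc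

variable (𝓜 : MDP S A M) (𝓟 : PolicyClass S A d) {γ : ℝ} {f : Euc M → ℝ} {Lf C : ℝ}

lemma SmoothOnBox.continuousOn_partialD (hs : SmoothOnBox f γ Lf) (m : Fin M) :
    ContinuousOn (partialD f m) (box M γ) := by
  have : LipschitzOnWith (Real.toNNReal Lf) (partialD f m) (box M γ) :=
    LipschitzOnWith.of_dist_le_mul fun x hx y hy => by
      rw [dist_eq_norm, dist_eq_norm]
      exact ((hs m).2 x hx y hy).trans
        (mul_le_mul_of_nonneg_right (Real.le_coe_toNNReal Lf) (norm_nonneg _))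
  exact this.continuousOn

/-- The partial derivatives are regular only on the box, so measurability is obtained only after
composing with maps that take values there. -/
lemma SmoothOnBox.measurable_partialD_comp (hs : SmoothOnBox f γ Lf) (m : Fin M)
    {X : Type*} [MeasurableSpace X] {g : X → Euc M} (hg : Measurable g)
    (hb : ∀ x, g x ∈ box M γ) : Measurable fun x => partialD f m (g x) :=
  ((continuousOn_iff_continuous_domRestrict.1 (hs.continuousOn_partialD m)).measurable).comp
    (hg.subtype_mk (h := hb))

lemma SmoothOnBox.measurable_partialD_empReturn (hs : SmoothOnBox f γ Lf)
    (hγ : γ ∈ Set.Ioo (0 : ℝ) 1) (H b : ℕ) (m : Fin M) :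
    Measurable fun τs => partialD f m (empReturn 𝓜 γ H b τs) :=
  hs.measurable_partialD_comp m (measurable_empReturn 𝓜 γ H b) (empReturn_mem_box 𝓜 hγ H b)

lemma SmoothOnBox.measurable_mlmcPartial (hs : SmoothOnBox f γ Lf)
    (hγ : γ ∈ Set.Ioo (0 : ℝ) 1) (H : ℕ) (Bmax : ℝ) (m : Fin M) :
    Measurable fun z : ℕ × (ℕ → Traj S A) => mlmcPartial 𝓜 γ f H Bmax z.1 z.2 m := by
  refine measurable_from_prod_countable_right fun q => ?_
  have h := fun b => hs.measurable_partialD_empReturn 𝓜 hγ H b m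
  unfold mlmcPartial
  refine (h 1).add ?_
  by_cases hq : (2 : ℝ) ^ q ≤ Bmax
  · simp only [hq, if_true]
    exact ((h _).sub (h _)).const_mul _
  · simp only [hq, if_false]
    exact measurable_const

lemma abs_mlmc_correction_le (hC : ∀ m, ∀ y ∈ box M γ, |partialD f m y| ≤ C)
    (hγ : γ ∈ Set.Ioo (0 : ℝ) 1) (H b c : ℕ) (τs : ℕ → Traj S A) (m : Fin M) :
    |partialD f m (empReturn 𝓜 γ H b τs) - partialD f m (empReturn 𝓜 γ H c τs)| ≤ 2 * C := by
  refine (abs_sub _ _).trans ?_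
  have := hC m _ (empReturn_mem_box 𝓜 hγ H b τs)
  have := hC m _ (empReturn_mem_box 𝓜 hγ H c τs)
  linarith

lemma abs_mlmcPartial_le (hC : ∀ m, ∀ y ∈ box M γ, |partialD f m y| ≤ C)
    (hγ : γ ∈ Set.Ioo (0 : ℝ) 1) (H : ℕ) {Bmax : ℝ} (hB : 0 ≤ Bmax) (q : ℕ)
    (τs : ℕ → Traj S A) (m : Fin M) :
    |mlmcPartial 𝓜 γ f H Bmax q τs m| ≤ C + Bmax * (2 * C) := by
  unfold mlmcPartial
  have h1 := hC m _ (empReturn_mem_box 𝓜 hγ H 1 τs)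
  have hC0 : 0 ≤ C := (abs_nonneg _).trans h1
  refine (abs_add_le _ _).trans (add_le_add h1 ?_)
  by_cases hq : (2 : ℝ) ^ q ≤ Bmax
  · rw [if_pos hq, abs_mul, abs_of_nonneg (by positivity)]
    exact mul_le_mul hq (abs_mlmc_correction_le 𝓜 hC hγ H _ _ τs m) (abs_nonneg _) hB
  · rw [if_neg hq, abs_zero]
    positivity

variable {Bmax : ℝ} {Q : ℕ}

lemma two_pow_le_iff (hQ : (2 : ℝ) ^ Q ≤ Bmax) (hQ' : Bmax < 2 ^ (Q + 1)) (q : ℕ) :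
    (2 : ℝ) ^ q ≤ Bmax ↔ q ≤ Q := by
  constructor
  · intro h
    have := (pow_lt_pow_iff_right₀ (one_lt_two : (1 : ℝ) < 2)).1 (h.trans_lt hQ')
    omega
  · intro h
    exact (pow_le_pow_right₀ one_le_two h).trans hQ

/-- The probability 2^{-q} cancels the factor 2^q, so the expected corrections telescope from one
trajectory to 2^Q. The estimate thus has the bias of a batch of size 2^Q at a much smaller expected
cost. -/
lemma SmoothOnBox.integral_mlmcPartial (hs : SmoothOnBox f γ Lf)
    (hC : ∀ m, ∀ y ∈ box M γ, |partialD f m y| ≤ C) (hγ : γ ∈ Set.Ioo (0 : ℝ) 1) (H : ℕ)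
    (hQ : (2 : ℝ) ^ Q ≤ Bmax) (hQ' : Bmax < 2 ^ (Q + 1)) (θ : Euc d) (m : Fin M) :
    ∫ z, mlmcPartial 𝓜 γ f H Bmax z.1 z.2 m ∂(levelLaw.prod (outerLaw 𝓜 𝓟 θ)) =
      ∫ τs, partialD f m (empReturn 𝓜 γ H (2 ^ Q) τs) ∂(outerLaw 𝓜 𝓟 θ) := by
  have hB : 0 ≤ Bmax := (by positivity : (0 : ℝ) ≤ 2 ^ Q).trans hQ
  have hi : ∀ b, Integrable (fun τs => partialD f m (empReturn 𝓜 γ H b τs)) (outerLaw 𝓜 𝓟 θ) :=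
    fun b => integrable_of_abs_le (hs.measurable_partialD_empReturn 𝓜 hγ H b m)
      fun τs => hC m _ (empReturn_mem_box 𝓜 hγ H b τs)
  rw [integral_prod _ (integrable_of_abs_le (hs.measurable_mlmcPartial 𝓜 hγ H Bmax m)
    fun z => abs_mlmcPartial_le 𝓜 hC hγ H hB z.1 z.2 m)]
  set c : ℕ → ℝ := fun b => ∫ τs, partialD f m (empReturn 𝓜 γ H b τs) ∂(outerLaw 𝓜 𝓟 θ) with hc
  set G : ℕ → ℝ := fun q => if q ≤ Q then 2 ^ q * (c (2 ^ q) - c (2 ^ (q - 1))) else 0 with hG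
  have hinner : ∀ q, ∫ τs, mlmcPartial 𝓜 γ f H Bmax q τs m ∂(outerLaw 𝓜 𝓟 θ) = c 1 + G q := by
    intro q
    unfold mlmcPartial
    simp only [two_pow_le_iff hQ hQ', hG]
    by_cases hq : q ≤ Q
    · simp only [hq, if_true]
      have hsub : Integrable (fun τs => partialD f m (empReturn 𝓜 γ H (2 ^ q) τs) -
          partialD f m (empReturn 𝓜 γ H (2 ^ (q - 1)) τs)) (outerLaw 𝓜 𝓟 θ) := (hi _).sub (hi _)
      rw [integral_add (hi 1) (hsub.const_mul _), integral_const_mul, integral_sub (hi _) (hi _)]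
    · simp only [hq, if_false, add_zero]
      rfl
  simp only [hinner]
  have hG0 : ∀ q, Q < q → G q = 0 := fun q hq => if_neg (by omega)
  have hGi : Integrable G levelLaw := by
    refine integrable_of_abs_le (measurable_of_countable G)
      (B := ∑ q ∈ Finset.range (Q + 1), |G q|) fun q => ?_
    by_cases hq : q ≤ Q
    · exact Finset.single_le_sum (f := fun q => |G q|) (fun _ _ => abs_nonneg _)
        (Finset.mem_range.2 (by omega))
    · rw [hG0 q (by omega), abs_zero]
      exact Finset.sum_nonneg fun _ _ => abs_nonneg _
  rw [integral_add (integrable_const _) hGi, integral_levelLaw hG0]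
  have e : ∀ n ∈ Finset.range Q, (1 / 2 : ℝ) ^ (n + 1) * G (n + 1) =
      c (2 ^ (n + 1)) - c (2 ^ n) := by
    intro n hn
    have hn' : n + 1 ≤ Q := by simpa using hn
    simp only [hG, hn', if_true, Nat.add_sub_cancel]
    rw [← mul_assoc, ← mul_pow]
    norm_num
  rw [Finset.sum_congr rfl e, Finset.sum_range_sub (fun n => c (2 ^ n))]
  simp [hc]

/-- Lipschitz continuity turns the bias into the mean distance of the empirical return from J, and
Jensen passes to its mean square. -/
lemma SmoothOnBox.abs_integral_partialD_sub_le (hs : SmoothOnBox f γ Lf)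
    (hLf : 0 ≤ Lf)
    (hC : ∀ m, ∀ y ∈ box M γ, |partialD f m y| ≤ C) (hγ : γ ∈ Set.Ioo (0 : ℝ) 1) (H : ℕ)
    {b : ℕ} (hb : 0 < b) (θ : Euc d) (m : Fin M) :
    |∫ τs, partialD f m (empReturn 𝓜 γ H b τs) ∂(outerLaw 𝓜 𝓟 θ) -
      partialD f m (𝓜.J γ (𝓟.policy θ))| ≤
    Lf * Real.sqrt (2 * (M / (b * (1 - γ) ^ 2)) + 2 * (M * (γ ^ H / (1 - γ)) ^ 2)) := by
  have hi : Integrable (fun τs => partialD f m (empReturn 𝓜 γ H b τs)) (outerLaw 𝓜 𝓟 θ) :=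
    integrable_of_abs_le (hs.measurable_partialD_empReturn 𝓜 hγ H b m)
      fun τs => hC m _ (empReturn_mem_box 𝓜 hγ H b τs)
  have hJ := 𝓜.J_mem_box (𝓟.policy θ) hγ
  set J := 𝓜.J γ (𝓟.policy θ) with hJdef
  have hnm : Measurable fun τs => ‖empReturn 𝓜 γ H b τs - J‖ :=
    ((measurable_empReturn 𝓜 γ H b).sub_const J).norm
  have hnb : ∀ τs, |‖empReturn 𝓜 γ H b τs - J‖| ≤ Real.sqrt (M * (1 / (1 - γ)) ^ 2) := fun τs => by
    rw [abs_of_nonneg (norm_nonneg _)]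
    exact Real.le_sqrt_of_sq_le (norm_sub_le_of_mem_box (empReturn_mem_box 𝓜 hγ H b τs) hJ)
  have hni : Integrable (fun τs => ‖empReturn 𝓜 γ H b τs - J‖) (outerLaw 𝓜 𝓟 θ) :=
    integrable_of_abs_le hnm hnb
  calc |∫ τs, partialD f m (empReturn 𝓜 γ H b τs) ∂(outerLaw 𝓜 𝓟 θ) - partialD f m J|
    _ = |∫ τs, (partialD f m (empReturn 𝓜 γ H b τs) - partialD f m J) ∂(outerLaw 𝓜 𝓟 θ)| := by
        rw [integral_sub hi (integrable_const _)]
        simp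
    _ ≤ ∫ τs, Lf * ‖empReturn 𝓜 γ H b τs - J‖ ∂(outerLaw 𝓜 𝓟 θ) := by
        rw [← Real.norm_eq_abs]
        refine norm_integral_le_of_norm_le (hni.const_mul Lf)
          (Filter.Eventually.of_forall fun τs => ?_)
        exact (hs m).2 _ (empReturn_mem_box 𝓜 hγ H b τs) _ hJ
    _ = Lf * ∫ τs, ‖empReturn 𝓜 γ H b τs - J‖ ∂(outerLaw 𝓜 𝓟 θ) := integral_const_mul _ _
    _ ≤ _ := by
        refine mul_le_mul_of_nonneg_left ((integral_le_sqrt_integral_sq hnm hnb).trans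
          (Real.sqrt_le_sqrt ?_)) hLf
        exact integral_norm_sq_empReturn_sub_J_le 𝓜 𝓟 hγ θ H hb

lemma SmoothOnBox.integral_sq_correction_le (hs : SmoothOnBox f γ Lf)
    (hγ : γ ∈ Set.Ioo (0 : ℝ) 1) (H : ℕ) {b c : ℕ} (hb : 0 < b) (hc : 0 < c)
    (θ : Euc d) (m : Fin M) :
    ∫ τs, (partialD f m (empReturn 𝓜 γ H b τs) - partialD f m (empReturn 𝓜 γ H c τs)) ^ 2
      ∂(outerLaw 𝓜 𝓟 θ) ≤
    Lf ^ 2 * (2 * (M / (b * (1 - γ) ^ 2)) + 2 * (M / (c * (1 - γ) ^ 2))) := by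
  have hi : Integrable (fun τs => ‖empReturn 𝓜 γ H b τs - empReturn 𝓜 γ H c τs‖ ^ 2)
      (outerLaw 𝓜 𝓟 θ) := integrable_of_abs_le (((measurable_empReturn 𝓜 γ H b).sub
        (measurable_empReturn 𝓜 γ H c)).norm.pow_const 2) fun τs => by
          rw [abs_of_nonneg (by positivity)]
          exact norm_sub_le_of_mem_box (empReturn_mem_box 𝓜 hγ H b τs)
            (empReturn_mem_box 𝓜 hγ H c τs)
  calc _ ≤ ∫ τs, Lf ^ 2 * ‖empReturn 𝓜 γ H b τs - empReturn 𝓜 γ H c τs‖ ^ 2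
        ∂(outerLaw 𝓜 𝓟 θ) := by
        refine integral_mono_of_nonneg (Filter.Eventually.of_forall fun τs => sq_nonneg _)
          (hi.const_mul _) (Filter.Eventually.of_forall fun τs => ?_)
        simp only
        rw [← mul_pow, ← sq_abs (partialD f m _ - _)]
        exact pow_le_pow_left₀ (abs_nonneg _) ((hs m).2 _ (empReturn_mem_box 𝓜 hγ H b τs) _
          (empReturn_mem_box 𝓜 hγ H c τs)) 2
    _ = Lf ^ 2 * ∫ τs, ‖empReturn 𝓜 γ H b τs - empReturn 𝓜 γ H c τs‖ ^ 2
        ∂(outerLaw 𝓜 𝓟 θ) := integral_const_mul _ _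
    _ ≤ _ := mul_le_mul_of_nonneg_left
        (integral_norm_sq_empReturn_sub_empReturn_le 𝓜 𝓟 hγ θ H hb hc) (sq_nonneg _)

lemma SmoothOnBox.integral_sq_mlmcPartial_level_le (hs : SmoothOnBox f γ Lf)
    (hC : ∀ m, ∀ y ∈ box M γ, |partialD f m y| ≤ C) (hγ : γ ∈ Set.Ioo (0 : ℝ) 1) (H : ℕ)
    (q : ℕ) (θ : Euc d) (m : Fin M) :
    ∫ τs, mlmcPartial 𝓜 γ f H Bmax q τs m ^ 2 ∂(outerLaw 𝓜 𝓟 θ) ≤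
      2 * C ^ 2 + if (2 : ℝ) ^ q ≤ Bmax then 2 * (2 ^ q) ^ 2 *
        (Lf ^ 2 * (2 * (M / (((2 ^ q : ℕ) : ℝ) * (1 - γ) ^ 2)) +
          2 * (M / (((2 ^ (q - 1) : ℕ) : ℝ) * (1 - γ) ^ 2)))) else 0 := by
  have hc2 : ∀ τs : ℕ → Traj S A, partialD f m (empReturn 𝓜 γ H 1 τs) ^ 2 ≤ C ^ 2 := fun τs => by
    rw [← sq_abs]
    exact pow_le_pow_left₀ (abs_nonneg _) (hC m _ (empReturn_mem_box 𝓜 hγ H 1 τs)) 2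
  by_cases hq : (2 : ℝ) ^ q ≤ Bmax
  · simp only [mlmcPartial, hq, if_true]
    have hΔm : Measurable fun τs : ℕ → Traj S A =>
        (partialD f m (empReturn 𝓜 γ H (2 ^ q) τs) -
          partialD f m (empReturn 𝓜 γ H (2 ^ (q - 1)) τs)) ^ 2 :=
      ((hs.measurable_partialD_empReturn 𝓜 hγ H _ m).sub
        (hs.measurable_partialD_empReturn 𝓜 hγ H _ m)).pow_const 2
    have hΔi : Integrable (fun τs => (partialD f m (empReturn 𝓜 γ H (2 ^ q) τs) -
          partialD f m (empReturn 𝓜 γ H (2 ^ (q - 1)) τs)) ^ 2) (outerLaw 𝓜 𝓟 θ) :=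
      integrable_of_abs_le hΔm (B := (2 * C) ^ 2) fun τs => by
        rw [abs_pow]
        exact pow_le_pow_left₀ (abs_nonneg _) (abs_mlmc_correction_le 𝓜 hC hγ H _ _ τs m) 2
    have hi : Integrable (fun τs => 2 * C ^ 2 + 2 * (2 ^ q) ^ 2 *
        (partialD f m (empReturn 𝓜 γ H (2 ^ q) τs) -
          partialD f m (empReturn 𝓜 γ H (2 ^ (q - 1)) τs)) ^ 2) (outerLaw 𝓜 𝓟 θ) :=
      (integrable_const _).add (hΔi.const_mul _)
    refine (integral_mono_of_nonneg (Filter.Eventually.of_forall fun τs => sq_nonneg _) hi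
      (Filter.Eventually.of_forall fun τs => ?_)).trans ?_
    · have := add_sq_le (a := partialD f m (empReturn 𝓜 γ H 1 τs)) (b := 2 ^ q *
        (partialD f m (empReturn 𝓜 γ H (2 ^ q) τs) -
          partialD f m (empReturn 𝓜 γ H (2 ^ (q - 1)) τs)))
      rw [mul_pow] at this
      have := hc2 τs
      simp only
      linarith
    · rw [integral_add (integrable_const _) (hΔi.const_mul _), integral_const]
      simp only [probReal_univ, one_smul]
      rw [integral_const_mul]
      have hd := hs.integral_sq_correction_le 𝓜 𝓟 hγ H (b := 2 ^ q) (c := 2 ^ (q - 1))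
          (by positivity) (by positivity) θ m
      gcongr
  · simp only [mlmcPartial, hq, if_false, add_zero]
    have hb : ∀ τs : ℕ → Traj S A, |partialD f m (empReturn 𝓜 γ H 1 τs) ^ 2| ≤ C ^ 2 :=
      fun τs => by rw [abs_pow, sq_abs]; exact hc2 τs
    have := abs_integral_le_of_abs_le (μ := outerLaw 𝓜 𝓟 θ) hb
    exact (le_abs_self _).trans (this.trans (by nlinarith [sq_nonneg C]))

/-- At level q the probability is 2^{-q}, the weight 2·4^q, and the mean square correction
Lf²(2M/2^q + 2M/2^{q-1})/(1-γ)² = 6 Lf² M/(2^q (1-γ)²). The product is 12 Lf² M/(1-γ)² for every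
level, and there are Q of them. -/
lemma SmoothOnBox.integral_sq_mlmcPartial_le (hs : SmoothOnBox f γ Lf)
    (hC : ∀ m, ∀ y ∈ box M γ, |partialD f m y| ≤ C) (hγ : γ ∈ Set.Ioo (0 : ℝ) 1) (H : ℕ)
    (hQ : (2 : ℝ) ^ Q ≤ Bmax) (hQ' : Bmax < 2 ^ (Q + 1)) (θ : Euc d) (m : Fin M) :
    ∫ z, mlmcPartial 𝓜 γ f H Bmax z.1 z.2 m ^ 2 ∂(levelLaw.prod (outerLaw 𝓜 𝓟 θ)) ≤
      2 * C ^ 2 + Q * (12 * Lf ^ 2 * M / (1 - γ) ^ 2) := by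
  have h1 : 0 < 1 - γ := by linarith [hγ.2]
  have hB : 0 ≤ Bmax := (by positivity : (0 : ℝ) ≤ 2 ^ Q).trans hQ
  have hpb : ∀ z : ℕ × (ℕ → Traj S A), |mlmcPartial 𝓜 γ f H Bmax z.1 z.2 m ^ 2| ≤
      (C + Bmax * (2 * C)) ^ 2 := fun z => by
    rw [abs_pow]
    exact pow_le_pow_left₀ (abs_nonneg _) (abs_mlmcPartial_le 𝓜 hC hγ H hB z.1 z.2 m) 2
  have hpm : Measurable fun z : ℕ × (ℕ → Traj S A) => mlmcPartial 𝓜 γ f H Bmax z.1 z.2 m ^ 2 :=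
    (hs.measurable_mlmcPartial 𝓜 hγ H Bmax m).pow_const 2
  have hp2 : Integrable (fun z : ℕ × (ℕ → Traj S A) => mlmcPartial 𝓜 γ f H Bmax z.1 z.2 m ^ 2)
      (levelLaw.prod (outerLaw 𝓜 𝓟 θ)) := integrable_of_abs_le hpm hpb
  rw [integral_prod _ hp2]
  set G : ℕ → ℝ := fun q => if (2 : ℝ) ^ q ≤ Bmax then 2 * (2 ^ q) ^ 2 *
        (Lf ^ 2 * (2 * (M / (((2 ^ q : ℕ) : ℝ) * (1 - γ) ^ 2)) +
          2 * (M / (((2 ^ (q - 1) : ℕ) : ℝ) * (1 - γ) ^ 2)))) else 0 with hG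
  have hG0 : ∀ q, Q < q → G q = 0 := fun q hq =>
    if_neg fun h => by have := (two_pow_le_iff hQ hQ' q).1 h; omega
  have hGi : Integrable G levelLaw := by
    refine integrable_of_abs_le (measurable_of_countable G)
      (B := ∑ q ∈ Finset.range (Q + 1), |G q|) fun q => ?_
    by_cases hq : q ≤ Q
    · exact Finset.single_le_sum (f := fun q => |G q|) (fun _ _ => abs_nonneg _)
        (Finset.mem_range.2 (by omega))
    · rw [hG0 q (by omega), abs_zero]
      exact Finset.sum_nonneg fun _ _ => abs_nonneg _
  have hle : ∀ q, ∫ τs, mlmcPartial 𝓜 γ f H Bmax q τs m ^ 2 ∂(outerLaw 𝓜 𝓟 θ) ≤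
      2 * C ^ 2 + G q := fun q => by
    rw [hG]
    exact hs.integral_sq_mlmcPartial_level_le 𝓜 𝓟 hC hγ H q θ m
  have hnn : ∀ q, 0 ≤ ∫ τs, mlmcPartial 𝓜 γ f H Bmax q τs m ^ 2 ∂(outerLaw 𝓜 𝓟 θ) :=
    fun q => integral_nonneg fun τs => sq_nonneg _
  have hi2 : Integrable (fun q => 2 * C ^ 2 + G q) levelLaw := (integrable_const _).add hGi
  clear_value G
  calc ∫ q, ∫ τs, mlmcPartial 𝓜 γ f H Bmax q τs m ^ 2 ∂(outerLaw 𝓜 𝓟 θ) ∂levelLaw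
      ≤ ∫ q, (2 * C ^ 2 + G q) ∂levelLaw :=
        integral_mono_of_nonneg (Filter.Eventually.of_forall hnn) hi2
          (Filter.Eventually.of_forall hle)
    _ = 2 * C ^ 2 + ∑ n ∈ Finset.range Q, (1 / 2 : ℝ) ^ (n + 1) * G (n + 1) := by
        rw [integral_add (integrable_const _) hGi, integral_levelLaw hG0]
        simp
    _ = 2 * C ^ 2 + ∑ n ∈ Finset.range Q, 12 * Lf ^ 2 * M / (1 - γ) ^ 2 := by
        congr 1
        refine Finset.sum_congr rfl fun n hn => ?_
        have hn' : (2 : ℝ) ^ (n + 1) ≤ Bmax :=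
          (two_pow_le_iff hQ hQ' _).2 (by simpa using hn)
        simp only [hG, hn', if_true, Nat.add_sub_cancel]
        push_cast
        rw [one_div, inv_pow]
        field_simp
        ring
    _ = _ := by simp

end Mlmc

/-! ### Linear stochastic iterations -/

section LinIter

/-- The iteration `ω_{n+1} = ω_n - β (A_n ω_n - b_n)` started at `w`. -/
def linIter {E : Type*} [NormedAddCommGroup E] [NormedSpace ℝ E] (β : ℝ) (A : ℕ → E →L[ℝ] E)
    (b : ℕ → E) (w : E) : ℕ → E
  | 0 => w
  | n + 1 => linIter β A b w n - β • (A n (linIter β A b w n) - b n)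

/-- The error obeys e_{n+1} = (I - βA_n)e_n - β(A_n u - b_n). The residuals are summed without using
the contraction, which costs a factor n, only logarithmic here. The lemma serves twice: pathwise
with ρ = 1 and u = 0, and for the mean iteration with ρ = exp(-βl). -/
lemma norm_linIter_sub_le {E : Type*} [NormedAddCommGroup E] [NormedSpace ℝ E] {β ρ η : ℝ}
    (hβ : 0 ≤ β) (hρ0 : 0 ≤ ρ) (hρ : ρ ≤ 1) {A : ℕ → E →L[ℝ] E} {b : ℕ → E} {u : E}
    (hA : ∀ j v, ‖v - β • A j v‖ ≤ ρ * ‖v‖) (hb : ∀ j, ‖A j u - b j‖ ≤ η) (w : E) (n : ℕ) :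
    ‖linIter β A b w n - u‖ ≤ ρ ^ n * ‖w - u‖ + n * (β * η) := by
  have hη : 0 ≤ η := (norm_nonneg _).trans (hb 0)
  induction n with
  | zero => simp [linIter]
  | succ n ih =>
    set x := linIter β A b w n with hx
    have e : linIter β A b w (n + 1) - u =
        ((x - u) - β • A n (x - u)) - β • (A n u - b n) := by
      simp only [linIter, ← hx, map_sub, smul_sub]
      abel
    rw [e]
    calc _ ≤ ‖(x - u) - β • A n (x - u)‖ + ‖β • (A n u - b n)‖ := norm_sub_le _ _
      _ ≤ ρ * ‖x - u‖ + β * η := by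
        rw [norm_smul, Real.norm_of_nonneg hβ]
        exact add_le_add (hA n _) (mul_le_mul_of_nonneg_left (hb n) hβ)
      _ ≤ ρ * (ρ ^ n * ‖w - u‖ + n * (β * η)) + β * η := by gcongr
      _ ≤ ρ ^ (n + 1) * ‖w - u‖ + ((n + 1 : ℕ) : ℝ) * (β * η) := by
        have : ρ * (n * (β * η)) ≤ 1 * (n * (β * η)) :=
          mul_le_mul_of_nonneg_right hρ (by positivity)
        push_cast
        rw [pow_succ]
        nlinarith

lemma measurable_clm_apply {Z : Type*} {mZ : MeasurableSpace Z} {A : Z → Euc d →L[ℝ] Euc d}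
    {v : Z → Euc d} (hA : Measurable A) (hv : Measurable v) : Measurable fun z => A z (v z) := by
  have : Continuous fun p : (Euc d →L[ℝ] Euc d) × Euc d => p.1 p.2 :=
    isBoundedBilinearMap_apply.continuous
  exact this.measurable.comp (hA.prodMk hv)

lemma measurable_linIter {Z : Type*} {mZ : MeasurableSpace Z} {β : ℝ}
    {A : Z → ℕ → Euc d →L[ℝ] Euc d} {b : Z → ℕ → Euc d} {w : Euc d} {n : ℕ}
    (hA : ∀ j < n, Measurable fun z => A z j) (hb : ∀ j < n, Measurable fun z => b z j) :
    Measurable fun z => linIter β (A z) (b z) w n := by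
  induction n with
  | zero => exact measurable_const
  | succ n ih =>
    have h := ih (fun j hj => hA j (by omega)) (fun j hj => hb j (by omega))
    exact h.sub (((measurable_clm_apply (hA n (by omega)) h).sub (hb n (by omega))).const_smul β)

lemma exists_norm_linIter_le {Z : Type*} (β : ℝ) {A : Z → ℕ → Euc d →L[ℝ] Euc d}
    {b : Z → ℕ → Euc d} {a B : ℝ} (hA : ∀ z j, ‖A z j‖ ≤ a) (hb : ∀ z j, ‖b z j‖ ≤ B) (w : Euc d)
    (n : ℕ) : ∃ R, ∀ z, ‖linIter β (A z) (b z) w n‖ ≤ R := by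
  induction n with
  | zero => exact ⟨‖w‖, fun z => le_rfl⟩
  | succ n ih =>
    obtain ⟨R, hR⟩ := ih
    refine ⟨R + |β| * (a * R + B), fun z => ?_⟩
    have ha : 0 ≤ a := (norm_nonneg _).trans (hA z n)
    refine (norm_sub_le _ _).trans (add_le_add (hR z) ?_)
    rw [norm_smul, Real.norm_eq_abs]
    refine mul_le_mul_of_nonneg_left ((norm_sub_le _ _).trans (add_le_add ?_ (hb z n)))
      (abs_nonneg _)
    exact ((A z n).le_opNorm _).trans (mul_le_mul (hA z n) (hR z) (norm_nonneg _) ha)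

/-- The iterate ω_n depends on the samples 0, …, n-1 only and is therefore independent of the n-th
sample. -/
lemma indepFun_past_infinitePi {Y Z : Type*} [MeasurableSpace Y] [MeasurableSpace Z]
    {ν : Measure Y} [IsProbabilityMeasure ν] {n : ℕ} {X : (ℕ → Y) → Z}
    (hX : Measurable[⨆ i ∈ Set.Iio n, MeasurableSpace.comap (fun y : ℕ → Y => y i) inferInstance]
      X) : IndepFun X (fun y => y n) (Measure.infinitePi fun _ : ℕ => ν) := by
  have h := iIndepFun_infinitePi (P := fun _ : ℕ => ν) (X := fun _ y => y) fun _ => measurable_id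
  have h2 := indep_iSup_of_disjoint (fun i => (measurable_pi_apply i).comap_le) h.iIndep
    (S := Set.Iio n) (T := {n}) (by simp)
  rw [IndepFun_iff_Indep]
  refine indep_of_indep_of_le_left (indep_of_indep_of_le_right h2 ?_) hX.comap_le
  exact le_iSup₂_of_le n rfl le_rfl

lemma integral_sub_smul_sub {Z : Type*} [MeasurableSpace Z] {P : Measure Z} (β : ℝ)
    {u v b : Z → Euc d} (hu : Integrable u P) (hv : Integrable v P) (hb : Integrable b P) :
    ∫ z, u z - β • (v z - b z) ∂P = ∫ z, u z ∂P - β • (∫ z, v z ∂P - ∫ z, b z ∂P) := by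
  have h : Integrable (fun z => β • (v z - b z)) P := (hv.sub hb).smul β
  rw [integral_sub hu h, integral_smul, integral_sub hv hb]

/-- One step is affine in ω for a fixed sample, and the fresh sample is independent of ω_n, so E[A_n
ω_n] = E[A] E[ω_n] and the mean follows the averaged recursion exactly. -/
lemma integral_linIter {Y : Type*} [MeasurableSpace Y] {ν : Measure Y} [IsProbabilityMeasure ν]
    {β : ℝ} {A : Y → Euc d →L[ℝ] Euc d} {b : Y → Euc d} (hA : Measurable A) (hb : Measurable b)
    {a B : ℝ} (hAa : ∀ y, ‖A y‖ ≤ a) (hbB : ∀ y, ‖b y‖ ≤ B) (w : Euc d) (n : ℕ) :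
    ∫ y, linIter β (fun j => A (y j)) (fun j => b (y j)) w n
        ∂(Measure.infinitePi fun _ : ℕ => ν) =
      linIter β (fun _ => ∫ y, A y ∂ν) (fun _ => ∫ y, b y ∂ν) w n := by
  induction n with
  | zero => simp [linIter]
  | succ n ih =>
    set P := Measure.infinitePi fun _ : ℕ => ν with hP
    set X : (ℕ → Y) → Euc d := fun y => linIter β (fun j => A (y j)) (fun j => b (y j)) w n with hX
    have hXm : Measurable X := measurable_linIter (fun j _ => hA.comp (measurable_pi_apply j))
      (fun j _ => hb.comp (measurable_pi_apply j))
    have hXp : Measurable[⨆ i ∈ Set.Iio n,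
        MeasurableSpace.comap (fun y : ℕ → Y => y i) inferInstance] X := by
      have hc : ∀ j < n, Measurable[⨆ i ∈ Set.Iio n,
          MeasurableSpace.comap (fun y : ℕ → Y => y i) inferInstance] fun y : ℕ → Y => y j :=
        fun j hj => Measurable.mono (comap_measurable _) (le_iSup₂_of_le j hj le_rfl) le_rfl
      exact measurable_linIter (fun j hj => hA.comp (hc j hj)) (fun j hj => hb.comp (hc j hj))
    obtain ⟨R, hR⟩ := exists_norm_linIter_le β (A := fun (y : ℕ → Y) j => A (y j))
      (b := fun (y : ℕ → Y) j => b (y j)) (fun z j => hAa _) (fun z j => hbB _) w n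
    obtain ⟨R', hR'⟩ := exists_norm_linIter_le β (A := fun (y : ℕ → Y) j => A (y j))
      (b := fun (y : ℕ → Y) j => b (y j)) (fun z j => hAa _) (fun z j => hbB _) w (n + 1)
    have hXi : Integrable X P :=
      Integrable.of_bound hXm.aestronglyMeasurable R (Filter.Eventually.of_forall hR)
    have hAi : Integrable A ν :=
      Integrable.of_bound hA.aestronglyMeasurable a (Filter.Eventually.of_forall hAa)
    have hbi : Integrable b ν :=
      Integrable.of_bound hb.aestronglyMeasurable B (Filter.Eventually.of_forall hbB)
    set g : Euc d × Y → Euc d := fun z => z.1 - β • (A z.2 z.1 - b z.2) with hg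
    have hgm : Measurable g := measurable_fst.sub (((measurable_clm_apply
      (hA.comp measurable_snd) measurable_fst).sub (hb.comp measurable_snd)).const_smul β)
    have hpair : Measurable fun y : ℕ → Y => (X y, y n) := hXm.prodMk (measurable_pi_apply n)
    -- Independence of past and present turns the joint law into a product, so the fresh sample can
    -- be integrated out first.
    have hlaw : P.map (fun y => (X y, y n)) = (P.map X).prod ν := by
      rw [(indepFun_iff_map_prod_eq_prod_map_map hXm.aemeasurable
        (measurable_pi_apply n).aemeasurable).1 (indepFun_past_infinitePi hXp),
        hP, Measure.infinitePi_map_eval]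
    have hgi : Integrable g ((P.map X).prod ν) := by
      rw [← hlaw, integrable_map_measure hgm.aestronglyMeasurable hpair.aemeasurable]
      exact Integrable.of_bound (hgm.comp hpair).aestronglyMeasurable R'
        (Filter.Eventually.of_forall hR')
    have := Measure.isProbabilityMeasure_map (μ := P) hXm.aemeasurable
    have hin : ∀ x, ∫ u, g (x, u) ∂ν = x - β • ((∫ y, A y ∂ν) x - ∫ y, b y ∂ν) := by
      intro x
      have h1 : Integrable (fun u => A u x) ν := hAi.apply_continuousLinearMap x
      simp only [hg]
      rw [integral_sub_smul_sub β (integrable_const _) h1 hbi,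
        ContinuousLinearMap.integral_apply hAi]
      simp
    set Ab := ∫ y, A y ∂ν
    set bb := ∫ y, b y ∂ν
    calc ∫ y, linIter β (fun j => A (y j)) (fun j => b (y j)) w (n + 1) ∂P
        = ∫ y, g (X y, y n) ∂P := rfl
      _ = ∫ z, g z ∂((P.map X).prod ν) := by
        rw [← hlaw, integral_map hpair.aemeasurable hgm.aestronglyMeasurable]
      _ = ∫ x, x - β • (Ab x - bb) ∂(P.map X) := by
        rw [integral_prod _ hgi]
        simp only [hin]
      _ = ∫ y, X y - β • (Ab (X y) - bb) ∂P := by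
        rw [integral_map hXm.aemeasurable]
        exact (Continuous.aestronglyMeasurable (by fun_prop))
      _ = (∫ y, X y ∂P) - β • (Ab (∫ y, X y ∂P) - bb) := by
        have h1 : Integrable (fun y => Ab (X y)) P := Ab.integrable_comp hXi
        rw [integral_sub_smul_sub β hXi h1 (integrable_const _), Ab.integral_comp_comm hXi]
        simp
      _ = _ := by rw [ih]; rfl

/-- The multi-level estimate is the same in all N steps, so it cannot be averaged step by step like
the fresh samples. With the matrix fixed, the iterate is affine in `b`, and the average passes
through at the end. -/
lemma integral_linIter_const {Z : Type*} [MeasurableSpace Z] {P : Measure Z}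
    [IsProbabilityMeasure P] {β : ℝ} (A : Euc d →L[ℝ] Euc d) {b : Z → Euc d} (hb : Integrable b P)
    (w : Euc d) (n : ℕ) :
    Integrable (fun z => linIter β (fun _ => A) (fun _ => b z) w n) P ∧
    ∫ z, linIter β (fun _ => A) (fun _ => b z) w n ∂P =
      linIter β (fun _ => A) (fun _ => ∫ z, b z ∂P) w n := by
  induction n with
  | zero => exact ⟨integrable_const _, by simp [linIter]⟩
  | succ n ih =>
    have h1 := A.integrable_comp ih.1
    have h2 : Integrable (fun z => A (linIter β (fun _ => A) (fun _ => b z) w n) - b z) P :=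
      h1.sub hb
    refine ⟨ih.1.sub (h2.smul β), ?_⟩
    simp only [linIter]
    rw [integral_sub_smul_sub β ih.1 h1 hb, A.integral_comp_comm ih.1, ih.2]

end LinIter

/-! ### The inner loop -/

section InnerLoop

variable (𝓜 : MDP S A M) {𝓟 : PolicyClass S A d} {γ G₁ G₂ : ℝ}

/-- The estimate of the gradient of `J_m` formed from one trajectory. -/
def gradTraj (γ : ℝ) (𝓟 : PolicyClass S A d) (H : ℕ) (θ : Euc d) (m : Fin M) (τ : Traj S A) :
    Euc d :=
  ∑ h ∈ Finset.range H, γ ^ h • (𝓜.r m (τ h) • scoreSum 𝓟 θ h τ)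

/-- Interchanging the sums over t ≤ h groups the estimate by reward time. This matches the form of
`gradTerm` and shows linearity in the estimated partial derivatives. -/
lemma gradEst_eq (γ : ℝ) (𝓟 : PolicyClass S A d) (H : ℕ) (pd : Fin M → ℝ) (θ : Euc d)
    (τ : Traj S A) :
    gradEst 𝓜 γ 𝓟 H pd θ τ = ∑ m, pd m • gradTraj 𝓜 γ 𝓟 H θ m τ := by
  unfold gradEst
  simp only [Finset.sum_smul]
  rw [Finset.sum_comm]
  refine Finset.sum_congr rfl fun m _ => ?_
  simp only [mul_smul, ← Finset.smul_sum]
  congr 1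
  simp only [Finset.sum_smul]
  rw [Finset.sum_comm' (t' := Finset.range H) (s' := fun h => Finset.range (h + 1))]
  · refine Finset.sum_congr rfl fun h _ => ?_
    simp only [scoreSum, Finset.smul_sum, smul_smul]
  · intro t h
    simp only [Finset.mem_range, Finset.mem_Ico]
    omega

lemma ScoreRegular.norm_gradTraj_le (hS : ScoreRegular 𝓟 G₁ G₂)
    (hγ : γ ∈ Set.Ioo (0 : ℝ) 1) (hG₁ : 0 < G₁) (H : ℕ) (θ : Euc d) (m : Fin M) (τ : Traj S A) :
    ‖gradTraj 𝓜 γ 𝓟 H θ m τ‖ ≤ 1 / (1 - γ) ^ 2 * G₁ := by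
  refine (norm_sum_le_of_le (f := fun h => γ ^ h • (𝓜.r m (τ h) • scoreSum 𝓟 θ h τ))
    (n := fun h => γ ^ h * ((h : ℝ) + 1) * G₁) _ fun h _ => ?_).trans ?_
  · rw [norm_smul, norm_pow, Real.norm_of_nonneg hγ.1.le]
    have := mul_le_mul_of_nonneg_left (hS.norm_reward_smul_scoreSum_le 𝓜 θ m h τ)
      (pow_nonneg hγ.1.le h)
    linarith
  · exact sum_le_hasSum _ (fun h _ => by have := hγ.1; positivity)
      ((hasSum_succ_mul_geometric hγ).mul_right G₁)

lemma ScoreRegular.measurable_gradTraj_prod (hS : ScoreRegular 𝓟 G₁ G₂) (γ : ℝ) (H : ℕ)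
    (m : Fin M) : Measurable fun p : Euc d × Traj S A => gradTraj 𝓜 γ 𝓟 H p.1 m p.2 := by
  refine Finset.measurable_sum _ fun h _ => ?_
  have h1 : Measurable fun p : Euc d × Traj S A => 𝓜.r m (p.2 h) :=
    (𝓜.r_measurable m).comp ((measurable_pi_apply h).comp measurable_snd)
  have h2 : Measurable fun p : Euc d × Traj S A => scoreSum 𝓟 p.1 h p.2 :=
    Finset.measurable_sum _ fun t _ => hS.measurable_score_prod.comp
      (measurable_fst.prodMk ((measurable_pi_apply t).comp measurable_snd))
  exact (h1.smul h2).const_smul (γ ^ h)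

lemma ScoreRegular.integral_gradTraj (hS : ScoreRegular 𝓟 G₁ G₂) (γ : ℝ) (H : ℕ) (θ : Euc d)
    (m : Fin M) :
    ∫ τ, gradTraj 𝓜 γ 𝓟 H θ m τ ∂(pathOf 𝓜 𝓟 θ) = truncGrad 𝓜 γ 𝓟 H θ m := by
  have hi := hS.integrable_reward_smul_scoreSum 𝓜 θ m
  unfold gradTraj truncGrad gradTerm
  have hi' : ∀ h, Integrable (fun τ => γ ^ h • (𝓜.r m (τ h) • scoreSum 𝓟 θ h τ))
    (pathOf 𝓜 𝓟 θ) := fun h => (hi h).smul (γ ^ h)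
  rw [integral_finsetSum _ fun h _ => hi' h]
  exact Finset.sum_congr rfl fun h _ => integral_smul _ _

lemma ScoreRegular.norm_gradEst_le (hS : ScoreRegular 𝓟 G₁ G₂)
    (hγ : γ ∈ Set.Ioo (0 : ℝ) 1) (hG₁ : 0 < G₁) (H : ℕ) (pd : Fin M → ℝ) (θ : Euc d)
    (τ : Traj S A) :
    ‖gradEst 𝓜 γ 𝓟 H pd θ τ‖ ≤ (∑ m, |pd m|) * (1 / (1 - γ) ^ 2 * G₁) := by
  rw [gradEst_eq, Finset.sum_mul]
  refine norm_sum_le_of_le _ fun m _ => ?_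
  rw [norm_smul, Real.norm_eq_abs]
  exact mul_le_mul_of_nonneg_left (hS.norm_gradTraj_le 𝓜 hγ hG₁ H θ m τ) (abs_nonneg _)

lemma ScoreRegular.measurable_gradTraj (hS : ScoreRegular 𝓟 G₁ G₂) (γ : ℝ) (H : ℕ)
    (θ : Euc d) (m : Fin M) : Measurable fun τ => gradTraj 𝓜 γ 𝓟 H θ m τ := by
  have h1 : Measurable fun τ : Traj S A => (θ, τ) := measurable_prodMk_left
  have h2 := (hS.measurable_gradTraj_prod 𝓜 γ H m).comp h1
  exact h2

lemma ScoreRegular.measurable_gradEst (hS : ScoreRegular 𝓟 G₁ G₂) (γ : ℝ) (H : ℕ)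
    (pd : Fin M → ℝ) (θ : Euc d) : Measurable fun τ => gradEst 𝓜 γ 𝓟 H pd θ τ := by
  simp only [gradEst_eq]
  exact Finset.measurable_sum _ fun m _ => (hS.measurable_gradTraj 𝓜 γ H θ m).const_smul (pd m)

lemma ScoreRegular.integral_gradEst (hS : ScoreRegular 𝓟 G₁ G₂) (hγ : γ ∈ Set.Ioo (0 : ℝ) 1)
    (hG₁ : 0 < G₁) (H : ℕ) (pd : Fin M → ℝ) (θ : Euc d) :
    ∫ τ, gradEst 𝓜 γ 𝓟 H pd θ τ ∂(pathOf 𝓜 𝓟 θ) = ∑ m, pd m • truncGrad 𝓜 γ 𝓟 H θ m := by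
  have hi : ∀ m, Integrable (gradTraj 𝓜 γ 𝓟 H θ m) (pathOf 𝓜 𝓟 θ) := fun m =>
    Integrable.of_bound (hS.measurable_gradTraj 𝓜 γ H θ m).aestronglyMeasurable _
      (Filter.Eventually.of_forall fun τ => hS.norm_gradTraj_le 𝓜 hγ hG₁ H θ m τ)
  simp only [gradEst_eq]
  have hi' : ∀ m, Integrable (fun τ => pd m • gradTraj 𝓜 γ 𝓟 H θ m τ) (pathOf 𝓜 𝓟 θ) :=
    fun m => (hi m).smul (pd m)
  rw [integral_finsetSum _ fun m _ => hi' m]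
  refine Finset.sum_congr rfl fun m _ => ?_
  rw [integral_smul, hS.integral_gradTraj 𝓜 γ H θ m]

variable {f : Euc M → ℝ} {I : Inputs d}

/-- With B = 1 only trajectory 0 of each inner batch enters, and the averages disappear. -/
lemma innerLoop_eq_linIter (hB : I.B = 1) (θ w : Euc d) (x : Draw S A) (n : ℕ) :
    innerLoop 𝓜 γ 𝓟 f I θ w x n =
      linIter I.β (fun j => sampleFisher γ 𝓟 I.H θ (x.2.2 j 0))
        (fun j => gradEst 𝓜 γ 𝓟 I.H (mlmcPartial 𝓜 γ f I.H I.Bmax x.1 x.2.1) θ (x.2.2 j 0)) w n := by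
  induction n with
  | zero => rfl
  | succ n ih =>
    simp only [innerLoop, linIter, hB, Finset.range_one, Finset.sum_singleton, Nat.cast_one,
      div_one, one_smul, fisherEst_mulVec, ih]

variable {Lf C : ℝ}

lemma ScoreRegular.measurable_innerLoop (hS : ScoreRegular 𝓟 G₁ G₂) (hs : SmoothOnBox f γ Lf)
    (hγ : γ ∈ Set.Ioo (0 : ℝ) 1) (hB : I.B = 1) (w : Euc d) (n : ℕ) :
    Measurable fun p : Euc d × Draw S A => innerLoop 𝓜 γ 𝓟 f I p.1 w p.2 n := by
  simp only [innerLoop_eq_linIter 𝓜 hB]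
  have hτ : ∀ j, Measurable fun p : Euc d × Draw S A => (p.1, p.2.2.2 j 0) := fun j =>
    measurable_fst.prodMk ((measurable_pi_apply 0).comp ((measurable_pi_apply j).comp
      (measurable_snd.comp (measurable_snd.comp measurable_snd))))
  have hq : Measurable fun p : Euc d × Draw S A => (p.2.1, p.2.2.1) :=
    (measurable_fst.comp measurable_snd).prodMk
      (measurable_fst.comp (measurable_snd.comp measurable_snd))
  have hF : ∀ j, Measurable fun p : Euc d × Draw S A =>
      sampleFisher γ 𝓟 I.H p.1 (p.2.2.2 j 0) := fun j => by
    have h := (hS.measurable_sampleFisher_prod γ I.H).comp (hτ j)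
    exact h
  have hg : ∀ j m, Measurable fun p : Euc d × Draw S A =>
      gradTraj 𝓜 γ 𝓟 I.H p.1 m (p.2.2.2 j 0) := fun j m => by
    have h := (hS.measurable_gradTraj_prod 𝓜 γ I.H m).comp (hτ j)
    exact h
  have hp : ∀ m, Measurable fun p : Euc d × Draw S A =>
      mlmcPartial 𝓜 γ f I.H I.Bmax p.2.1 p.2.2.1 m := fun m => by
    have h := (hs.measurable_mlmcPartial 𝓜 hγ I.H I.Bmax m).comp hq
    exact h
  refine measurable_linIter (fun j _ => hF j) fun j _ => ?_
  simp only [gradEst_eq]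
  exact Finset.measurable_sum _ fun m _ => (hp m).smul (hg j m)

lemma ScoreRegular.norm_innerLoop_le (hS : ScoreRegular 𝓟 G₁ G₂)
    (hγ : γ ∈ Set.Ioo (0 : ℝ) 1) (hG₁ : 0 < G₁) (hB : I.B = 1) (hβ0 : 0 ≤ I.β)
    (hβ : I.β ≤ (1 - γ) / G₁ ^ 2) (θ w : Euc d) (x : Draw S A) (n : ℕ) :
    ‖innerLoop 𝓜 γ 𝓟 f I θ w x n‖ ≤ ‖w‖ + n * (I.β * ((∑ m,
      |mlmcPartial 𝓜 γ f I.H I.Bmax x.1 x.2.1 m|) * (1 / (1 - γ) ^ 2 * G₁))) := by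
  rw [innerLoop_eq_linIter 𝓜 hB]
  have := norm_linIter_sub_le hβ0 zero_le_one le_rfl (u := (0 : Euc d))
    (A := fun j => sampleFisher γ 𝓟 I.H θ (x.2.2 j 0))
    (b := fun j => gradEst 𝓜 γ 𝓟 I.H (mlmcPartial 𝓜 γ f I.H I.Bmax x.1 x.2.1) θ (x.2.2 j 0))
    (fun j v => by
      rw [one_mul]; exact hS.norm_sub_smul_sampleFisher_le hG₁ hγ hβ0 hβ I.H θ (x.2.2 j 0) v)
    (fun j => by
      rw [map_zero, zero_sub, norm_neg]
      exact hS.norm_gradEst_le 𝓜 hγ hG₁ I.H _ θ (x.2.2 j 0)) w n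
  simpa using this

/-- The law of the inner trajectories. -/
abbrev innerLaw (𝓟 : PolicyClass S A d) (θ : Euc d) : Measure (ℕ → ℕ → Traj S A) :=
  Measure.infinitePi fun _ : ℕ => outerLaw 𝓜 𝓟 θ

/-- Reassociates the product so that the inner trajectories are integrated with the level and the
outer trajectories held fixed. -/
lemma integral_drawLaw {E : Type*} [NormedAddCommGroup E] [NormedSpace ℝ E] (θ : Euc d)
    {φ : Draw S A → E} (hφ : Integrable φ (drawLaw 𝓜 𝓟 θ)) :
    ∫ x, φ x ∂(drawLaw 𝓜 𝓟 θ) = ∫ z, ∫ y, φ (z.1, z.2, y) ∂(innerLaw 𝓜 𝓟 θ)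
      ∂(levelLaw.prod (outerLaw 𝓜 𝓟 θ)) := by
  have h := measurePreserving_prodAssoc levelLaw (outerLaw 𝓜 𝓟 θ) (innerLaw 𝓜 𝓟 θ)
  have hi := (h.integrable_comp_emb (MeasurableEquiv.measurableEmbedding _) (g := φ)).2 hφ
  calc ∫ x, φ x ∂(drawLaw 𝓜 𝓟 θ)
      = ∫ z, (φ ∘ MeasurableEquiv.prodAssoc) z
        ∂((levelLaw.prod (outerLaw 𝓜 𝓟 θ)).prod (innerLaw 𝓜 𝓟 θ)) :=
        (h.integral_comp (MeasurableEquiv.measurableEmbedding _) φ).symm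
    _ = _ := integral_prod _ hi

lemma ScoreRegular.exists_norm_innerLoop_le (hS : ScoreRegular 𝓟 G₁ G₂)
    (hC : ∀ m, ∀ y ∈ box M γ, |partialD f m y| ≤ C)
    (hγ : γ ∈ Set.Ioo (0 : ℝ) 1) (hG₁ : 0 < G₁) (hB : I.B = 1) (hβ0 : 0 ≤ I.β)
    (hβ : I.β ≤ (1 - γ) / G₁ ^ 2) (hBm : 0 ≤ I.Bmax) (w : Euc d) (n : ℕ) :
    ∃ R, ∀ θ (x : Draw S A), ‖innerLoop 𝓜 γ 𝓟 f I θ w x n‖ ≤ R := by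
  refine ⟨‖w‖ + n * (I.β * ((∑ _m : Fin M, (C + I.Bmax * (2 * C))) *
    (1 / (1 - γ) ^ 2 * G₁))), fun θ x =>
    (hS.norm_innerLoop_le 𝓜 hγ hG₁ hB hβ0 hβ θ w x n).trans ?_⟩
  gcongr
  exact abs_mlmcPartial_le 𝓜 hC hγ I.H hBm _ _ _

end InnerLoop

/-! ### Mean and second moment of the inner loop -/

section InnerLoopMoments

variable (𝓜 : MDP S A M) {𝓟 : PolicyClass S A d} {γ G₁ G₂ : ℝ} {f : Euc M → ℝ} {I : Inputs d}
  {Lf C : ℝ} {Q : ℕ}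

lemma integral_eval_outerLaw {E : Type*} [NormedAddCommGroup E] [NormedSpace ℝ E] (θ : Euc d)
    {g : Traj S A → E} (hg : AEStronglyMeasurable g (pathOf 𝓜 𝓟 θ)) (j : ℕ) :
    ∫ y, g (y j) ∂(outerLaw 𝓜 𝓟 θ) = ∫ τ, g τ ∂(pathOf 𝓜 𝓟 θ) := by
  have h : (outerLaw 𝓜 𝓟 θ).map (fun y => y j) = pathOf 𝓜 𝓟 θ := Measure.infinitePi_map_eval _ j
  rw [← h, integral_map (measurable_pi_apply j).aemeasurable (by rwa [h])]

lemma ScoreRegular.measurable_innerLoop_draw (hS : ScoreRegular 𝓟 G₁ G₂)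
    (hs : SmoothOnBox f γ Lf) (hγ : γ ∈ Set.Ioo (0 : ℝ) 1) (hB : I.B = 1) (θ w : Euc d) (n : ℕ) :
    Measurable fun x : Draw S A => innerLoop 𝓜 γ 𝓟 f I θ w x n := by
  have h1 : Measurable fun x : Draw S A => (θ, x) := measurable_prodMk_left
  have h2 := (hS.measurable_innerLoop 𝓜 hs hγ hB w n).comp h1
  exact h2

lemma ScoreRegular.integral_innerLoop_inner (hS : ScoreRegular 𝓟 G₁ G₂)
    (hγ : γ ∈ Set.Ioo (0 : ℝ) 1) (hG₁ : 0 < G₁) (hB : I.B = 1) (θ w : Euc d) (n : ℕ)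
    (z : ℕ × (ℕ → Traj S A)) :
    ∫ y, innerLoop 𝓜 γ 𝓟 f I θ w (z.1, z.2, y) n ∂(innerLaw 𝓜 𝓟 θ) =
      linIter I.β (fun _ => truncFisher 𝓜 γ 𝓟 I.H θ)
        (fun _ => ∑ m, mlmcPartial 𝓜 γ f I.H I.Bmax z.1 z.2 m • truncGrad 𝓜 γ 𝓟 I.H θ m) w n := by
  simp only [innerLoop_eq_linIter 𝓜 hB]
  set p := mlmcPartial 𝓜 γ f I.H I.Bmax z.1 z.2 with hp
  have hFm := hS.measurable_sampleFisher γ I.H θ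
  have hgm := hS.measurable_gradEst 𝓜 γ I.H p θ
  have hFm' : Measurable fun y : ℕ → Traj S A => sampleFisher γ 𝓟 I.H θ (y 0) :=
    hFm.comp (measurable_pi_apply 0)
  have hgm' : Measurable fun y : ℕ → Traj S A => gradEst 𝓜 γ 𝓟 I.H p θ (y 0) :=
    hgm.comp (measurable_pi_apply 0)
  have key := integral_linIter (ν := outerLaw 𝓜 𝓟 θ) (β := I.β) hFm' hgm'
    (fun y => hS.norm_sampleFisher_le hγ I.H θ (y 0))
    (fun y => hS.norm_gradEst_le 𝓜 hγ hG₁ I.H p θ (y 0)) w n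
  rw [integral_eval_outerLaw 𝓜 θ hFm.aestronglyMeasurable,
    integral_eval_outerLaw 𝓜 θ hgm.aestronglyMeasurable, hS.integral_gradEst 𝓜 hγ hG₁] at key
  exact key

/-- Averaging first over the inner samples (`integral_linIter`), then over the outer draws
(`integral_linIter_const`), and finally telescoping the mean of the multi-level estimate. -/
lemma ScoreRegular.integral_innerLoop (hS : ScoreRegular 𝓟 G₁ G₂)
    (hs : SmoothOnBox f γ Lf) (hC : ∀ m, ∀ y ∈ box M γ, |partialD f m y| ≤ C)
    (hγ : γ ∈ Set.Ioo (0 : ℝ) 1) (hG₁ : 0 < G₁) (hB : I.B = 1) (hβ0 : 0 ≤ I.β)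
    (hβ : I.β ≤ (1 - γ) / G₁ ^ 2) (hQ : (2 : ℝ) ^ Q ≤ I.Bmax) (hQ' : I.Bmax < 2 ^ (Q + 1))
    (θ w : Euc d) (n : ℕ) :
    ∫ x, innerLoop 𝓜 γ 𝓟 f I θ w x n ∂(drawLaw 𝓜 𝓟 θ) =
      linIter I.β (fun _ => truncFisher 𝓜 γ 𝓟 I.H θ)
        (fun _ => ∑ m, (∫ τs, partialD f m (empReturn 𝓜 γ I.H (2 ^ Q) τs) ∂(outerLaw 𝓜 𝓟 θ)) •
          truncGrad 𝓜 γ 𝓟 I.H θ m) w n := by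
  have hBm : 0 ≤ I.Bmax := (by positivity : (0 : ℝ) ≤ 2 ^ Q).trans hQ
  obtain ⟨R, hR⟩ := hS.exists_norm_innerLoop_le 𝓜 hC hγ hG₁ hB hβ0 hβ hBm w n
  rw [integral_drawLaw 𝓜 θ (Integrable.of_bound
    (hS.measurable_innerLoop_draw 𝓜 hs hγ hB θ w n).aestronglyMeasurable R
    (Filter.Eventually.of_forall (hR θ)))]
  simp only [hS.integral_innerLoop_inner 𝓜 hγ hG₁ hB θ w n]
  have hp : ∀ m, Integrable (fun z : ℕ × (ℕ → Traj S A) =>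
      mlmcPartial 𝓜 γ f I.H I.Bmax z.1 z.2 m) (levelLaw.prod (outerLaw 𝓜 𝓟 θ)) := fun m =>
    integrable_of_abs_le (hs.measurable_mlmcPartial 𝓜 hγ I.H I.Bmax m)
      fun z => abs_mlmcPartial_le 𝓜 hC hγ I.H hBm z.1 z.2 m
  have hp' : ∀ m, Integrable (fun z : ℕ × (ℕ → Traj S A) =>
      mlmcPartial 𝓜 γ f I.H I.Bmax z.1 z.2 m • truncGrad 𝓜 γ 𝓟 I.H θ m)
      (levelLaw.prod (outerLaw 𝓜 𝓟 θ)) := fun m => (hp m).smul_const _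
  rw [(integral_linIter_const (truncFisher 𝓜 γ 𝓟 I.H θ)
    (integrable_finsetSum _ fun m _ => hp' m) w n).2, integral_finsetSum _ fun m _ => hp' m]
  congr 1
  funext _
  refine Finset.sum_congr rfl fun m _ => ?_
  rw [integral_smul_const, hs.integral_mlmcPartial 𝓜 𝓟 hC hγ I.H hQ hQ' θ m]

lemma sum_abs_sq_le (p : Fin M → ℝ) : (∑ m, |p m|) ^ 2 ≤ M * ∑ m, p m ^ 2 := by
  have h := sq_sum_le_card_mul_sum_sq (s := (Finset.univ : Finset (Fin M))) (f := fun m => |p m|)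
  simpa using h

lemma ScoreRegular.integral_norm_sq_innerLoop_le (hS : ScoreRegular 𝓟 G₁ G₂)
    (hs : SmoothOnBox f γ Lf) (hC : ∀ m, ∀ y ∈ box M γ, |partialD f m y| ≤ C)
    (hγ : γ ∈ Set.Ioo (0 : ℝ) 1) (hG₁ : 0 < G₁) (hB : I.B = 1) (hβ0 : 0 ≤ I.β)
    (hβ : I.β ≤ (1 - γ) / G₁ ^ 2) (hQ : (2 : ℝ) ^ Q ≤ I.Bmax) (hQ' : I.Bmax < 2 ^ (Q + 1))
    (θ w : Euc d) (n : ℕ) :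
    ∫ x, ‖innerLoop 𝓜 γ 𝓟 f I θ w x n‖ ^ 2 ∂(drawLaw 𝓜 𝓟 θ) ≤
      2 * ‖w‖ ^ 2 + 2 * (n * (I.β * (1 / (1 - γ) ^ 2 * G₁))) ^ 2 *
        (M * (M * (2 * C ^ 2 + Q * (12 * Lf ^ 2 * M / (1 - γ) ^ 2)))) := by
  have hBm : 0 ≤ I.Bmax := (by positivity : (0 : ℝ) ≤ 2 ^ Q).trans hQ
  have hpb : ∀ m (z : ℕ × (ℕ → Traj S A)), |mlmcPartial 𝓜 γ f I.H I.Bmax z.1 z.2 m ^ 2| ≤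
      (C + I.Bmax * (2 * C)) ^ 2 := fun m z => by
    rw [abs_pow]
    exact pow_le_pow_left₀ (abs_nonneg _) (abs_mlmcPartial_le 𝓜 hC hγ I.H hBm z.1 z.2 m) 2
  have hpm : ∀ m, Measurable fun z : ℕ × (ℕ → Traj S A) =>
      mlmcPartial 𝓜 γ f I.H I.Bmax z.1 z.2 m ^ 2 := fun m =>
    (hs.measurable_mlmcPartial 𝓜 hγ I.H I.Bmax m).pow_const 2
  have hz : Measurable fun x : Draw S A => (x.1, x.2.1) :=
    measurable_fst.prodMk (measurable_fst.comp measurable_snd)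
  have hxi : ∀ m, Integrable (fun x : Draw S A =>
      mlmcPartial 𝓜 γ f I.H I.Bmax x.1 x.2.1 m ^ 2) (drawLaw 𝓜 𝓟 θ) := fun m => by
    have hm : Measurable fun x : Draw S A => mlmcPartial 𝓜 γ f I.H I.Bmax x.1 x.2.1 m ^ 2 := by
      have h := (hpm m).comp hz
      exact h
    exact integrable_of_abs_le hm fun x => hpb m (x.1, x.2.1)
  set T := (n : ℝ) * (I.β * (1 / (1 - γ) ^ 2 * G₁)) with hT
  have hbound : ∀ x : Draw S A, ‖innerLoop 𝓜 γ 𝓟 f I θ w x n‖ ^ 2 ≤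
      2 * ‖w‖ ^ 2 + 2 * T ^ 2 * (M * ∑ m, mlmcPartial 𝓜 γ f I.H I.Bmax x.1 x.2.1 m ^ 2) := by
    intro x
    have h1 := hS.norm_innerLoop_le 𝓜 (f := f) hγ hG₁ hB hβ0 hβ θ w x n
    have h2 := sum_abs_sq_le (mlmcPartial 𝓜 γ f I.H I.Bmax x.1 x.2.1)
    set a := ∑ m, |mlmcPartial 𝓜 γ f I.H I.Bmax x.1 x.2.1 m| with ha
    have h3 : ‖innerLoop 𝓜 γ 𝓟 f I θ w x n‖ ≤ ‖w‖ + T * a := h1.trans (le_of_eq (by rw [hT]; ring))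
    calc _ ≤ (‖w‖ + T * a) ^ 2 := pow_le_pow_left₀ (norm_nonneg _) h3 2
      _ ≤ 2 * (‖w‖ ^ 2 + (T * a) ^ 2) := add_sq_le
      _ = 2 * ‖w‖ ^ 2 + 2 * T ^ 2 * a ^ 2 := by ring
      _ ≤ _ := by gcongr
  have hsum : Integrable (fun x : Draw S A =>
      ∑ m, mlmcPartial 𝓜 γ f I.H I.Bmax x.1 x.2.1 m ^ 2) (drawLaw 𝓜 𝓟 θ) :=
    integrable_finsetSum _ fun m _ => hxi m
  have hmul : Integrable (fun x : Draw S A => 2 * T ^ 2 *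
      (M * ∑ m, mlmcPartial 𝓜 γ f I.H I.Bmax x.1 x.2.1 m ^ 2)) (drawLaw 𝓜 𝓟 θ) :=
    (hsum.const_mul _).const_mul _
  have htot : Integrable (fun x : Draw S A => 2 * ‖w‖ ^ 2 + 2 * T ^ 2 *
      (M * ∑ m, mlmcPartial 𝓜 γ f I.H I.Bmax x.1 x.2.1 m ^ 2)) (drawLaw 𝓜 𝓟 θ) :=
    (integrable_const _).add hmul
  have h_int : ∀ m, ∫ x, mlmcPartial 𝓜 γ f I.H I.Bmax x.1 x.2.1 m ^ 2 ∂(drawLaw 𝓜 𝓟 θ) ≤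
      2 * C ^ 2 + Q * (12 * Lf ^ 2 * M / (1 - γ) ^ 2) := fun m => by
    rw [integral_drawLaw 𝓜 θ (hxi m)]
    simp only [integral_const, probReal_univ, one_smul]
    exact hs.integral_sq_mlmcPartial_le 𝓜 𝓟 hC hγ I.H hQ hQ' θ m
  calc ∫ x, ‖innerLoop 𝓜 γ 𝓟 f I θ w x n‖ ^ 2 ∂(drawLaw 𝓜 𝓟 θ)
      ≤ ∫ x, (2 * ‖w‖ ^ 2 + 2 * T ^ 2 *
        (M * ∑ m, mlmcPartial 𝓜 γ f I.H I.Bmax x.1 x.2.1 m ^ 2)) ∂(drawLaw 𝓜 𝓟 θ) :=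
        integral_mono_of_nonneg (Filter.Eventually.of_forall fun x => sq_nonneg _) htot
          (Filter.Eventually.of_forall hbound)
    _ = 2 * ‖w‖ ^ 2 + 2 * T ^ 2 * (M * ∑ m,
        ∫ x, mlmcPartial 𝓜 γ f I.H I.Bmax x.1 x.2.1 m ^ 2 ∂(drawLaw 𝓜 𝓟 θ)) := by
        rw [integral_add (integrable_const _) hmul, integral_const, integral_const_mul,
          integral_const_mul, integral_finsetSum _ fun m _ => hxi m]
        simp
    _ ≤ 2 * ‖w‖ ^ 2 + 2 * T ^ 2 * (M * ∑ _m : Fin M,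
        (2 * C ^ 2 + Q * (12 * Lf ^ 2 * M / (1 - γ) ^ 2))) := by
        gcongr with m
        exact h_int m
    _ = _ := by rw [Finset.sum_const, Finset.card_univ, Fintype.card_fin, nsmul_eq_mul]

/-- Distance of the mean of the inner loop to `(1 - γ) ω*`, in terms of the bias `η` of one step
and the contraction exponent. -/
lemma ScoreRegular.norm_integral_innerLoop_sub_le (hS : ScoreRegular 𝓟 G₁ G₂)
    (hs : SmoothOnBox f γ Lf) (hC : ∀ m, ∀ y ∈ box M γ, |partialD f m y| ≤ C)
    (hγ : γ ∈ Set.Ioo (0 : ℝ) 1) (hG₁ : 0 < G₁) (hB : I.B = 1) (hβ0 : 0 ≤ I.β)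
    (hβ : I.β ≤ (1 - γ) / G₁ ^ 2) (hQ : (2 : ℝ) ^ Q ≤ I.Bmax) (hQ' : I.Bmax < 2 ^ (Q + 1))
    {θ : Euc d} {l : ℝ} (hl0 : 0 ≤ l)
    (hl : ∀ v, l * ‖v‖ ^ 2 ≤ inner ℝ (truncFisher 𝓜 γ 𝓟 I.H θ v) v) {u : Euc d} {η : ℝ}
    (hη : ‖truncFisher 𝓜 γ 𝓟 I.H θ u - ∑ m,
      (∫ τs, partialD f m (empReturn 𝓜 γ I.H (2 ^ Q) τs) ∂(outerLaw 𝓜 𝓟 θ)) •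
        truncGrad 𝓜 γ 𝓟 I.H θ m‖ ≤ η) (w : Euc d) (n : ℕ) :
    ‖∫ x, innerLoop 𝓜 γ 𝓟 f I θ w x n ∂(drawLaw 𝓜 𝓟 θ) - u‖ ≤
      Real.exp (-(I.β * l) * n) * ‖w - u‖ + n * (I.β * η) := by
  rw [hS.integral_innerLoop 𝓜 hs hC hγ hG₁ hB hβ0 hβ hQ hQ' θ w n]
  have h := norm_linIter_sub_le hβ0 (Real.exp_pos (-(I.β * l))).le
    (Real.exp_le_one_iff.2 (by nlinarith)) (u := u)
    (A := fun _ => truncFisher 𝓜 γ 𝓟 I.H θ)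
    (fun _ v => hS.norm_sub_smul_truncFisher_le 𝓜 hG₁ hγ hβ0 hβ hl v) (fun _ => hη) w n
  rwa [← Real.exp_nat_mul, mul_comm (n : ℝ) (-(I.β * l))] at h

end InnerLoopMoments

/-! ### Sizes of the prescribed inputs -/

section Sizes

variable {𝓜 : MDP S A M} {𝓟 : PolicyClass S A d} {γ : ℝ} {f : Euc M → ℝ}
  {C G₁ G₂ μ R₀ c₁ c₂ ε : ℝ} {I : Inputs d}

/-- Lets constants be absorbed into powers of L = log(1/ε): 1 ≤ 2L, 1 ≤ 4L², 1 ≤ 8L³ and 1 ≤ 16L⁴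
account for the numerical factors below. -/
lemma half_le_log_inv (hε : ε ∈ Set.Ioc (0 : ℝ) (1 / 2)) : 1 / 2 ≤ Real.log (1 / ε) := by
  have h2 : (2 : ℝ) ≤ 1 / ε := by
    rw [le_div_iff₀ hε.1]; linarith [hε.2]
  have := Real.log_le_log two_pos h2
  linarith [Real.log_two_gt_d9]

lemma Prescribed.pow_H_le (h : Prescribed 𝓜 γ 𝓟 f C G₁ G₂ μ R₀ c₁ c₂ ε I)
    (hγ : γ ∈ Set.Ioo (0 : ℝ) 1) (hε : ε ∈ Set.Ioc (0 : ℝ) (1 / 2)) : γ ^ I.H ≤ ε ^ 2 := by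
  have hlog : 0 < Real.log (1 / γ) := Real.log_pos (by rw [lt_div_iff₀ hγ.1]; linarith [hγ.2])
  have hH : 2 * Real.log (1 / ε) / Real.log (1 / γ) ≤ I.H := by rw [h.H_eq]; exact Nat.le_ceil _
  rw [div_le_iff₀ hlog] at hH
  rw [← Real.log_le_log_iff (pow_pos hγ.1 _) (pow_pos hε.1 _), Real.log_pow, Real.log_pow]
  simp only [one_div, Real.log_inv] at hH
  push_cast
  linarith

lemma Prescribed.H_le (h : Prescribed 𝓜 γ 𝓟 f C G₁ G₂ μ R₀ c₁ c₂ ε I)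
    (hγ : γ ∈ Set.Ioo (0 : ℝ) 1) (hε : ε ∈ Set.Ioc (0 : ℝ) (1 / 2)) :
    (I.H : ℝ) ≤ (2 / Real.log (1 / γ) + 2) * Real.log (1 / ε) := by
  have hlog : 0 < Real.log (1 / γ) := Real.log_pos (by rw [lt_div_iff₀ hγ.1]; linarith [hγ.2])
  have hL := half_le_log_inv hε
  rw [h.H_eq]
  -- The 1 lost in rounding up is at most 2 log(1/ε).
  refine (Nat.ceil_lt_add_one (by positivity)).le.trans ?_
  have : 2 * Real.log (1 / ε) / Real.log (1 / γ) = 2 / Real.log (1 / γ) * Real.log (1 / ε) := by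
    ring
  linarith

lemma Prescribed.N_le (h : Prescribed 𝓜 γ 𝓟 f C G₁ G₂ μ R₀ c₁ c₂ ε I)
    (hC : 0 < C) (hG₁ : 0 < G₁) (hR₀ : 0 < R₀) (hε : ε ∈ Set.Ioc (0 : ℝ) (1 / 2)) :
    (I.N : ℝ) ≤ (4 * C * M * G₁ / (μ ^ 2 * (1 - γ) ^ 2) * (4 * |Real.log R₀| + 2) + 2) *
      Real.log (1 / ε) := by
  have hL := half_le_log_inv hε
  set x := 4 * C * M * G₁ / (μ ^ 2 * (1 - γ) ^ 2) with hx
  have hx0 : 0 ≤ x := by positivity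
  set L := Real.log (1 / ε) with hLdef
  have hlog : Real.log (R₀ ^ 2 / ε ^ 2) = 2 * Real.log R₀ + 2 * L := by
    rw [Real.log_div (by positivity) (pow_pos hε.1 2).ne', Real.log_pow, Real.log_pow, hLdef,
      one_div, Real.log_inv]
    push_cast
    ring
  have habs := le_abs_self (Real.log R₀)
  have h1 : (I.N : ℝ) ≤ x * (2 * |Real.log R₀| + 2 * L) + 1 := by
    rw [h.N_eq, ← hx, hlog]
    refine (Nat.cast_le.2 (Nat.ceil_le_ceil (b := x * (2 * |Real.log R₀| + 2 * L)) ?_)).trans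
      (Nat.ceil_lt_add_one (by positivity)).le
    gcongr
  have h2 : x * (2 * |Real.log R₀| + 2 * L) ≤ x * ((4 * |Real.log R₀| + 2) * L) := by
    gcongr
    nlinarith [abs_nonneg (Real.log R₀)]
  linarith

/-- Q is the integer part of log₂(1/ε²). The factor 4 is 2/log 2 bounded with log 2 ≥ 1/2, and 1/2^Q
≤ 2ε² follows from B_max < 2^{Q+1}. -/
lemma Prescribed.exists_maxLevel (h : Prescribed 𝓜 γ 𝓟 f C G₁ G₂ μ R₀ c₁ c₂ ε I)
    (hε : ε ∈ Set.Ioc (0 : ℝ) (1 / 2)) :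
    ∃ Q : ℕ, (2 : ℝ) ^ Q ≤ I.Bmax ∧ I.Bmax < 2 ^ (Q + 1) ∧ (Q : ℝ) ≤ 4 * Real.log (1 / ε) ∧
      1 / (2 : ℝ) ^ Q ≤ 2 * ε ^ 2 := by
  have hε0 := hε.1
  have h1 : 1 ≤ 1 / ε ^ 2 := by
    rw [le_div_iff₀ (by positivity)]
    nlinarith [hε.2]
  obtain ⟨Q, hQ, hQ'⟩ := exists_nat_pow_near h1 (one_lt_two : (1 : ℝ) < 2)
  rw [h.Bmax_eq]
  refine ⟨Q, hQ, hQ', ?_, ?_⟩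
  · have := Real.log_le_log (by positivity) hQ
    rw [one_div, Real.log_inv, Real.log_pow, Real.log_pow] at this
    rw [one_div, Real.log_inv]
    have h2 := Real.log_two_gt_d9
    push_cast at this
    nlinarith [(Nat.cast_nonneg Q : (0 : ℝ) ≤ Q)]
  · rw [div_lt_iff₀ (by positivity), pow_succ] at hQ'
    rw [div_le_iff₀ (by positivity)]
    linarith

lemma Prescribed.beta_nonneg (h : Prescribed 𝓜 γ 𝓟 f C G₁ G₂ μ R₀ c₁ c₂ ε I)
    (hγ : γ ∈ Set.Ioo (0 : ℝ) 1) (hC : 0 < C) (hG₁ : 0 < G₁) (hμ : 0 < μ) : 0 ≤ I.β := by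
  have h1 : 0 < 1 - γ := by linarith [hγ.2]
  exact le_trans (by positivity) h.β_mem.1

/-- The lower bound on β, the curvature μ/(2(1-γ)) and the prescribed N multiply to at least (1/2)
log(R₀²/ε²) = log(R₀/ε); the constants in β and N are tuned for this cancellation. -/
lemma Prescribed.exp_le (h : Prescribed 𝓜 γ 𝓟 f C G₁ G₂ μ R₀ c₁ c₂ ε I) (hM : 0 < M)
    (hγ : γ ∈ Set.Ioo (0 : ℝ) 1) (hC : 0 < C) (hG₁ : 0 < G₁) (hμ : 0 < μ) (hR₀ : 0 < R₀)
    (hε : ε ∈ Set.Ioc (0 : ℝ) (1 / 2)) :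
    Real.exp (-(I.β * (μ / (2 * (1 - γ)))) * I.N) ≤ ε / R₀ := by
  have h1 : 0 < 1 - γ := by linarith [hγ.2]
  have hM' : (0 : ℝ) < M := Nat.cast_pos.2 hM
  have hε0 := hε.1
  have hN : 4 * C * M * G₁ / (μ ^ 2 * (1 - γ) ^ 2) * Real.log (R₀ ^ 2 / ε ^ 2) ≤ I.N := by
    rw [h.N_eq]; exact Nat.le_ceil _
  have hβ := h.β_mem.1
  have hb : μ * (1 - γ) ^ 3 / (4 * C * M * G₁) * (μ / (2 * (1 - γ))) ≤
      I.β * (μ / (2 * (1 - γ))) := mul_le_mul_of_nonneg_right hβ (by positivity)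
  have key : Real.log (R₀ / ε) ≤ I.β * (μ / (2 * (1 - γ))) * I.N := by
    refine le_trans (le_of_eq ?_) ((mul_le_mul_of_nonneg_left hN (by positivity)).trans
      (mul_le_mul_of_nonneg_right hb (Nat.cast_nonneg _)))
    rw [← div_pow, Real.log_pow]
    field_simp
    push_cast
    ring
  rw [← Real.log_le_log_iff (Real.exp_pos _) (by positivity), Real.log_exp,
    ← inv_div R₀ ε, Real.log_inv]
  linarith

end Sizes

/-! ### Bias of the inner loop -/

section Bias

variable (𝓜 : MDP S A M) {𝓟 : PolicyClass S A d} {γ G₁ G₂ : ℝ} {f : Euc M → ℝ}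
  {Lf C μ : ℝ}

/-- A bound for the norm of the natural policy gradient. -/
def npgBound (M : ℕ) (γ C G₁ μ : ℝ) : ℝ := M * (C * (1 / (1 - γ) ^ 2 * G₁)) / μ

lemma FisherNondegenerate.norm_npg_le_npgBound (hF : FisherNondegenerate 𝓜 γ 𝓟 μ)
    (hS : ScoreRegular 𝓟 G₁ G₂) (hG₁ : 0 < G₁) (hγ : γ ∈ Set.Ioo (0 : ℝ) 1) (hM : 0 < M)
    (hf : ConcaveOn ℝ Set.univ f) (hs : SmoothOnBox f γ Lf)
    (hC : ∀ m, ∀ y ∈ box M γ, |partialD f m y| ≤ C) (hμ : 0 < μ) (θ : Euc d) :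
    ‖𝓜.npg γ 𝓟 f θ‖ ≤ npgBound M γ C G₁ μ :=
  (hF.norm_npg_le 𝓜 hμ (hS.hasGradientAt_objective 𝓜 hG₁ hγ hM hf hs θ)).trans
    (div_le_div_of_nonneg_right (hS.norm_gradObj_le 𝓜 hγ hC θ) hμ.le)

/-- Two sources of bias for each m: the horizon tail of the policy gradient, and the error of the
mean estimate of ∂_m f that multiplies the truncated gradient. -/
lemma ScoreRegular.norm_gradObj_sub_le (hS : ScoreRegular 𝓟 G₁ G₂) (hG₁ : 0 < G₁)
    (hγ : γ ∈ Set.Ioo (0 : ℝ) 1) (hs : SmoothOnBox f γ Lf) (hLf : 0 ≤ Lf)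
    (hC : ∀ m, ∀ y ∈ box M γ, |partialD f m y| ≤ C) (H : ℕ) {b : ℕ} (hb : 0 < b) (θ : Euc d) :
    ‖gradObj 𝓜 γ 𝓟 f θ - ∑ m,
      (∫ τs, partialD f m (empReturn 𝓜 γ H b τs) ∂(outerLaw 𝓜 𝓟 θ)) •
        truncGrad 𝓜 γ 𝓟 H θ m‖ ≤
      M * (C * (γ ^ H * (H / (1 - γ) + 1 / (1 - γ) ^ 2) * G₁) +
        Lf * Real.sqrt (2 * (M / (b * (1 - γ) ^ 2)) + 2 * (M * (γ ^ H / (1 - γ)) ^ 2)) *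
          (1 / (1 - γ) ^ 2 * G₁)) := by
  rw [gradObj, ← Finset.sum_sub_distrib]
  refine (norm_sum_le_of_le _ (n := fun _ =>
    C * (γ ^ H * (H / (1 - γ) + 1 / (1 - γ) ^ 2) * G₁) +
        Lf * Real.sqrt (2 * (M / (b * (1 - γ) ^ 2)) + 2 * (M * (γ ^ H / (1 - γ)) ^ 2)) *
          (1 / (1 - γ) ^ 2 * G₁)) fun m _ => ?_).trans (le_of_eq ?_)
  · set p := ∫ τs, partialD f m (empReturn 𝓜 γ H b τs) ∂(outerLaw 𝓜 𝓟 θ) with hp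
    set q := partialD f m (𝓜.J γ (𝓟.policy θ)) with hq
    have hpq : |p - q| ≤ _ := hs.abs_integral_partialD_sub_le 𝓜 𝓟 hLf hC hγ H hb θ m
    have hqC : |q| ≤ C := hC m _ (𝓜.J_mem_box (𝓟.policy θ) hγ)
    have e : q • gradJ 𝓜 γ 𝓟 θ m - p • truncGrad 𝓜 γ 𝓟 H θ m =
        q • (gradJ 𝓜 γ 𝓟 θ m - truncGrad 𝓜 γ 𝓟 H θ m) - (p - q) • truncGrad 𝓜 γ 𝓟 H θ m := by
      rw [smul_sub, sub_smul]; abel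
    rw [e]
    refine (norm_sub_le _ _).trans (add_le_add ?_ ?_)
    · rw [norm_smul, Real.norm_eq_abs]
      exact mul_le_mul hqC (hS.norm_gradJ_sub_truncGrad_le 𝓜 hγ θ m H) (norm_nonneg _)
        ((abs_nonneg _).trans hqC)
    · rw [norm_smul, Real.norm_eq_abs]
      exact mul_le_mul hpq (hS.norm_truncGrad_le 𝓜 hγ hG₁ θ m H) (norm_nonneg _)
        ((abs_nonneg _).trans hpq)
  · rw [Finset.sum_const, Finset.card_univ, Fintype.card_fin, nsmul_eq_mul]

/-- The variance part contributes 2·2ε² and the horizon part 2ε², hence the 6. -/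
lemma sqrt_mse_le {ε : ℝ} (hγ : γ ∈ Set.Ioo (0 : ℝ) 1) (hε : ε ∈ Set.Ioc (0 : ℝ) (1 / 2))
    {H Q : ℕ} (hH : γ ^ H ≤ ε ^ 2) (hQ : 1 / (2 : ℝ) ^ Q ≤ 2 * ε ^ 2) :
    Real.sqrt (2 * (M / ((2 ^ Q : ℕ) * (1 - γ) ^ 2)) + 2 * (M * (γ ^ H / (1 - γ)) ^ 2)) ≤
      ε * (Real.sqrt (6 * M) / (1 - γ)) := by
  have h1 : 0 < 1 - γ := by linarith [hγ.2]
  have hε0 := hε.1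
  have hH' : γ ^ H ≤ ε := hH.trans (by nlinarith [hε.2])
  rw [Real.sqrt_le_left (by positivity), mul_pow, div_pow (Real.sqrt _), Real.sq_sqrt (by positivity)]
  have e1 : (M : ℝ) / ((2 ^ Q : ℕ) * (1 - γ) ^ 2) = 1 / (2 : ℝ) ^ Q * (M / (1 - γ) ^ 2) := by
    push_cast; field_simp
  have e2 : (M : ℝ) * (γ ^ H / (1 - γ)) ^ 2 = (γ ^ H) ^ 2 * (M / (1 - γ) ^ 2) := by
    field_simp
  have e3 : ε ^ 2 * (6 * M / (1 - γ) ^ 2) = 2 * (2 * ε ^ 2 * (M / (1 - γ) ^ 2)) +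
      2 * (ε ^ 2 * (M / (1 - γ) ^ 2)) := by ring
  rw [e1, e2, e3]
  have hg := pow_nonneg hγ.1.le H
  gcongr

end Bias

/-! ### The inner loop with the prescribed inputs -/

/-- The standing assumptions on the problem. -/
structure Regular (𝓜 : MDP S A M) (𝓟 : PolicyClass S A d) (f : Euc M → ℝ)
    (γ Lf C G₁ G₂ μ : ℝ) : Prop where
  M_pos : 0 < M
  γ_mem : γ ∈ Set.Ioo (0 : ℝ) 1
  Lf_nonneg : 0 ≤ Lf
  C_pos : 0 < C
  G₁_pos : 0 < G₁
  G₂_pos : 0 < G₂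
  μ_pos : 0 < μ
  concave : ConcaveOn ℝ Set.univ f
  smooth : SmoothOnBox f γ Lf
  partialD_le : ∀ m, ∀ y ∈ box M γ, |partialD f m y| ≤ C
  score : ScoreRegular 𝓟 G₁ G₂
  fisher : FisherNondegenerate 𝓜 γ 𝓟 μ

/-- `H ≤ horizonConst · log (1/ε)`. -/
def horizonConst (γ : ℝ) : ℝ := 2 / Real.log (1 / γ) + 2

/-- `N ≤ innerConst · log (1/ε)`. -/
def innerConst (M : ℕ) (γ C G₁ μ R₀ : ℝ) : ℝ :=
  4 * C * M * G₁ / (μ ^ 2 * (1 - γ) ^ 2) * (4 * |Real.log R₀| + 2) + 2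

/-- The bias of one inner step is at most `stepBiasConst · ε log (1/ε)`. -/
def stepBiasConst (M : ℕ) (γ Lf C G₁ μ : ℝ) : ℝ :=
  M * (C * ((horizonConst γ / (1 - γ) + 2 / (1 - γ) ^ 2) * G₁) +
    Lf * (2 * (Real.sqrt (6 * M) / (1 - γ))) * (1 / (1 - γ) ^ 2 * G₁)) +
    2 * (G₁ ^ 2 * npgBound M γ C G₁ μ)

/-- The bias of the inner loop is at most `biasConst · ε log² (1/ε)`. -/
def biasConst (M : ℕ) (γ Lf C G₁ μ R₀ : ℝ) : ℝ :=
  4 * ((1 / R₀ + G₁ / Real.sqrt (μ / 2)) * (R₀ + npgBound M γ C G₁ μ)) +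
    innerConst M γ C G₁ μ R₀ * ((1 - γ) / G₁ ^ 2) * stepBiasConst M γ Lf C G₁ μ

/-- The second moment of the inner loop is at most `momentConst · log³ (1/ε)`. -/
def momentConst (M : ℕ) (γ Lf C G₁ μ R₀ : ℝ) : ℝ :=
  16 * (R₀ + npgBound M γ C G₁ μ) ^ 2 +
    2 * (innerConst M γ C G₁ μ R₀ * ((1 - γ) / G₁ ^ 2 * (1 / (1 - γ) ^ 2 * G₁))) ^ 2 *
      (M * (M * (4 * C ^ 2 + 4 * (12 * Lf ^ 2 * M / (1 - γ) ^ 2))))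

section Bounds

variable {𝓜 : MDP S A M} {𝓟 : PolicyClass S A d} {f : Euc M → ℝ}
  {γ Lf C G₁ G₂ μ R₀ c₁ c₂ ε : ℝ} {I : Inputs d}

lemma npgBound_nonneg (hC : 0 < C) (hG₁ : 0 < G₁) (hμ : 0 < μ) :
    0 ≤ npgBound M γ C G₁ μ := by
  unfold npgBound; positivity

lemma horizonConst_nonneg (hγ : γ ∈ Set.Ioo (0 : ℝ) 1) : 0 ≤ horizonConst γ := by
  have : 0 < Real.log (1 / γ) := Real.log_pos (by rw [lt_div_iff₀ hγ.1]; linarith [hγ.2])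
  unfold horizonConst; positivity

lemma innerConst_nonneg (hC : 0 < C) (hG₁ : 0 < G₁) : 0 ≤ innerConst M γ C G₁ μ R₀ := by
  unfold innerConst; positivity

lemma Regular.norm_npg_le (h : Regular 𝓜 𝓟 f γ Lf C G₁ G₂ μ) (θ : Euc d) :
    ‖𝓜.npg γ 𝓟 f θ‖ ≤ npgBound M γ C G₁ μ :=
  h.fisher.norm_npg_le_npgBound 𝓜 h.score h.G₁_pos h.γ_mem h.M_pos h.concave h.smooth
    h.partialD_le h.μ_pos θ

lemma Regular.stepBiasConst_nonneg (h : Regular 𝓜 𝓟 f γ Lf C G₁ G₂ μ) :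
    0 ≤ stepBiasConst M γ Lf C G₁ μ := by
  have h1 : 0 < 1 - γ := by linarith [h.γ_mem.2]
  have := h.C_pos
  have := h.G₁_pos
  have := h.Lf_nonneg
  have := horizonConst_nonneg h.γ_mem
  have := npgBound_nonneg (M := M) (γ := γ) h.C_pos h.G₁_pos h.μ_pos
  unfold stepBiasConst; positivity

/-- If ε²G₁² ≤ μ/2, the horizon error costs at most half of μ, and the prescribed N gives ε/R₀.
Otherwise ε is bounded below by √(μ/2)/G₁, so the trivial rate l = 0 with factor 1 ≤ εG₁/√(μ/2)
suffices. -/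
lemma Regular.exists_contraction (h : Regular 𝓜 𝓟 f γ Lf C G₁ G₂ μ)
    (hI : Prescribed 𝓜 γ 𝓟 f C G₁ G₂ μ R₀ c₁ c₂ ε I) (hR₀ : 0 < R₀)
    (hε : ε ∈ Set.Ioc (0 : ℝ) (1 / 2)) (θ : Euc d) :
    ∃ l, 0 ≤ l ∧ (∀ v, l * ‖v‖ ^ 2 ≤ inner ℝ (truncFisher 𝓜 γ 𝓟 I.H θ v) v) ∧
      Real.exp (-(I.β * l) * I.N) ≤ ε * (1 / R₀ + G₁ / Real.sqrt (μ / 2)) := by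
  have h1 : 0 < 1 - γ := by linarith [h.γ_mem.2]
  have hG := h.G₁_pos
  have hμ := h.μ_pos
  have hε0 := hε.1
  have hsq : 0 < Real.sqrt (μ / 2) := Real.sqrt_pos.2 (by positivity)
  by_cases hc : ε ^ 2 * G₁ ^ 2 ≤ μ / 2
  · refine ⟨μ / (2 * (1 - γ)), by positivity, fun v => ?_, ?_⟩
    · refine le_trans ?_ (h.fisher.le_inner_truncFisher 𝓜 h.score h.γ_mem I.H θ v)
      have hH := mul_le_mul_of_nonneg_right (hI.pow_H_le h.γ_mem hε) (sq_nonneg G₁)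
      have : μ / (2 * (1 - γ)) = (μ - μ / 2) / (1 - γ) := by field_simp; ring
      rw [this]
      gcongr
      exact hH.trans hc
    · refine (hI.exp_le h.M_pos h.γ_mem h.C_pos hG hμ hR₀ hε).trans ?_
      rw [mul_add, mul_one_div]
      exact le_add_of_nonneg_right (by positivity)
  · refine ⟨0, le_rfl, fun v => ?_, ?_⟩
    · rw [zero_mul, h.score.inner_truncFisher_eq_integral 𝓜 h.γ_mem]
      exact integral_nonneg fun τ => inner_sampleFisher_nonneg h.γ_mem I.H θ τ v
    · push Not at hc
      have h2 : Real.sqrt (μ / 2) ≤ ε * G₁ := by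
        rw [Real.sqrt_le_left (by positivity), mul_pow]
        exact hc.le
      rw [mul_zero, neg_zero, zero_mul, Real.exp_zero, mul_add, ← mul_div_assoc ε G₁]
      have := (one_le_div hsq).2 h2
      have : 0 ≤ ε * (1 / R₀) := by positivity
      linarith

/-- The exact gradient g is the intermediate point: (1-γ)ω* solves the truncated system up to the
Fisher tail, and the averaged estimate misses g by the horizon and Monte Carlo biases. -/
lemma Regular.step_bias_le (h : Regular 𝓜 𝓟 f γ Lf C G₁ G₂ μ)
    (hI : Prescribed 𝓜 γ 𝓟 f C G₁ G₂ μ R₀ c₁ c₂ ε I)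
    (hε : ε ∈ Set.Ioc (0 : ℝ) (1 / 2)) {Q : ℕ} (hQ : 1 / (2 : ℝ) ^ Q ≤ 2 * ε ^ 2) (θ : Euc d) :
    ‖truncFisher 𝓜 γ 𝓟 I.H θ ((1 - γ) • 𝓜.npg γ 𝓟 f θ) - ∑ m,
      (∫ τs, partialD f m (empReturn 𝓜 γ I.H (2 ^ Q) τs) ∂(outerLaw 𝓜 𝓟 θ)) •
        truncGrad 𝓜 γ 𝓟 I.H θ m‖ ≤
      stepBiasConst M γ Lf C G₁ μ * (ε * Real.log (1 / ε)) := by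
  have hγ := h.γ_mem
  have h1 : 0 < 1 - γ := by linarith [hγ.2]
  have hG := h.G₁_pos
  have hC := h.C_pos
  have hLf := h.Lf_nonneg
  have hε0 := hε.1
  have hL := half_le_log_inv hε
  have hW := npgBound_nonneg (M := M) (γ := γ) h.C_pos h.G₁_pos h.μ_pos
  have hH := hI.H_le hγ hε
  have hpH := hI.pow_H_le hγ hε
  have hpH' : γ ^ I.H ≤ ε := hpH.trans (by nlinarith [hε.2])
  have hgrad := h.score.hasGradientAt_objective 𝓜 hG hγ h.M_pos h.concave h.smooth θ
  have b1 := h.fisher.norm_truncFisher_npg_sub_le 𝓜 h.score hγ h.μ_pos hgrad I.H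
  have b2 := h.score.norm_gradObj_sub_le 𝓜 hG hγ h.smooth hLf h.partialD_le I.H
    (b := 2 ^ Q) (by positivity) θ
  have b3 := sqrt_mse_le (M := M) hγ hε hpH hQ
  set L := Real.log (1 / ε) with hLdef
  set g := gradObj 𝓜 γ 𝓟 f θ
  have b1' : ‖g - truncFisher 𝓜 γ 𝓟 I.H θ ((1 - γ) • 𝓜.npg γ 𝓟 f θ)‖ ≤
      ε * (2 * L * (G₁ ^ 2 * npgBound M γ C G₁ μ)) := by
    refine b1.trans ?_
    rw [norm_smul, Real.norm_of_nonneg h1.le]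
    calc _ ≤ ε * (G₁ ^ 2 / (1 - γ)) * ((1 - γ) * npgBound M γ C G₁ μ) := by
          gcongr
          exact h.norm_npg_le θ
      _ = ε * (1 * (G₁ ^ 2 * npgBound M γ C G₁ μ)) := by field_simp
      _ ≤ _ := by gcongr; linarith
  have b2' : ‖g - ∑ m, (∫ τs, partialD f m (empReturn 𝓜 γ I.H (2 ^ Q) τs) ∂(outerLaw 𝓜 𝓟 θ)) •
        truncGrad 𝓜 γ 𝓟 I.H θ m‖ ≤
      M * (C * (ε * (L * (horizonConst γ / (1 - γ) + 2 / (1 - γ) ^ 2)) * G₁) +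
        Lf * (ε * (L * (2 * (Real.sqrt (6 * M) / (1 - γ))))) *
          (1 / (1 - γ) ^ 2 * G₁)) := by
    refine b2.trans ?_
    gcongr
    · calc (I.H : ℝ) / (1 - γ) + 1 / (1 - γ) ^ 2
          ≤ (horizonConst γ * L) / (1 - γ) + (2 * L) / (1 - γ) ^ 2 := by
            gcongr
            · exact hH
            · linarith
        _ = _ := by ring
    · refine b3.trans ?_
      gcongr
      have : 0 ≤ Real.sqrt (6 * M) / (1 - γ) := by positivity
      nlinarith
  have tri := norm_sub_le_norm_sub_add_norm_sub
    (truncFisher 𝓜 γ 𝓟 I.H θ ((1 - γ) • 𝓜.npg γ 𝓟 f θ)) g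
    (∑ m, (∫ τs, partialD f m (empReturn 𝓜 γ I.H (2 ^ Q) τs) ∂(outerLaw 𝓜 𝓟 θ)) •
        truncGrad 𝓜 γ 𝓟 I.H θ m)
  rw [norm_sub_rev _ g] at tri
  refine tri.trans ((add_le_add b1' b2').trans (le_of_eq ?_))
  unfold stepBiasConst
  ring

/-- R₀ measures the distance to ω*, but the loop targets (1-γ)ω*; the difference γω* is absorbed by
`npgBound`. -/
lemma Regular.norm_start_sub_le (h : Regular 𝓜 𝓟 f γ Lf C G₁ G₂ μ)
    (hI : Prescribed 𝓜 γ 𝓟 f C G₁ G₂ μ R₀ c₁ c₂ ε I) (k : ℕ) (θ : Euc d) :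
    ‖I.ω₀ k - (1 - γ) • 𝓜.npg γ 𝓟 f θ‖ ≤ R₀ + npgBound M γ C G₁ μ := by
  have e : I.ω₀ k - (1 - γ) • 𝓜.npg γ 𝓟 f θ =
      (I.ω₀ k - 𝓜.npg γ 𝓟 f θ) + γ • 𝓜.npg γ 𝓟 f θ := by
    rw [sub_smul, one_smul]; abel
  rw [e]
  refine (norm_add_le _ _).trans (add_le_add (hI.ω₀_dist k θ) ?_)
  rw [norm_smul, Real.norm_of_nonneg h.γ_mem.1.le]
  exact (mul_le_of_le_one_left (norm_nonneg _) h.γ_mem.2.le).trans (h.norm_npg_le θ)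

lemma Regular.norm_start_le (h : Regular 𝓜 𝓟 f γ Lf C G₁ G₂ μ)
    (hI : Prescribed 𝓜 γ 𝓟 f C G₁ G₂ μ R₀ c₁ c₂ ε I) (k : ℕ) (θ : Euc d) :
    ‖I.ω₀ k‖ ≤ R₀ + npgBound M γ C G₁ μ := by
  have := norm_add_le (I.ω₀ k - 𝓜.npg γ 𝓟 f θ) (𝓜.npg γ 𝓟 f θ)
  rw [sub_add_cancel] at this
  exact this.trans (add_le_add (hI.ω₀_dist k θ) (h.norm_npg_le θ))

lemma Regular.innerLoop_bias_le (h : Regular 𝓜 𝓟 f γ Lf C G₁ G₂ μ)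
    (hI : Prescribed 𝓜 γ 𝓟 f C G₁ G₂ μ R₀ c₁ c₂ ε I) (hR₀ : 0 < R₀)
    (hε : ε ∈ Set.Ioc (0 : ℝ) (1 / 2)) (k : ℕ) (θ : Euc d) :
    ‖∫ x, innerLoop 𝓜 γ 𝓟 f I θ (I.ω₀ k) x I.N ∂(drawLaw 𝓜 𝓟 θ) -
      (1 - γ) • 𝓜.npg γ 𝓟 f θ‖ ≤
      biasConst M γ Lf C G₁ μ R₀ * (ε * Real.log (1 / ε) ^ 2) := by
  have hγ := h.γ_mem
  have h1 : 0 < 1 - γ := by linarith [hγ.2]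
  have hG := h.G₁_pos
  have hμ := h.μ_pos
  have hε0 := hε.1
  have hL := half_le_log_inv hε
  obtain ⟨Q, hQ1, hQ2, -, hQ4⟩ := hI.exists_maxLevel hε
  obtain ⟨l, hl0, hl, hexp⟩ := h.exists_contraction hI hR₀ hε θ
  have hβ0 := hI.beta_nonneg hγ h.C_pos hG hμ
  have hN := hI.N_le h.C_pos hG hR₀ hε
  have hW := npgBound_nonneg (M := M) (γ := γ) h.C_pos h.G₁_pos h.μ_pos
  have hcN := innerConst_nonneg (M := M) (γ := γ) (μ := μ) (R₀ := R₀) h.C_pos hG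
  have hcs := h.stepBiasConst_nonneg
  refine (h.score.norm_integral_innerLoop_sub_le 𝓜 h.smooth h.partialD_le hγ hG hI.B_eq hβ0
    hI.β_mem.2 hQ1 hQ2 hl0 hl (h.step_bias_le hI hε hQ4 θ) (I.ω₀ k) I.N).trans ?_
  set L := Real.log (1 / ε) with hLdef
  calc _ ≤ ε * (1 / R₀ + G₁ / Real.sqrt (μ / 2)) * (R₀ + npgBound M γ C G₁ μ) +
        (innerConst M γ C G₁ μ R₀ * L) * ((1 - γ) / G₁ ^ 2 *
          (stepBiasConst M γ Lf C G₁ μ * (ε * L))) := by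
        gcongr
        · exact h.norm_start_sub_le hI k θ
        · exact hN
        · exact hI.β_mem.2
    _ ≤ ε * (1 / R₀ + G₁ / Real.sqrt (μ / 2)) * (R₀ + npgBound M γ C G₁ μ) * (4 * L ^ 2) +
        (innerConst M γ C G₁ μ R₀ * L) * ((1 - γ) / G₁ ^ 2 *
          (stepBiasConst M γ Lf C G₁ μ * (ε * L))) := by
        refine add_le_add_left ?_ _
        -- 1 ≤ 4L², because L ≥ 1/2; both terms then have the same power of L.
        exact le_mul_of_one_le_right (by positivity) (by nlinarith)
    _ = _ := by unfold biasConst; ring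

lemma Regular.innerLoop_moment_le (h : Regular 𝓜 𝓟 f γ Lf C G₁ G₂ μ)
    (hI : Prescribed 𝓜 γ 𝓟 f C G₁ G₂ μ R₀ c₁ c₂ ε I) (hR₀ : 0 < R₀)
    (hε : ε ∈ Set.Ioc (0 : ℝ) (1 / 2)) (k : ℕ) (θ : Euc d) :
    ∫ x, ‖innerLoop 𝓜 γ 𝓟 f I θ (I.ω₀ k) x I.N‖ ^ 2 ∂(drawLaw 𝓜 𝓟 θ) ≤
      momentConst M γ Lf C G₁ μ R₀ * Real.log (1 / ε) ^ 3 := by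
  have hγ := h.γ_mem
  have h1 : 0 < 1 - γ := by linarith [hγ.2]
  have hG := h.G₁_pos
  have hμ := h.μ_pos
  have hL := half_le_log_inv hε
  obtain ⟨Q, hQ1, hQ2, hQ3, -⟩ := hI.exists_maxLevel hε
  have hβ0 := hI.beta_nonneg hγ h.C_pos hG hμ
  have hN := hI.N_le h.C_pos hG hR₀ hε
  have hW := npgBound_nonneg (M := M) (γ := γ) h.C_pos h.G₁_pos h.μ_pos
  have hcN := innerConst_nonneg (M := M) (γ := γ) (μ := μ) (R₀ := R₀) h.C_pos hG
  refine (h.score.integral_norm_sq_innerLoop_le 𝓜 h.smooth h.partialD_le hγ hG hI.B_eq hβ0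
    hI.β_mem.2 hQ1 hQ2 θ (I.ω₀ k) I.N).trans ?_
  set L := Real.log (1 / ε) with hLdef
  set K := 12 * Lf ^ 2 * M / (1 - γ) ^ 2 with hK
  have hK0 : 0 ≤ K := by positivity
  have hQK : 2 * C ^ 2 + Q * K ≤ (4 * C ^ 2 + 4 * K) * L := by
    have : (Q : ℝ) * K ≤ 4 * L * K := mul_le_mul_of_nonneg_right hQ3 hK0
    nlinarith [sq_nonneg C]
  calc _ ≤ 2 * (R₀ + npgBound M γ C G₁ μ) ^ 2 +
        2 * ((innerConst M γ C G₁ μ R₀ * L) * ((1 - γ) / G₁ ^ 2 * (1 / (1 - γ) ^ 2 * G₁))) ^ 2 *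
          (M * (M * ((4 * C ^ 2 + 4 * K) * L))) := by
        gcongr
        · exact h.norm_start_le hI k θ
        · exact hN
        · exact hI.β_mem.2
    _ ≤ 2 * (R₀ + npgBound M γ C G₁ μ) ^ 2 * (8 * L ^ 3) +
        2 * ((innerConst M γ C G₁ μ R₀ * L) * ((1 - γ) / G₁ ^ 2 * (1 / (1 - γ) ^ 2 * G₁))) ^ 2 *
          (M * (M * ((4 * C ^ 2 + 4 * K) * L))) := by
        refine add_le_add_left ?_ _
        -- 1 ≤ 8L³. The other term already has L³: two powers from N² and one from the number of
        -- levels.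
        refine le_mul_of_one_le_right (by positivity) ?_
        have := pow_le_pow_left₀ (by norm_num) hL 3
        linarith
    _ = _ := by unfold momentConst; ring

end Bounds

/-! ### Runs of the algorithm -/

section Run

variable {𝓜 : MDP S A M} {𝓟 : PolicyClass S A d} {f : Euc M → ℝ}
  {γ Lf C G₁ G₂ μ : ℝ} {I : Inputs d}
  {Ω : Type*} [MeasurableSpace Ω] {Pr : Measure Ω} {X : ℕ → Ω → Draw S A}

/-- The σ-algebra is left free so that the lemma applies both to the ambient one and to the one
generated by the draws before step k. -/
lemma Regular.measurable_iterate_of_draws (h : Regular 𝓜 𝓟 f γ Lf C G₁ G₂ μ) (hB : I.B = 1)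
    {Z : Type*} {mZ : MeasurableSpace Z} {Y : ℕ → Z → Draw S A} (k : ℕ)
    (hY : ∀ j < k, Measurable (Y j)) :
    Measurable fun z => iterate 𝓜 γ 𝓟 f I (fun j => Y j z) k := by
  induction k with
  | zero => exact measurable_const
  | succ k ih =>
    have h1 := ih fun j hj => hY j (by omega)
    have h2 := (h.score.measurable_innerLoop 𝓜 h.smooth h.γ_mem hB (I.ω₀ k) I.N).comp
      (h1.prodMk (hY k (by omega)))
    exact h1.add (h2.const_smul I.α)

lemma Regular.measurable_iterate (h : Regular 𝓜 𝓟 f γ Lf C G₁ G₂ μ) (hB : I.B = 1)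
    (hX : IsRun Pr 𝓜 γ 𝓟 f I X) (k : ℕ) :
    Measurable fun ω => iterate 𝓜 γ 𝓟 f I (fun j => X j ω) k :=
  h.measurable_iterate_of_draws hB k fun j _ => hX.1 j

/-- θ_k is a function of the past draws, so the conditional law of X_k in `IsRun`, restricted to
events {θ_k ∈ s}, identifies the joint law on rectangles. -/
lemma Regular.map_iterate_draw [IsProbabilityMeasure Pr] (h : Regular 𝓜 𝓟 f γ Lf C G₁ G₂ μ)
    (hB : I.B = 1) (hX : IsRun Pr 𝓜 γ 𝓟 f I X) (k : ℕ) :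
    Pr.map (fun ω => (iterate 𝓜 γ 𝓟 f I (fun j => X j ω) k, X k ω)) =
      (Pr.map fun ω => iterate 𝓜 γ 𝓟 f I (fun j => X j ω) k) ⊗ₘ drawKernel 𝓜 h.score := by
  have hm := h.measurable_iterate hB hX k
  have := Measure.isProbabilityMeasure_map (μ := Pr) hm.aemeasurable
  have hpair := hm.prodMk (hX.1 k)
  have := Measure.isProbabilityMeasure_map (μ := Pr) hpair.aemeasurable
  refine Measure.ext_prod fun {s t} hs ht => ?_
  rw [Measure.map_apply hpair (hs.prod ht), Measure.compProd_apply_prod hs ht,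
    setLIntegral_map hs (Kernel.measurable_coe _ ht) hm]
  refine hX.2 k _ ?_ t ht
  have hk : ∀ j < k, Measurable[⨆ j : Fin k, MeasurableSpace.comap (X j) inferInstance] (X j) :=
    fun j hj => Measurable.mono (comap_measurable _)
      (le_iSup (fun j : Fin k => MeasurableSpace.comap (X j) inferInstance) ⟨j, hj⟩) le_rfl
  exact h.measurable_iterate_of_draws hB k hk hs

lemma Regular.integral_iterate_draw [IsProbabilityMeasure Pr]
    (h : Regular 𝓜 𝓟 f γ Lf C G₁ G₂ μ) (hB : I.B = 1) (hX : IsRun Pr 𝓜 γ 𝓟 f I X) (k : ℕ)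
    {φ : Euc d × Draw S A → ℝ} (hφ : Measurable φ) {R : ℝ} (hR : ∀ z, |φ z| ≤ R) :
    ∫ ω, φ (iterate 𝓜 γ 𝓟 f I (fun j => X j ω) k, X k ω) ∂Pr =
      ∫ ω, (∫ x, φ (iterate 𝓜 γ 𝓟 f I (fun j => X j ω) k, x)
        ∂(drawLaw 𝓜 𝓟 (iterate 𝓜 γ 𝓟 f I (fun j => X j ω) k))) ∂Pr := by
  have hm := h.measurable_iterate hB hX k
  have := Measure.isProbabilityMeasure_map (μ := Pr) hm.aemeasurable
  have hpair := hm.prodMk (hX.1 k)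
  have hi : Integrable φ ((Pr.map fun ω => iterate 𝓜 γ 𝓟 f I (fun j => X j ω) k) ⊗ₘ
    drawKernel 𝓜 h.score) := integrable_of_abs_le hφ hR
  have hin : StronglyMeasurable fun θ => ∫ x, φ (θ, x) ∂(drawKernel 𝓜 h.score θ) :=
    hφ.stronglyMeasurable.integral_kernel_prod_right'
  have e := integral_map (μ := Pr) hpair.aemeasurable (hφ.aestronglyMeasurable)
  rw [h.map_iterate_draw hB hX k, Measure.integral_compProd hi,
    integral_map hm.aemeasurable hin.aestronglyMeasurable] at e
  exact e.symm

lemma Regular.measurable_integral_draw (h : Regular 𝓜 𝓟 f γ Lf C G₁ G₂ μ)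
    {φ : Euc d × Draw S A → ℝ} (hφ : Measurable φ) :
    Measurable fun θ => ∫ x, φ (θ, x) ∂(drawLaw 𝓜 𝓟 θ) := by
  have hin : StronglyMeasurable fun θ => ∫ x, φ (θ, x) ∂(drawKernel 𝓜 h.score θ) :=
    hφ.stronglyMeasurable.integral_kernel_prod_right'
  exact hin.measurable

/-- The supergradient inequality, used at both endpoints, makes f bounded on the box. -/
lemma Regular.abs_objective_sub_le (h : Regular 𝓜 𝓟 f γ Lf C G₁ G₂ μ) {x y : Euc M}
    (hx : x ∈ box M γ) (hy : y ∈ box M γ) : |f y - f x| ≤ M * (C * (1 / (1 - γ))) := by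
  have key : ∀ x ∈ box M γ, ∀ y ∈ box M γ, f y - f x ≤ M * (C * (1 / (1 - γ))) := by
    intro x hx y hy
    have hd := concave_sub_le_partialD h.concave h.M_pos
      (fun m => (h.smooth m).1 x hx) (y - x)
    rw [add_sub_cancel] at hd
    refine hd.trans ((Finset.sum_le_sum (g := fun _ => C * (1 / (1 - γ))) fun m _ => ?_).trans
      (le_of_eq (by simp)))
    refine (le_abs_self _).trans ?_
    rw [abs_mul]
    refine mul_le_mul (h.partialD_le m x hx) ?_ (abs_nonneg _) h.C_pos.le
    have h1 := hx m
    have h2 := hy m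
    rw [PiLp.sub_apply, abs_le]
    constructor <;> linarith [h1.1, h1.2, h2.1, h2.2]
  rw [abs_le]
  constructor
  · linarith [key y hy x hx]
  · exact key x hx y hy

lemma Regular.continuous_objective (h : Regular 𝓜 𝓟 f γ Lf C G₁ G₂ μ) :
    Continuous fun θ => f (𝓜.J γ (𝓟.policy θ)) :=
  continuous_iff_continuousAt.2 fun θ =>
    (h.score.hasGradientAt_objective 𝓜 h.G₁_pos h.γ_mem h.M_pos h.concave h.smooth
      θ).hasFDerivAt.continuousAt

lemma Regular.integrable_objective [IsProbabilityMeasure Pr]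
    (h : Regular 𝓜 𝓟 f γ Lf C G₁ G₂ μ) {ϑ : Ω → Euc d} (hϑ : Measurable ϑ) :
    Integrable (fun ω => f (𝓜.J γ (𝓟.policy (ϑ ω)))) Pr := by
  have hm : Measurable fun ω => f (𝓜.J γ (𝓟.policy (ϑ ω))) := by
    have := h.continuous_objective.measurable.comp hϑ
    exact this
  have h0 := 𝓜.J_mem_box (𝓟.policy 0) h.γ_mem
  refine integrable_of_abs_le hm
    (B := |f (𝓜.J γ (𝓟.policy 0))| + M * (C * (1 / (1 - γ)))) fun ω => ?_
  have := h.abs_objective_sub_le h0 (𝓜.J_mem_box (𝓟.policy (ϑ ω)) h.γ_mem)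
  have h2 := abs_add_le (f (𝓜.J γ (𝓟.policy 0)))
    (f (𝓜.J γ (𝓟.policy (ϑ ω))) - f (𝓜.J γ (𝓟.policy 0)))
  rw [add_sub_cancel] at h2
  linarith

/-- The level is drawn independently of θ, so its conditional law given the past is constant. -/
lemma map_level [IsProbabilityMeasure Pr] (hX : IsRun Pr 𝓜 γ 𝓟 f I X) (k : ℕ) :
    Pr.map (fun ω => (X k ω).1) = levelLaw := by
  ext s hs
  have hm : Measurable fun ω => (X k ω).1 := measurable_fst.comp (hX.1 k)
  have h := hX.2 k Set.univ (@MeasurableSet.univ _ _) (s ×ˢ Set.univ) (hs.prod MeasurableSet.univ)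
  have hd : ∀ θ, drawLaw 𝓜 𝓟 θ (s ×ˢ Set.univ) = levelLaw s := fun θ => by
    rw [drawLaw, Measure.prod_prod, measure_univ, mul_one]
  simp only [hd, Set.univ_inter, Measure.restrict_univ, lintegral_const, measure_univ,
    mul_one] at h
  rw [Measure.map_apply hm hs, ← h]
  congr 1
  ext ω
  simp

lemma lintegral_sampleCount_le [IsProbabilityMeasure Pr] (hX : IsRun Pr 𝓜 γ 𝓟 f I X)
    (hB : I.B = 1) {Q : ℕ} (hQ : I.Bmax < 2 ^ (Q + 1)) :
    ∫⁻ ω, (sampleCount I (fun j => X j ω) : ℝ≥0∞) ∂Pr ≤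
      ((I.K * (I.H * (Q + 1 + I.N)) : ℕ) : ℝ≥0∞) := by
  have hm : ∀ k, Measurable fun ω => (X k ω).1 := fun k => measurable_fst.comp (hX.1 k)
  have hg : Measurable fun q : ℕ => ((2 ^ truncLevel I.Bmax q : ℕ) : ℝ≥0∞) :=
    measurable_of_countable _
  have hgk : ∀ k, Measurable fun ω => ((2 ^ truncLevel I.Bmax (X k ω).1 : ℕ) : ℝ≥0∞) :=
    fun k => hg.comp (hm k)
  have hk : ∀ k, ∫⁻ ω, ((2 ^ truncLevel I.Bmax (X k ω).1 : ℕ) : ℝ≥0∞) ∂Pr ≤ Q + 1 := fun k => by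
    have h1 := lintegral_two_pow_truncLevel_le hQ
    rw [← map_level hX k, lintegral_map hg (hm k)] at h1
    exact h1
  have e : ∀ ω, (sampleCount I (fun j => X j ω) : ℝ≥0∞) = ∑ k ∈ Finset.range I.K,
      (I.H : ℝ≥0∞) * (((2 ^ truncLevel I.Bmax (X k ω).1 : ℕ) : ℝ≥0∞) + I.N) := fun ω => by
    simp only [sampleCount, hB, mul_one]
    push_cast
    rfl
  simp only [e]
  rw [lintegral_finsetSum _ fun k _ => ((hgk k).add_const _).const_mul _]
  calc _ ≤ ∑ _k ∈ Finset.range I.K, (I.H : ℝ≥0∞) * ((Q + 1) + I.N) := by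
        refine Finset.sum_le_sum fun k _ => ?_
        rw [lintegral_const_mul _ ((hgk k).add_const _), lintegral_add_right _ measurable_const]
        gcongr
        · exact hk k
        · simp
    _ = _ := by
        rw [Finset.sum_const, Finset.card_range, nsmul_eq_mul]
        push_cast
        rfl

end Run

/-! ### Convergence -/

section Convergence

variable {𝓜 : MDP S A M} {𝓟 : PolicyClass S A d} {f : Euc M → ℝ}
  {γ Lf C G₁ G₂ μ R₀ D c₁ c₂ ε εbias : ℝ} {I : Inputs d}
  {Ω : Type*} [MeasurableSpace Ω] {Pr : Measure Ω} {X : ℕ → Ω → Draw S A}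

/-- The potential argument along one run. -/
lemma Regular.sum_inner_le (h : Regular 𝓜 𝓟 f γ Lf C G₁ G₂ μ) (πs : Kernel S A)
    [IsMarkovKernel πs]
    (hD : ∫⁻ s, InformationTheory.klDiv (πs s) (𝓟.policy I.θ₀ s) ∂(𝓜.visit γ πs)
      ≤ ENNReal.ofReal D) (x : ℕ → Draw S A) (K : ℕ) :
    ∑ k ∈ Finset.range K,
      (I.α * inner ℝ (innerLoop 𝓜 γ 𝓟 f I (iterate 𝓜 γ 𝓟 f I x k) (I.ω₀ k) (x k) I.N)
          (meanScore 𝓜 πs γ 𝓟 (iterate 𝓜 γ 𝓟 f I x k)) -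
        G₂ * I.α ^ 2 *
          ‖innerLoop 𝓜 γ 𝓟 f I (iterate 𝓜 γ 𝓟 f I x k) (I.ω₀ k) (x k) I.N‖ ^ 2) ≤ max D 0 := by
  refine le_trans ?_ (h.score.integral_logRatio_le 𝓜 πs h.γ_mem I.θ₀
    (iterate 𝓜 γ 𝓟 f I x K) hD)
  induction K with
  | zero => simp [iterate, logRatio]
  | succ K ih =>
    set θ := iterate 𝓜 γ 𝓟 f I x K with hθ
    set ω := innerLoop 𝓜 γ 𝓟 f I θ (I.ω₀ K) (x K) I.N with hω
    have e : iterate 𝓜 γ 𝓟 f I x (K + 1) = θ + I.α • ω := rfl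
    have hstep := h.score.integral_logRatio_step 𝓜 πs h.G₂_pos.le h.γ_mem θ (I.α • ω)
    rw [real_inner_smul_left, norm_smul, mul_pow, Real.norm_eq_abs, sq_abs] at hstep
    -- Log-ratios add along the path of parameters, so the per-step lower bounds accumulate.
    rw [Finset.sum_range_succ, e, h.score.integral_logRatio_add 𝓜 πs h.γ_mem I.θ₀ θ]
    have : G₂ * I.α ^ 2 * ‖ω‖ ^ 2 = G₂ * (I.α ^ 2 * ‖ω‖ ^ 2) := by ring
    linarith

/-- The gap at a parameter in terms of the expected progress of one outer iteration. -/
lemma Regular.gap_le_integral (h : Regular 𝓜 𝓟 f γ Lf C G₁ G₂ μ) (πs : Kernel S A)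
    [IsMarkovKernel πs] (hbias : ∀ θ, transferError 𝓜 γ 𝓟 f πs θ ≤ εbias)
    (hI : Prescribed 𝓜 γ 𝓟 f C G₁ G₂ μ R₀ c₁ c₂ ε I) (hR₀ : 0 < R₀)
    (hε : ε ∈ Set.Ioc (0 : ℝ) (1 / 2)) (k : ℕ) (θ : Euc d) :
    f (𝓜.J γ πs) - f (𝓜.J γ (𝓟.policy θ)) ≤ Real.sqrt εbias / (1 - γ) +
      (1 - γ)⁻¹ * (∫ x, inner ℝ (innerLoop 𝓜 γ 𝓟 f I θ (I.ω₀ k) x I.N) (meanScore 𝓜 πs γ 𝓟 θ)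
        ∂(drawLaw 𝓜 𝓟 θ) +
        biasConst M γ Lf C G₁ μ R₀ * (ε * Real.log (1 / ε) ^ 2) * G₁) := by
  have h1 : 0 < 1 - γ := by linarith [h.γ_mem.2]
  have hgap := h.score.gap_le 𝓜 πs h.γ_mem h.M_pos h.concave h.smooth h.partialD_le (hbias θ)
  have hβ0 := hI.beta_nonneg h.γ_mem h.C_pos h.G₁_pos h.μ_pos
  obtain ⟨Q, hQ1, -, -, -⟩ := hI.exists_maxLevel hε
  have hBm : 0 ≤ I.Bmax := (by positivity : (0 : ℝ) ≤ 2 ^ Q).trans hQ1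
  obtain ⟨R, hR⟩ := h.score.exists_norm_innerLoop_le 𝓜 h.partialD_le h.γ_mem h.G₁_pos hI.B_eq hβ0
    hI.β_mem.2 hBm (I.ω₀ k) I.N
  have hi : Integrable (fun x => innerLoop 𝓜 γ 𝓟 f I θ (I.ω₀ k) x I.N) (drawLaw 𝓜 𝓟 θ) :=
    Integrable.of_bound (h.score.measurable_innerLoop_draw 𝓜 h.smooth h.γ_mem hI.B_eq θ
      (I.ω₀ k) I.N).aestronglyMeasurable R (Filter.Eventually.of_forall (hR θ))
  have hb := h.innerLoop_bias_le hI hR₀ hε k θ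
  set Ψ := meanScore 𝓜 πs γ 𝓟 θ with hΨ
  set w := 𝓜.npg γ 𝓟 f θ with hw
  set b := biasConst M γ Lf C G₁ μ R₀ * (ε * Real.log (1 / ε) ^ 2) with hbdef
  -- The progress is linear in the inner iterate, so only its mean enters and its variance is
  -- irrelevant here.
  have e : ∫ x, inner ℝ (innerLoop 𝓜 γ 𝓟 f I θ (I.ω₀ k) x I.N) Ψ ∂(drawLaw 𝓜 𝓟 θ) =
      inner ℝ (∫ x, innerLoop 𝓜 γ 𝓟 f I θ (I.ω₀ k) x I.N ∂(drawLaw 𝓜 𝓟 θ)) Ψ := by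
    rw [real_inner_comm, ← integral_inner hi]
    simp only [real_inner_comm]
  rw [e]
  set v := ∫ x, innerLoop 𝓜 γ 𝓟 f I θ (I.ω₀ k) x I.N ∂(drawLaw 𝓜 𝓟 θ) with hv
  have hin : inner ℝ ((1 - γ) • w - v) Ψ ≤ b * G₁ := by
    refine (real_inner_le_norm _ _).trans ?_
    rw [norm_sub_rev]
    exact mul_le_mul hb (h.score.norm_meanScore_le 𝓜 πs h.γ_mem θ) (norm_nonneg _)
      ((norm_nonneg _).trans hb)
  rw [inner_sub_left, real_inner_smul_left] at hin
  -- The loop approximates (1-γ)ω*; recovering ω* costs the factor (1-γ)⁻¹ in front of progress and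
  -- bias.
  have hfin : inner ℝ w Ψ ≤ (1 - γ)⁻¹ * (inner ℝ v Ψ + b * G₁) := by
    rw [inv_mul_eq_div, le_div_iff₀ h1]
    linarith
  linarith

lemma Regular.alpha_pos (h : Regular 𝓜 𝓟 f γ Lf C G₁ G₂ μ)
    (hI : Prescribed 𝓜 γ 𝓟 f C G₁ G₂ μ R₀ c₁ c₂ ε I) (hε : ε ∈ Set.Ioc (0 : ℝ) (1 / 2)) :
    0 < I.α := by
  have h1 : 0 < 1 - γ := by linarith [h.γ_mem.2]
  have hL := half_le_log_inv hε
  have hL' : 0 < Real.log (1 / ε) := by linarith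
  have hM' : (0 : ℝ) < M := Nat.cast_pos.2 h.M_pos
  have := h.C_pos
  have := h.G₁_pos
  have := h.G₂_pos
  have := h.μ_pos
  have := hε.1
  rw [hI.α_eq, LJ]
  positivity

/-- Integrates the gap bound conditionally on θ_k, replaces the conditional progress by the actual
progress along the run, and bounds the sum of the latter by the potential argument. -/
lemma Regular.sum_gap_le [IsProbabilityMeasure Pr] (h : Regular 𝓜 𝓟 f γ Lf C G₁ G₂ μ)
    (πs : Kernel S A) [IsMarkovKernel πs] (hbias : ∀ θ, transferError 𝓜 γ 𝓟 f πs θ ≤ εbias)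
    (hI : Prescribed 𝓜 γ 𝓟 f C G₁ G₂ μ R₀ c₁ c₂ ε I) (hR₀ : 0 < R₀)
    (hε : ε ∈ Set.Ioc (0 : ℝ) (1 / 2))
    (hD : ∫⁻ s, InformationTheory.klDiv (πs s) (𝓟.policy I.θ₀ s) ∂(𝓜.visit γ πs)
      ≤ ENNReal.ofReal D) (hX : IsRun Pr 𝓜 γ 𝓟 f I X) :
    ∑ k ∈ Finset.range I.K, (f (𝓜.J γ πs) -
      ∫ ω, f (𝓜.J γ (𝓟.policy (iterate 𝓜 γ 𝓟 f I (fun j => X j ω) k))) ∂Pr) ≤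
    I.K * (Real.sqrt εbias / (1 - γ)) + (1 - γ)⁻¹ * (max D 0 / I.α +
      I.K * (G₂ * I.α * (momentConst M γ Lf C G₁ μ R₀ * Real.log (1 / ε) ^ 3)) +
      I.K * (biasConst M γ Lf C G₁ μ R₀ * (ε * Real.log (1 / ε) ^ 2) * G₁)) := by
  have h1 : 0 < 1 - γ := by linarith [h.γ_mem.2]
  have hα := h.alpha_pos hI hε
  have hβ0 := hI.beta_nonneg h.γ_mem h.C_pos h.G₁_pos h.μ_pos
  obtain ⟨Q, hQ1, -, -, -⟩ := hI.exists_maxLevel hε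
  have hBm : 0 ≤ I.Bmax := (by positivity : (0 : ℝ) ≤ 2 ^ Q).trans hQ1
  set θ : ℕ → Ω → Euc d := fun k ω => iterate 𝓜 γ 𝓟 f I (fun j => X j ω) k with hθ
  set W : ℕ → Euc d × Draw S A → Euc d :=
    fun k z => innerLoop 𝓜 γ 𝓟 f I z.1 (I.ω₀ k) z.2 I.N with hW
  set Ψ := meanScore 𝓜 πs γ 𝓟 with hΨ
  set b := biasConst M γ Lf C G₁ μ R₀ * (ε * Real.log (1 / ε) ^ 2) * G₁ with hb
  set V := momentConst M γ Lf C G₁ μ R₀ * Real.log (1 / ε) ^ 3 with hV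
  have hθm : ∀ k, Measurable (θ k) := fun k => h.measurable_iterate hI.B_eq hX k
  have hWm : ∀ k, Measurable (W k) := fun k =>
    h.score.measurable_innerLoop 𝓜 h.smooth h.γ_mem hI.B_eq (I.ω₀ k) I.N
  have hΨm : Measurable Ψ := (h.score.continuous_meanScore 𝓜 πs h.γ_mem).measurable
  have hpair : ∀ k, Measurable fun ω => (θ k ω, X k ω) := fun k => (hθm k).prodMk (hX.1 k)
  have hRex : ∀ k, ∃ R, ∀ z : Euc d × Draw S A, ‖W k z‖ ≤ R := fun k => by
    obtain ⟨R, hR⟩ := h.score.exists_norm_innerLoop_le 𝓜 h.partialD_le h.γ_mem h.G₁_pos hI.B_eq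
      hβ0 hI.β_mem.2 hBm (I.ω₀ k) I.N
    exact ⟨R, fun z => hR z.1 z.2⟩
  choose R hR using hRex
  set φ : ℕ → Euc d × Draw S A → ℝ := fun k z => inner ℝ (W k z) (Ψ z.1) with hφ
  have hφm : ∀ k, Measurable (φ k) := fun k => (hWm k).inner (hΨm.comp measurable_fst)
  have hφb : ∀ k z, |φ k z| ≤ R k * G₁ := fun k z => by
    refine (abs_real_inner_le_norm _ _).trans ?_
    exact mul_le_mul (hR k z) (h.score.norm_meanScore_le 𝓜 πs h.γ_mem z.1) (norm_nonneg _)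
      ((norm_nonneg _).trans (hR k z))
  set ψ : ℕ → Euc d × Draw S A → ℝ := fun k z => ‖W k z‖ ^ 2 with hψ
  have hψm : ∀ k, Measurable (ψ k) := fun k => (hWm k).norm.pow_const 2
  have hψb : ∀ k z, |ψ k z| ≤ R k ^ 2 := fun k z => by
    rw [abs_of_nonneg (sq_nonneg _)]
    exact pow_le_pow_left₀ (norm_nonneg _) (hR k z) 2
  have hφi : ∀ k, Integrable (fun ω => φ k (θ k ω, X k ω)) Pr := fun k =>
    integrable_of_abs_le ((hφm k).comp (hpair k)) fun ω => hφb k _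
  have hψi : ∀ k, Integrable (fun ω => ψ k (θ k ω, X k ω)) Pr := fun k =>
    integrable_of_abs_le ((hψm k).comp (hpair k)) fun ω => hψb k _
  have hφint : ∀ k, ∫ ω, φ k (θ k ω, X k ω) ∂Pr =
      ∫ ω, ∫ x, φ k (θ k ω, x) ∂(drawLaw 𝓜 𝓟 (θ k ω)) ∂Pr := fun k =>
    h.integral_iterate_draw hI.B_eq hX k (hφm k) (hφb k)
  have hψint : ∀ k, ∫ ω, ψ k (θ k ω, X k ω) ∂Pr =
      ∫ ω, ∫ x, ψ k (θ k ω, x) ∂(drawLaw 𝓜 𝓟 (θ k ω)) ∂Pr := fun k =>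
    h.integral_iterate_draw hI.B_eq hX k (hψm k) (hψb k)
  have hψle : ∀ k, ∫ ω, ψ k (θ k ω, X k ω) ∂Pr ≤ V := fun k => by
    rw [hψint k]
    refine (integral_mono_of_nonneg (Filter.Eventually.of_forall fun ω =>
      integral_nonneg fun x => sq_nonneg _) (integrable_const V)
      (Filter.Eventually.of_forall fun ω => h.innerLoop_moment_le hI hR₀ hε k (θ k ω))).trans
      (le_of_eq (by simp))
  have hcm : ∀ k, Integrable (fun ω => ∫ x, φ k (θ k ω, x) ∂(drawLaw 𝓜 𝓟 (θ k ω))) Pr := fun k =>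
    integrable_of_abs_le ((h.measurable_integral_draw (hφm k)).comp (hθm k))
      fun ω => abs_integral_le_of_abs_le fun x => hφb k _
  have hgap : ∀ k, f (𝓜.J γ πs) - ∫ ω, f (𝓜.J γ (𝓟.policy (θ k ω))) ∂Pr ≤
      Real.sqrt εbias / (1 - γ) + (1 - γ)⁻¹ * (∫ ω, φ k (θ k ω, X k ω) ∂Pr + b) := fun k => by
    have hfi := h.integrable_objective (Pr := Pr) (hθm k)
    have e1 : f (𝓜.J γ πs) - ∫ ω, f (𝓜.J γ (𝓟.policy (θ k ω))) ∂Pr =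
        ∫ ω, (f (𝓜.J γ πs) - f (𝓜.J γ (𝓟.policy (θ k ω)))) ∂Pr := by
      rw [integral_sub (integrable_const _) hfi]
      simp
    have hsum : Integrable (fun ω => ∫ x, φ k (θ k ω, x) ∂(drawLaw 𝓜 𝓟 (θ k ω)) + b) Pr :=
      (hcm k).add (integrable_const b)
    have e2 : Real.sqrt εbias / (1 - γ) + (1 - γ)⁻¹ * (∫ ω, φ k (θ k ω, X k ω) ∂Pr + b) =
        ∫ ω, (Real.sqrt εbias / (1 - γ) + (1 - γ)⁻¹ *
          (∫ x, φ k (θ k ω, x) ∂(drawLaw 𝓜 𝓟 (θ k ω)) + b)) ∂Pr := by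
      rw [hφint k, integral_add (integrable_const _) (hsum.const_mul _), integral_const,
        integral_const_mul, integral_add (hcm k) (integrable_const b), integral_const]
      simp
    rw [e1, e2]
    exact integral_mono ((integrable_const _).sub hfi)
      ((integrable_const _).add (hsum.const_mul _))
      fun ω => h.gap_le_integral πs hbias hI hR₀ hε k (θ k ω)
  have hpot : ∑ k ∈ Finset.range I.K, (I.α * ∫ ω, φ k (θ k ω, X k ω) ∂Pr -
      G₂ * I.α ^ 2 * ∫ ω, ψ k (θ k ω, X k ω) ∂Pr) ≤ max D 0 := by
    have hterm : ∀ k, Integrable (fun ω => I.α * φ k (θ k ω, X k ω) -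
        G₂ * I.α ^ 2 * ψ k (θ k ω, X k ω)) Pr := fun k =>
      ((hφi k).const_mul _).sub ((hψi k).const_mul _)
    have e : ∑ k ∈ Finset.range I.K, (I.α * ∫ ω, φ k (θ k ω, X k ω) ∂Pr -
        G₂ * I.α ^ 2 * ∫ ω, ψ k (θ k ω, X k ω) ∂Pr) =
        ∫ ω, ∑ k ∈ Finset.range I.K, (I.α * φ k (θ k ω, X k ω) -
          G₂ * I.α ^ 2 * ψ k (θ k ω, X k ω)) ∂Pr := by
      rw [integral_finsetSum _ fun k _ => hterm k]
      refine Finset.sum_congr rfl fun k _ => ?_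
      rw [integral_sub ((hφi k).const_mul _) ((hψi k).const_mul _), integral_const_mul,
        integral_const_mul]
    rw [e]
    refine (integral_mono (integrable_finsetSum _ fun k _ => hterm k)
      (integrable_const (max D 0)) fun ω =>
        h.sum_inner_le πs hD (fun j => X j ω) I.K).trans (le_of_eq (by simp))
  have hphi : ∑ k ∈ Finset.range I.K, ∫ ω, φ k (θ k ω, X k ω) ∂Pr ≤
      max D 0 / I.α + I.K * (G₂ * I.α * V) := by
    -- The second-moment bound V replaces E‖ω_N‖²; dividing by α afterwards leaves D/α + K G₂ α V.
    have h3 : ∑ k ∈ Finset.range I.K, (I.α * ∫ ω, φ k (θ k ω, X k ω) ∂Pr -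
        G₂ * I.α ^ 2 * V) ≤ max D 0 := by
      refine le_trans (Finset.sum_le_sum fun k _ => ?_) hpot
      have := mul_le_mul_of_nonneg_left (hψle k)
        (mul_nonneg h.G₂_pos.le (sq_nonneg I.α))
      linarith
    rw [Finset.sum_sub_distrib, ← Finset.mul_sum, Finset.sum_const, Finset.card_range,
      nsmul_eq_mul] at h3
    rw [div_add' _ _ _ hα.ne', le_div_iff₀ hα]
    linarith
  refine (Finset.sum_le_sum fun k _ => hgap k).trans ?_
  rw [Finset.sum_add_distrib, ← Finset.mul_sum, Finset.sum_add_distrib, Finset.sum_const,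
    Finset.sum_const, Finset.card_range, nsmul_eq_mul, nsmul_eq_mul]
  gcongr

end Convergence

/-! ### Rates -/

section Rates

variable {𝓜 : MDP S A M} {𝓟 : PolicyClass S A d} {f : Euc M → ℝ}
  {γ Lf C G₁ G₂ μ R₀ D c₁ c₂ ε εbias : ℝ} {I : Inputs d}
  {Ω : Type*} [MeasurableSpace Ω] {Pr : Measure Ω} {X : ℕ → Ω → Draw S A}

/-- `α = stepConst · ε log (1/ε)`. -/
def stepConst (M : ℕ) (γ C G₁ G₂ μ : ℝ) : ℝ := μ / (4 * LJ M γ C G₂ * G₁ ^ 2)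

/-- The constant in the bound of the average gap. -/
def gapConst (M : ℕ) (γ Lf C G₁ G₂ μ R₀ D c₁ : ℝ) : ℝ :=
  (1 - γ)⁻¹ * (16 * (max D 0 / c₁) +
    G₂ * stepConst M γ C G₁ G₂ μ * momentConst M γ Lf C G₁ μ R₀ +
    4 * (biasConst M γ Lf C G₁ μ R₀ * G₁))

/-- The constant in the bound of the expected number of samples. -/
def sampleConst (M : ℕ) (γ C G₁ G₂ μ R₀ c₂ : ℝ) : ℝ :=
  8 * (|c₂| / stepConst M γ C G₁ G₂ μ * (horizonConst γ * (6 + innerConst M γ C G₁ μ R₀)))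

lemma Regular.biasConst_nonneg (h : Regular 𝓜 𝓟 f γ Lf C G₁ G₂ μ) (hR₀ : 0 < R₀) :
    0 ≤ biasConst M γ Lf C G₁ μ R₀ := by
  have h1 : 0 < 1 - γ := by linarith [h.γ_mem.2]
  have := h.G₁_pos
  have := h.μ_pos
  have := npgBound_nonneg (M := M) (γ := γ) h.C_pos h.G₁_pos h.μ_pos
  have := innerConst_nonneg (M := M) (γ := γ) (μ := μ) (R₀ := R₀) h.C_pos h.G₁_pos
  have := h.stepBiasConst_nonneg
  unfold biasConst
  positivity

lemma Regular.average_gap_le [IsProbabilityMeasure Pr] (h : Regular 𝓜 𝓟 f γ Lf C G₁ G₂ μ)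
    (πs : Kernel S A) [IsMarkovKernel πs] (hbias : ∀ θ, transferError 𝓜 γ 𝓟 f πs θ ≤ εbias)
    (hI : Prescribed 𝓜 γ 𝓟 f C G₁ G₂ μ R₀ c₁ c₂ ε I) (hR₀ : 0 < R₀) (hc₁ : 0 < c₁)
    (hε : ε ∈ Set.Ioc (0 : ℝ) (1 / 2))
    (hD : ∫⁻ s, InformationTheory.klDiv (πs s) (𝓟.policy I.θ₀ s) ∂(𝓜.visit γ πs)
      ≤ ENNReal.ofReal D) (hX : IsRun Pr 𝓜 γ 𝓟 f I X) :
    f (𝓜.J γ πs) - (1 / (I.K : ℝ)) * ∑ k ∈ Finset.range I.K,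
      ∫ ω, f (𝓜.J γ (𝓟.policy (iterate 𝓜 γ 𝓟 f I (fun j => X j ω) k))) ∂Pr ≤
    Real.sqrt εbias / (1 - γ) +
      gapConst M γ Lf C G₁ G₂ μ R₀ D c₁ * (ε * Real.log (1 / ε) ^ 4) := by
  have h1 : 0 < 1 - γ := by linarith [h.γ_mem.2]
  have hε0 := hε.1
  have hL := half_le_log_inv hε
  have hα := h.alpha_pos hI hε
  have hG₁ := h.G₁_pos
  have hcb := h.biasConst_nonneg hR₀
  have hK1 : c₁ / (I.α * ε) ≤ I.K := hI.K_mem.1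
  have hK : (0 : ℝ) < I.K := lt_of_lt_of_le (by positivity) hK1
  have hsum := h.sum_gap_le πs hbias hI hR₀ hε hD hX
  rw [Finset.sum_sub_distrib, Finset.sum_const, Finset.card_range, nsmul_eq_mul] at hsum
  have hα' : I.α = stepConst M γ C G₁ G₂ μ * (ε * Real.log (1 / ε)) := by
    rw [hI.α_eq, stepConst]; ring
  set T := ∑ k ∈ Finset.range I.K,
      ∫ ω, f (𝓜.J γ (𝓟.policy (iterate 𝓜 γ 𝓟 f I (fun j => X j ω) k))) ∂Pr with hT
  set L := Real.log (1 / ε) with hLdef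
  have hL2 : 1 ≤ 4 * L ^ 2 := by nlinarith
  have hL4 : 1 ≤ 16 * L ^ 4 := by nlinarith [sq_nonneg (L ^ 2)]
  have e : f (𝓜.J γ πs) - 1 / (I.K : ℝ) * T = (I.K * f (𝓜.J γ πs) - T) / I.K := by
    field_simp
  -- The lower bound on K gives αK ≥ c₁/ε, so the initial divergence contributes order ε.
  have hDK : max D 0 / (I.α * I.K) ≤ max D 0 / c₁ * ε := by
    have : c₁ / ε ≤ I.α * I.K := by
      rw [div_le_iff₀ (by positivity)] at hK1 ⊢
      linarith
    calc max D 0 / (I.α * I.K) ≤ max D 0 / (c₁ / ε) := by gcongr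
      _ = _ := by field_simp
  calc _ ≤ (I.K * (Real.sqrt εbias / (1 - γ)) + (1 - γ)⁻¹ * (max D 0 / I.α +
        I.K * (G₂ * I.α * (momentConst M γ Lf C G₁ μ R₀ * L ^ 3)) +
        I.K * (biasConst M γ Lf C G₁ μ R₀ * (ε * L ^ 2) * G₁))) / I.K := by
        rw [e]
        exact div_le_div_of_nonneg_right hsum hK.le
    _ = Real.sqrt εbias / (1 - γ) + (1 - γ)⁻¹ * (max D 0 / (I.α * I.K) +
        G₂ * I.α * (momentConst M γ Lf C G₁ μ R₀ * L ^ 3) +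
        biasConst M γ Lf C G₁ μ R₀ * (ε * L ^ 2) * G₁) := by
        field_simp
    _ ≤ Real.sqrt εbias / (1 - γ) + (1 - γ)⁻¹ * (max D 0 / c₁ * ε * (16 * L ^ 4) +
        G₂ * I.α * (momentConst M γ Lf C G₁ μ R₀ * L ^ 3) +
        biasConst M γ Lf C G₁ μ R₀ * (ε * L ^ 2) * G₁ * (4 * L ^ 2)) := by
        -- The dominant term is α L³, of order ε L⁴; the other two are padded to the same power of
        -- L.
        have i1 : max D 0 / (I.α * I.K) ≤ max D 0 / c₁ * ε * (16 * L ^ 4) :=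
          hDK.trans (le_mul_of_one_le_right (by positivity) hL4)
        have i2 : biasConst M γ Lf C G₁ μ R₀ * (ε * L ^ 2) * G₁ ≤
            biasConst M γ Lf C G₁ μ R₀ * (ε * L ^ 2) * G₁ * (4 * L ^ 2) :=
          le_mul_of_one_le_right (by positivity) hL2
        have i3 : 0 ≤ (1 - γ)⁻¹ := by positivity
        refine add_le_add_right (mul_le_mul_of_nonneg_left ?_ i3) _
        linarith
    _ = _ := by
        rw [hα', gapConst]
        ring

lemma Regular.expected_sampleCount_le [IsProbabilityMeasure Pr]
    (h : Regular 𝓜 𝓟 f γ Lf C G₁ G₂ μ)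
    (hI : Prescribed 𝓜 γ 𝓟 f C G₁ G₂ μ R₀ c₁ c₂ ε I) (hR₀ : 0 < R₀)
    (hε : ε ∈ Set.Ioc (0 : ℝ) (1 / 2)) (hX : IsRun Pr 𝓜 γ 𝓟 f I X) :
    ∫⁻ ω, (sampleCount I (fun j => X j ω) : ℝ≥0∞) ∂Pr ≤
      ENNReal.ofReal (sampleConst M γ C G₁ G₂ μ R₀ c₂ * (1 / ε ^ 2 * Real.log (1 / ε) ^ 4)) := by
  have h1 : 0 < 1 - γ := by linarith [h.γ_mem.2]
  have hε0 := hε.1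
  have hL := half_le_log_inv hε
  have hL0 : 0 < Real.log (1 / ε) := by linarith
  have hα := h.alpha_pos hI hε
  have hG₁ := h.G₁_pos
  obtain ⟨Q, -, hQ2, hQ3, -⟩ := hI.exists_maxLevel hε
  refine (lintegral_sampleCount_le hX hI.B_eq hQ2).trans ?_
  rw [← ENNReal.ofReal_natCast]
  refine ENNReal.ofReal_le_ofReal ?_
  have hα' : I.α = stepConst M γ C G₁ G₂ μ * (ε * Real.log (1 / ε)) := by
    rw [hI.α_eq, stepConst]; ring
  have hs : 0 < stepConst M γ C G₁ G₂ μ := by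
    rw [hα'] at hα
    exact pos_of_mul_pos_left hα (by positivity)
  -- The absolute value makes the constant nonnegative without a sign condition on c₂.
  have hK : (I.K : ℝ) ≤ |c₂| / (I.α * ε) := hI.K_mem.2.trans (by gcongr; exact le_abs_self c₂)
  have hH : (I.H : ℝ) ≤ horizonConst γ * Real.log (1 / ε) := hI.H_le h.γ_mem hε
  have hN : (I.N : ℝ) ≤ innerConst M γ C G₁ μ R₀ * Real.log (1 / ε) :=
    hI.N_le h.C_pos hG₁ hR₀ hε
  have hcN := innerConst_nonneg (M := M) (γ := γ) (μ := μ) (R₀ := R₀) h.C_pos hG₁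
  have hcH := horizonConst_nonneg h.γ_mem
  set L := Real.log (1 / ε) with hLdef
  have hQN : (Q : ℝ) + 1 + I.N ≤ (6 + innerConst M γ C G₁ μ R₀) * L := by linarith
  have hL3 : 1 ≤ 8 * L ^ 3 := by
    have := pow_le_pow_left₀ (by norm_num) hL 3
    linarith
  push_cast
  calc (I.K : ℝ) * (I.H * (Q + 1 + I.N))
      ≤ |c₂| / (I.α * ε) * (horizonConst γ * L * ((6 + innerConst M γ C G₁ μ R₀) * L)) := by
        gcongr
    -- One factor L from α in the denominator cancels one of the two from H and from the cost per
    -- step, leaving ε⁻²L.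
    _ = |c₂| / stepConst M γ C G₁ G₂ μ * (horizonConst γ * (6 + innerConst M γ C G₁ μ R₀)) *
        (1 / ε ^ 2 * L) := by
        rw [hα']
        field_simp
    _ ≤ |c₂| / stepConst M γ C G₁ G₂ μ * (horizonConst γ * (6 + innerConst M γ C G₁ μ R₀)) *
        (1 / ε ^ 2 * L) * (8 * L ^ 3) := le_mul_of_one_le_right (by positivity) hL3
    _ = _ := by
        rw [sampleConst]
        ring

end Rates

end MORL
end

/-! ### The final theorem. -/

open MORL MeasureTheory ProbabilityTheory in
theorem theorem1 :
    ∃ p : ℕ, ∀ (M : ℕ) (γ Lf C G₁ G₂ μ R₀ D c₁ c₂ : ℝ),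
      0 < M → γ ∈ Set.Ioo (0 : ℝ) 1 → 0 ≤ Lf → 0 < C → 0 < G₁ → 0 < G₂ → 0 < μ → 0 < R₀ →
      0 < c₁ →
    ∃ c : ℝ, ∀ (S A : Type*) [MeasurableSpace S] [MeasurableSpace A] (d : ℕ)
      (𝓜 : MDP S A M) (𝓟 : PolicyClass S A d) (f : Euc M → ℝ)
      (πstar : Kernel S A) [IsMarkovKernel πstar] (εbias : ℝ),
      ConcaveOn ℝ Set.univ f →
      SmoothOnBox f γ Lf →
      (∀ m, ∀ y ∈ box M γ, |partialD f m y| ≤ C) →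
      ScoreRegular 𝓟 G₁ G₂ →
      FisherNondegenerate 𝓜 γ 𝓟 μ →
      (∀ θ, transferError 𝓜 γ 𝓟 f πstar θ ≤ εbias) →
      ∀ (ε : ℝ), ε ∈ Set.Ioc (0 : ℝ) (1 / 2) →
      ∀ (I : Inputs d), Prescribed 𝓜 γ 𝓟 f C G₁ G₂ μ R₀ c₁ c₂ ε I →
      (∫⁻ s, InformationTheory.klDiv (πstar s) (𝓟.policy I.θ₀ s) ∂(𝓜.visit γ πstar)
        ≤ ENNReal.ofReal D) →
      ∀ (Ω : Type*) [MeasurableSpace Ω] (Pr : Measure Ω) [IsProbabilityMeasure Pr]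
        (X : ℕ → Ω → Draw S A), IsRun Pr 𝓜 γ 𝓟 f I X →
      (∀ k, Integrable
        (fun ω => f (𝓜.J γ (𝓟.policy (iterate 𝓜 γ 𝓟 f I (fun j => X j ω) k)))) Pr) ∧
      f (𝓜.J γ πstar) - (1 / (I.K : ℝ)) * ∑ k ∈ Finset.range I.K,
          ∫ ω, f (𝓜.J γ (𝓟.policy (iterate 𝓜 γ 𝓟 f I (fun j => X j ω) k))) ∂Pr
        ≤ Real.sqrt εbias / (1 - γ) + c * ε * Real.log (1 / ε) ^ p ∧
      ∫⁻ ω, (sampleCount I (fun j => X j ω) : ENNReal) ∂Pr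
        ≤ ENNReal.ofReal (c * (1 / ε ^ 2) * Real.log (1 / ε) ^ p) := by
  -- The exponent 4 comes from α times the log³ second moment; the sample bound is padded from L to
  -- L⁴ so that one exponent serves both.
  refine ⟨4, fun M γ Lf C G₁ G₂ μ R₀ D c₁ c₂ hM hγ hLf hC0 hG₁ hG₂ hμ hR₀ hc₁ =>
    ⟨max (gapConst M γ Lf C G₁ G₂ μ R₀ D c₁) (sampleConst M γ C G₁ G₂ μ R₀ c₂), ?_⟩⟩
  intro S A _ _ d 𝓜 𝓟 f πstar _ εbias hf hs hC hS hF hbias ε hε I hI hD Ω _ Pr _ X hX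
  have h : Regular 𝓜 𝓟 f γ Lf C G₁ G₂ μ :=
    ⟨hM, hγ, hLf, hC0, hG₁, hG₂, hμ, hf, hs, hC, hS, hF⟩
  have hε0 := hε.1
  have hL : 0 < Real.log (1 / ε) := by linarith [half_le_log_inv hε]
  refine ⟨fun k => h.integrable_objective (h.measurable_iterate hI.B_eq hX k), ?_, ?_⟩
  · refine (h.average_gap_le πstar hbias hI hR₀ hc₁ hε hD hX).trans ?_
    rw [mul_assoc (max _ _)]
    gcongr
    exact le_max_left _ _
  · refine (h.expected_sampleCount_le hI hR₀ hε hX).trans (ENNReal.ofReal_le_ofReal ?_)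
    rw [mul_assoc (max _ _)]
    gcongr
    exact le_max_right _ _
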